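/- Regard $\mathbb S^3$ as the unit sphere of the quaternions $\mathbb H=\mathbb R^4$ and let $\mathbb S^3\times\mathbb S^3$ carry its homogeneous nearly Kähler structure: for $Z=(U,V)\in T_{(p,q)}(\mathbb S^3\times\mathbb S^3)$, $$J(U,V)=\tfrac1{\sqrt3}\,(2pq^{-1}V-U,\,-2qp^{-1}U+V),\qquad g(Z,Z')=\tfrac12\big(\langle Z,Z'\rangle+\langle JZ,JZ'\rangle\big),$$ where $\langle\cdot,\cdot\rangle$ is the Euclidean product metric. Let $\tilde\nabla$ be the Levi-Civita connection of $g$, $G=\tilde\nabla J$, and $P(U,V)=(pq^{-1}V,qp^{-1}U)$. Let $M$ be a connected smooth $3$-manifold and $f=(p,q):M\to\mathbb S^3\times\mathbb S^3$ a smooth Lagrangian immersion (that is, $g(J\,df(X),df(Y))=0$ for all tangent vectors $X,Y$ at the same point) which is not totally geodesic with respect to $g$, and such that $p$ has nowhere maximal rank, i.e. $\operatorname{rank} dp_x<3$ for all $x\in M$. Tangent vectors $X$ of $M$ are identified with $df(X)$. An adapted frame at $x\in M$ is a $g$-orthonormal basis $E_1,E_2,E_3$ of $T_xM$ together with a number $\Lambda$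 such that $PE_i=\cos(2\theta_i)E_i+\sin(2\theta_i)JE_i$ with $2\theta_1=\frac{2\pi}3$, $2\theta_2=2\Lambda+\frac{2\pi}3$, $2\theta_3=-2\Lambda+\frac{2\pi}3$, and $JG(E_1,E_2)=\frac1{\sqrt3}E_3$, $JG(E_2,E_3)=\frac1{\sqrt3}E_1$, $JG(E_3,E_1)=\frac1{\sqrt3}E_2$. Put $v_2=dp(E_2)$, $v_3=dp(E_3)$, $\xi=\frac1{\sqrt3}E_1-JE_1$. Then: 1. $p(M)$ is a (branched) minimal surface in $\mathbb S^3$, in the following sense. The set $M_0$ of the points at which $dp$ has rank $2$ is open and dense in $M$, and $dp=0$ at every point outside $M_0$. Every point of $M_0$ has an open neighbourhood $V$ on which $p=\varphi\circ\pi$, where $\pi$ is a smooth submersion of $V$ onto an open set $D\subset\mathbb R^2$ and $\varphi:D\to\mathbb S^3$ is a smooth minimal immersion with a smooth unit normal field $N$ in $\mathbb S^3$; in particular $p(V)=\varphi(D)$. 2. At every point of $M$ there is an adapted frame with $0\le\Lambda\le\frac\pi2$. For each adapted frame at a point $x$, one has $x\in M_0$ if and only if $\sin\Lambda\ne0$;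 the vector $\xi$ is tangent to the first factor of $\mathbb S^3\times\mathbb S^3$; and if $\sin\Lambda\neq0$, then the matrix $$\tilde P(x)=\Big(p(x)\ \ \tfrac{v_2}{\sin\Lambda}\ \ \tfrac{v_3}{\sin\Lambda}\ \ \xi\Big)$$ belongs to $SO(4)$ and, for each local representation $p|_V=\varphi\circ\pi$ as in 1 with $x\in V$, it lies over $\pi(x)$ in the frame bundle of the minimal surface $\varphi$, for one of its two unit normals $\pm N$: its second and third columns are tangent to $\varphi$ at $\pi(x)$, and $\xi=\pm N(\pi(x))$. 3. If, moreover, $V$ is connected and the adapted frames $E_1,E_2,E_3$ form a smooth frame field on $V$, then the sign in 2 is the same on all of $V$, so that $\tilde P$ maps $V$ into the frame bundle of the surface oriented by one unit normal, $N$ or $-N$, and $\xi$ is that unit normal. -/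

import Mathlib

open scoped Manifold ContDiff Quaternion

namespace NKS3

/-! ### The nearly Kähler structure of the product of two unit spheres of quaternions

Tangent vectors at `x = (p, q)` are pairs `Z = (U, V)` of quaternions with `U ⟂ p`, `V ⟂ q`. -/

/-- Pairs of quaternions: the Euclidean space which contains the product of the unit spheres. -/
abbrev HH : Type := ℍ[ℝ] × ℍ[ℝ]

/-- The usual Euclidean product metric. -/
noncomputable def euclid (Z W : HH) : ℝ := inner ℝ Z.1 W.1 + inner ℝ Z.2 W.2

/-- The almost complex structure `J (U, V) = (1/√3) (2 p q⁻¹ V - U, -2 q p⁻¹ U + V)`. -/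
noncomputable def J (x Z : HH) : HH :=
  (1 / Real.sqrt 3) •
    ((2 : ℝ) • (x.1 * x.2⁻¹ * Z.2) - Z.1, -((2 : ℝ) • (x.2 * x.1⁻¹ * Z.1)) + Z.2)

/-- The nearly Kähler metric, the Hermitian metric associated with the Euclidean one. -/
noncomputable def g (x Z W : HH) : ℝ := (1 / 2) * (euclid Z W + euclid (J x Z) (J x W))

/-- The almost product structure `P (U, V) = (p q⁻¹ V, q p⁻¹ U)`. -/
noncomputable def P (x Z : HH) : HH := (x.1 * x.2⁻¹ * Z.2, x.2 * x.1⁻¹ * Z.1)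

/-! ### The Levi-Civita connection of the nearly Kähler metric

It is written in the left-invariant trivialisation: the pair `a = (α, β)` of imaginary quaternions
stands for the tangent vector `(p α, q β)` at `(p, q)`, and, with `a` fixed, for the left-invariant
vector field `(p, q) ↦ (p α, q β)`. -/

/-- The value at `x` of the left-invariant vector field given by `a`. -/
noncomputable def leftVec (x a : HH) : HH := (x.1 * a.1, x.2 * a.2)

/-- The left-invariant coordinates of the tangent vector `Z` at `x`. -/
noncomputable def leftCoord (x Z : HH) : HH := (x.1⁻¹ * Z.1, x.2⁻¹ * Z.2)

/-- The cross product of imaginary quaternions. -/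
noncomputable def cross (a b : ℍ[ℝ]) : ℍ[ℝ] := (1 / 2 : ℝ) • (a * b - b * a)

/-- The Levi-Civita connection on left-invariant vector fields: `Γ a b` is the left-invariant field
`∇_a b`. See `g_leftVec`, `Gam_torsion` and `Gam_metric`, which characterise it. -/
noncomputable def Gam (a b : HH) : HH :=
  (cross a.1 b.1 - (1 / 3 : ℝ) • cross a.1 b.2 + (1 / 3 : ℝ) • cross a.2 b.1,
   cross a.2 b.2 + (1 / 3 : ℝ) • cross a.1 b.2 - (1 / 3 : ℝ) • cross a.2 b.1)

/-- The metric is left-invariant. -/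
theorem g_leftVec (x a b : HH) (h1 : ‖x.1‖ = 1) (h2 : ‖x.2‖ = 1) :
    g x (leftVec x a) (leftVec x b) = g (1, 1) a b := by
  have hp : x.1 ≠ 0 := by
    intro h
    simp [h] at h1
  have hq : x.2 ≠ 0 := by
    intro h
    simp [h] at h2
  have key : ∀ u : ℍ[ℝ], ‖u‖ = 1 → ∀ c d : ℍ[ℝ], inner ℝ (u * c) (u * d) = inner ℝ c d := by
    intro u hu c d
    have hn : Quaternion.normSq u = 1 := by
      rw [Quaternion.normSq_eq_norm_mul_self, hu, one_mul]
    rw [Quaternion.normSq_def'] at hn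
    simp only [Quaternion.inner_def, Quaternion.re_mul, Quaternion.imI_mul, Quaternion.imJ_mul,
      Quaternion.imK_mul, Quaternion.re_star, Quaternion.imI_star, Quaternion.imJ_star,
      Quaternion.imK_star]
    linear_combination (c.re * d.re + c.imI * d.imI + c.imJ * d.imJ + c.imK * d.imK) * hn
  have hJ : ∀ a : HH, J x (leftVec x a) = leftVec x (J (1, 1) a) := by
    intro a
    ext1
    · simp only [J, leftVec, mul_assoc, inv_mul_cancel_left₀ hq, inv_one, one_mul,
        Prod.smul_fst, mul_smul_comm, mul_sub]
    · simp only [J, leftVec, mul_assoc, inv_mul_cancel_left₀ hp, inv_one, one_mul,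
        Prod.smul_snd, mul_smul_comm, mul_add, mul_neg]
  have hE : ∀ a b : HH, euclid (leftVec x a) (leftVec x b) = euclid a b := by
    intro a b
    simp only [euclid, leftVec, key _ h1, key _ h2]
  rw [g, g, hJ, hJ, hE, hE]

/-- The connection is torsion free: `∇_a b - ∇_b a` is the Lie bracket `[a, b]`
of left-invariant fields. -/
theorem Gam_torsion (a b : HH) :
    Gam a b - Gam b a = (a.1 * b.1 - b.1 * a.1, a.2 * b.2 - b.2 * a.2) := by
  ext <;> simp [Gam, cross] <;> ring

/-- The connection is metric (the functions `g b c` are constant on left-invariant fields). -/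
theorem Gam_metric (a b c : HH) : g (1, 1) (Gam a b) c + g (1, 1) b (Gam a c) = 0 := by
  have h3 : (Real.sqrt 3)⁻¹ * (Real.sqrt 3)⁻¹ = 1 / 3 := by
    rw [← mul_inv, Real.mul_self_sqrt (by norm_num)]
    norm_num
  have hJ : ∀ u v : HH, euclid (J (1, 1) u) (J (1, 1) v) = (1 / 3) *
      euclid ((2 : ℝ) • u.2 - u.1, -((2 : ℝ) • u.1) + u.2)
        ((2 : ℝ) • v.2 - v.1, -((2 : ℝ) • v.1) + v.2) := by
    intro u v
    simp only [euclid, J, Prod.smul_fst, Prod.smul_snd, inner_smul_left, inner_smul_right,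
      inv_one, one_mul, conj_trivial, one_div]
    linear_combination (inner ℝ ((2 : ℝ) • u.2 - u.1) ((2 : ℝ) • v.2 - v.1)
      + inner ℝ (-((2 : ℝ) • u.1) + u.2) (-((2 : ℝ) • v.1) + v.2)) * h3
  rw [g, g, hJ, hJ]
  simp [euclid, Gam, cross, Quaternion.inner_def]
  ring

/-- `∇_Z W` at `x`, where `W` is extended to a left-invariant vector field. -/
noncomputable def conn (x Z W : HH) : HH := leftVec x (Gam (leftCoord x Z) (leftCoord x W))

/-- The tensor `G = ∇ J`, `G (Z, W) = (∇_Z J) W`; note that `J` maps left-invariant vector fields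
to left-invariant vector fields. -/
noncomputable def G (x Z W : HH) : HH := conn x Z (J x W) - J x (conn x Z W)

/-! ### Lagrangian immersions of 3-manifolds -/

section Immersions

variable {M : Type*} [TopologicalSpace M] [ChartedSpace (EuclideanSpace ℝ (Fin 3)) M]

/-- The differential at `x` of a map from a 3-manifold to a normed space. -/
noncomputable def diff {E : Type*} [NormedAddCommGroup E] [NormedSpace ℝ E] (F : M → E) (x : M) :
    TangentSpace (𝓡 3) x →L[ℝ] E :=
  mfderiv (𝓡 3) 𝓘(ℝ, E) F x

/-- `f = (p, q)` is a smooth Lagrangian immersion of the 3-manifold `M` into the product of the two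
unit spheres, with the nearly Kähler structure `(g, J)`. -/
structure IsLagrangianImmersion (f : M → HH) : Prop where
  smooth : ContMDiff (𝓡 3) 𝓘(ℝ, HH) ∞ f
  norm_fst : ∀ x, ‖(f x).1‖ = 1
  norm_snd : ∀ x, ‖(f x).2‖ = 1
  immersion : ∀ x, Function.Injective (diff f x)
  lagrangian : ∀ x (X Y : TangentSpace (𝓡 3) x), g (f x) (J (f x) (diff f x X)) (diff f x Y) = 0

/-- The covariant derivative at `x`, in the direction `X`, of the vector field `W` along `f`, for
the Levi-Civita connection of the nearly Kähler metric. -/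
noncomputable def covDeriv (f W : M → HH) (x : M) (X : TangentSpace (𝓡 3) x) : HH :=
  leftVec (f x) (diff (fun y => leftCoord (f y) (W y)) x X
    + Gam (leftCoord (f x) (diff f x X)) (leftCoord (f x) (W x)))

/-- The immersion `f` is totally geodesic: for all smooth vector fields `Y` on `M` and all tangent
vectors `X`, the covariant derivative of `df(Y)` in the direction `X` is tangent to the immersion
(that is, the second fundamental form vanishes identically). -/
def IsTotallyGeodesic [IsManifold (𝓡 3) ∞ M] (f : M → HH) : Prop :=
  ∀ Y : (x : M) → TangentSpace (𝓡 3) x,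
    ContMDiff (𝓡 3) (𝓡 3).tangent ∞ (fun x => (⟨x, Y x⟩ : TangentBundle (𝓡 3) M)) →
    ∀ (x : M) (X : TangentSpace (𝓡 3) x),
      covDeriv f (fun y => diff f y (Y y)) x X ∈ Set.range (diff f x)

/-- The first component `p` of `f = (p, q)`. -/
def fstMap (f : M → HH) : M → ℍ[ℝ] := fun x => (f x).1

/-- The rank at `x` of a map from a 3-manifold to the unit sphere of the quaternions. -/
noncomputable def rankAt (p : M → ℍ[ℝ]) (x : M) : ℕ :=
  Module.finrank ℝ (LinearMap.range (diff p x : TangentSpace (𝓡 3) x →ₗ[ℝ] ℍ[ℝ]))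

/-- The map `p` into the 3-sphere has nowhere maximal rank. -/
def NowhereMaximalRank (p : M → ℍ[ℝ]) : Prop := ∀ x, rankAt p x < 3

/-! ### Minimal surfaces in the 3-sphere -/

/-- The coordinate plane. -/
abbrev Plane : Type := EuclideanSpace ℝ (Fin 2)

/-- The second fundamental form at `z`, in the direction of the unit normal `N z`, of the surface
`φ` in the 3-sphere. -/
noncomputable def sigma (φ N : Plane → ℍ[ℝ]) (z u v : Plane) : ℝ :=
  inner ℝ (fderiv ℝ (fun w => fderiv ℝ φ w v) z u) (N z)

/-- `φ : D → S³` is an immersed minimal surface with (smooth) unit normal `N`: the trace of its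
second fundamental form, with respect to the induced metric, vanishes. -/
structure IsMinimalSurface (D : Set Plane) (φ N : Plane → ℍ[ℝ]) : Prop where
  isOpen : IsOpen D
  smooth : ContDiffOn ℝ ∞ φ D
  norm_eq : ∀ z ∈ D, ‖φ z‖ = 1
  immersion : ∀ z ∈ D, Function.Injective (fderiv ℝ φ z)
  normal_smooth : ContDiffOn ℝ ∞ N D
  normal_norm : ∀ z ∈ D, ‖N z‖ = 1
  normal_sphere : ∀ z ∈ D, inner ℝ (N z) (φ z) = 0
  normal_surface : ∀ z ∈ D, ∀ u, inner ℝ (N z) (fderiv ℝ φ z u) = 0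
  minimal : ∀ z ∈ D, ∀ u v : Plane,
    ‖fderiv ℝ φ z u‖ = 1 → ‖fderiv ℝ φ z v‖ = 1 →
    inner ℝ (fderiv ℝ φ z u) (fderiv ℝ φ z v) = 0 →
    sigma φ N z u u + sigma φ N z v v = 0

/-- On the open set `V`, the map `p` is a submersion `π` of `V` onto `D`, followed by the minimal
immersion `φ : D → S³` with unit normal `N`. In particular `p(V) = φ(D)`. -/
structure IsLocalSurface (p : M → ℍ[ℝ]) (V : Set M) (D : Set Plane) (φ N : Plane → ℍ[ℝ])
    (π : M → Plane) : Prop where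
  isOpen : IsOpen V
  surface : IsMinimalSurface D φ N
  smooth : ContMDiffOn (𝓡 3) 𝓘(ℝ, Plane) ∞ π V
  submersion : ∀ y ∈ V, Function.Surjective (diff π y)
  image_eq : π '' V = D
  factor : ∀ y ∈ V, p y = φ (π y)

/-- The set of the points at which `p` has rank two. -/
def regularSet (p : M → ℍ[ℝ]) : Set M := {x | rankAt p x = 2}

/-- `p(M)` is a (branched) minimal surface in the 3-sphere: off a closed nowhere dense set of
singular points, where `dp` vanishes, `p` has rank two and is locally a submersion onto an immersed
minimal surface. -/
structure IsBranchedMinimalSurface (p : M → ℍ[ℝ]) : Prop where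
  isOpen : IsOpen (regularSet p)
  dense : Dense (regularSet p)
  singular : ∀ x, x ∉ regularSet p → diff p x = 0
  regular : ∀ x ∈ regularSet p, ∃ (V : Set M) (D : Set Plane) (φ N : Plane → ℍ[ℝ])
    (π : M → Plane), x ∈ V ∧ IsLocalSurface p V D φ N π

/-- The coordinates of a quaternion in the basis `1, i, j, k`. -/
def quatCoord (a : ℍ[ℝ]) : Fin 4 → ℝ := ![a.re, a.imI, a.imJ, a.imK]

/-- The matrix with columns `a, b, c, d`. -/
def frameMatrix (a b c d : ℍ[ℝ]) : Matrix (Fin 4) (Fin 4) ℝ :=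
  Matrix.of fun i j => quatCoord (![a, b, c, d] j) i

/-- The fibre over `z` of the frame bundle in `SO(4)` of the surface `φ` with unit normal `N`: the
matrices `(φ, w, w', N)` in `SO(4)` for which `w` and `w'` are tangent to the surface. (So `w` is a
unit tangent vector, and `w'` is its image under the rotation by a right angle.) -/
def frameFiber (φ N : Plane → ℍ[ℝ]) (z : Plane) : Set (Matrix (Fin 4) (Fin 4) ℝ) :=
  {A | A ∈ Matrix.specialOrthogonalGroup (Fin 4) ℝ ∧
    ∃ u u' : Plane, A = frameMatrix (φ z) (fderiv ℝ φ z u) (fderiv ℝ φ z u') (N z)}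

/-! ### The adapted frames of the Lagrangian immersion -/

/-- The doubles `2θ₁, 2θ₂, 2θ₃` of the angle functions. -/
noncomputable def doubleAngle (Λ : ℝ) : Fin 3 → ℝ :=
  ![2 * Real.pi / 3, 2 * Λ + 2 * Real.pi / 3, -2 * Λ + 2 * Real.pi / 3]

/-- `e = (E₁, E₂, E₃)` is an orthonormal basis of the tangent space at `x` with
`P E_i = cos (2θ_i) E_i + sin (2θ_i) J E_i` and `J G (E_i, E_j) = (1/√3) ε_{ijk} E_k`,
with the angles `2θ_i` given by `Λ`. -/
structure IsAdaptedFrame (f : M → HH) (x : M) (e : Fin 3 → TangentSpace (𝓡 3) x) (Λ : ℝ) :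
    Prop where
  orthonormal : ∀ i j, g (f x) (diff f x (e i)) (diff f x (e j)) = if i = j then 1 else 0
  eigen : ∀ i, P (f x) (diff f x (e i)) =
    Real.cos (doubleAngle Λ i) • diff f x (e i) + Real.sin (doubleAngle Λ i) • J (f x) (diff f x (e i))
  orient₁₂ : J (f x) (G (f x) (diff f x (e 0)) (diff f x (e 1))) =
    (1 / Real.sqrt 3) • diff f x (e 2)
  orient₂₃ : J (f x) (G (f x) (diff f x (e 1)) (diff f x (e 2))) =
    (1 / Real.sqrt 3) • diff f x (e 0)
  orient₃₁ : J (f x) (G (f x) (diff f x (e 2)) (diff f x (e 0))) =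
    (1 / Real.sqrt 3) • diff f x (e 1)

/-- The vector `ξ = (1/√3) E₁ - J E₁`, tangent to the product of the two spheres. -/
noncomputable def xi (f : M → HH) (x : M) (e : Fin 3 → TangentSpace (𝓡 3) x) : HH :=
  (1 / Real.sqrt 3) • diff f x (e 0) - J (f x) (diff f x (e 0))

/-- The matrix `(p, v₂ / sin Λ, v₃ / sin Λ, ξ)` with `v₂ = dp(E₂)`, `v₃ = dp(E₃)`; here `ξ` stands
for its component in the first factor. -/
noncomputable def liftMatrix (f : M → HH) (x : M) (e : Fin 3 → TangentSpace (𝓡 3) x) (Λ : ℝ) :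
    Matrix (Fin 4) (Fin 4) ℝ :=
  frameMatrix (fstMap f x) ((Real.sin Λ)⁻¹ • diff (fstMap f) x (e 1))
    ((Real.sin Λ)⁻¹ • diff (fstMap f) x (e 2)) (xi f x e).1

end Immersions

end NKS3

/-!
The differential of `f = (p, q)` is described by the left-trivialised forms `a = p⁻¹ dp` and
`b = q⁻¹ dq`, with values in the imaginary quaternions. In these terms `f` is Lagrangian if and only
if `⟨b X, a Y⟩` is symmetric in `X` and `Y`. Differentiating this symmetry and using the
Maurer–Cartan equations for `a` and `b` gives a second, cubic condition, which says that the Kähler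
form is closed along `f` (`IsLagrangianPatch.isLagrangianPair`).

*Linear algebra.* If `a` is not injective, these two conditions force `a` to have rank two or zero
(`IsLagrangianPair.finrank_ker`), and there is a frame in which `a` and `b` take the normal form
`IsNormalFrame`: for an orthonormal frame `(w, u, v)` of the imaginary quaternions with `w = u × v`,
the values of `a` are `0`, `sin Λ u`, `sin Λ v`. Such frames are the adapted frames
(`normalFrame_of_adaptedFrame`, `adaptedFrame_of_normalFrame`).

*Minimality.* Near a point of rank two there are coordinates in which the kernel of `dp` is a
coordinate direction `t`, so that `p` depends on the other two variables only; the unit normal of the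
surface is the direction of `p b(t)`. The cubic condition says that the trace of `b`, taken relative
to `a`, is constant along the surface. Its derivative in the direction `t` is, by the Maurer–Cartan
equation, the trace of the derivative of `b(t)`, that is, the mean curvature
(`IsLagrangianPatch.inner_fderiv_add_eq_zero`, `IsLagrangianPatch.isMinimalSurface`,
`IsLagrangianPatch.exists_local_surface`).

*Density of the regular points.* Where `dp = 0`, the map `q` is a local diffeomorphism, and the
inverse Cayley transform of `q` gives coordinates `y` with `q = q₀ (1 - y)⁻¹ (1 + y)`. The twisted
components `(1 + y) a(∂ᵢ) (1 - y)` of `a` form a symmetric matrix (`twist_symm`). Its trace is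
quadratic in its entries (`twist_trace`), and by the Maurer–Cartan equation the exterior derivatives
of its columns are bounded by its entries. For a symmetric matrix, the Dirac operator
`i ∂₁ + j ∂₂ + k ∂₃` applied to a column involves only these exterior derivatives and the gradient of
the trace, so each column satisfies a Dirac type differential inequality (`norm_dirac_twist_le`). The
Carleman inequality with the weight `exp (τ / |x|²)` (`carleman`) then gives unique continuation on
balls of definite size (`unique_continuation`, `mc_eq_zero_of_eventually`), so that the set of the
points near which `dp = 0` is open and closed (`isClosed_interior_fstForm_eq_zero`). As `M` is
connected, it is empty or all of `M`; in the second case `f(M)` lies in a fibre `{p} × S³`, and `f` is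
totally geodesic (`isTotallyGeodesic_of_fstForm_eq_zero`).

*The lift.* In a normal frame `ξ = (p w, 0)` (`xi_eq`), and for `sin Λ ≠ 0` the lift is the matrix
`(p, p u, p v, p w)`, which is in `SO(4)`. As `p u` and `p v` are tangent to the surface, `p w` is one
of the two unit normals (`xi_eq_normal`). Along a smooth frame field on a connected set, the inner
product of `ξ` and `N` is a continuous function with values `1` and `-1`, hence constant.
-/

namespace NKS3

/-! ### Quaternions as scalars and vectors -/

theorem inner_eq (a b : ℍ[ℝ]) :
    inner ℝ a b = a.re * b.re + a.imI * b.imI + a.imJ * b.imJ + a.imK * b.imK := by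
  simp [Quaternion.inner_def]

theorem norm_sq_eq (a : ℍ[ℝ]) :
    ‖a‖ ^ 2 = a.re ^ 2 + a.imI ^ 2 + a.imJ ^ 2 + a.imK ^ 2 := by
  rw [← real_inner_self_eq_norm_sq, inner_eq]; ring

@[simp] theorem cross_re (a b : ℍ[ℝ]) : (cross a b).re = 0 := by simp [cross]; ring
@[simp] theorem cross_imI (a b : ℍ[ℝ]) :
    (cross a b).imI = a.imJ * b.imK - a.imK * b.imJ := by simp [cross]; ring
@[simp] theorem cross_imJ (a b : ℍ[ℝ]) :
    (cross a b).imJ = a.imK * b.imI - a.imI * b.imK := by simp [cross]; ring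
@[simp] theorem cross_imK (a b : ℍ[ℝ]) :
    (cross a b).imK = a.imI * b.imJ - a.imJ * b.imI := by simp [cross]; ring

theorem cross_add_left (a b c : ℍ[ℝ]) : cross (a + b) c = cross a c + cross b c := by
  ext <;> simp <;> ring
theorem cross_add_right (a b c : ℍ[ℝ]) : cross a (b + c) = cross a b + cross a c := by
  ext <;> simp <;> ring
theorem cross_sub_right (a b c : ℍ[ℝ]) : cross a (b - c) = cross a b - cross a c := by
  ext <;> simp <;> ring
theorem cross_smul_left (r : ℝ) (a b : ℍ[ℝ]) : cross (r • a) b = r • cross a b := by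
  ext <;> simp <;> ring
theorem cross_smul_right (r : ℝ) (a b : ℍ[ℝ]) : cross a (r • b) = r • cross a b := by
  ext <;> simp <;> ring
theorem cross_anticomm (a b : ℍ[ℝ]) : cross b a = -cross a b := by
  ext <;> simp <;> ring
@[simp] theorem cross_self (a : ℍ[ℝ]) : cross a a = 0 := by
  ext <;> simp <;> ring
@[simp] theorem cross_zero_left (a : ℍ[ℝ]) : cross 0 a = 0 := by
  ext <;> simp
@[simp] theorem cross_zero_right (a : ℍ[ℝ]) : cross a 0 = 0 := by
  ext <;> simp

theorem two_smul_cross (a b : ℍ[ℝ]) : (2 : ℝ) • cross a b = a * b - b * a := by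
  rw [cross, smul_smul]; norm_num

theorem inner_cross_cyc (a b c : ℍ[ℝ]) : inner ℝ a (cross b c) = inner ℝ b (cross c a) := by
  simp only [inner_eq, cross_re, cross_imI, cross_imJ, cross_imK]; ring

theorem inner_cross_self_left (a b : ℍ[ℝ]) : inner ℝ a (cross a b) = 0 := by
  simp only [inner_eq, cross_re, cross_imI, cross_imJ, cross_imK]; ring

theorem inner_cross_self_right (a b : ℍ[ℝ]) : inner ℝ b (cross a b) = 0 := by
  simp only [inner_eq, cross_re, cross_imI, cross_imJ, cross_imK]; ring

/-- Lagrange's identity. -/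
theorem inner_cross_cross {a b c d : ℍ[ℝ]} (ha : a.re = 0) (hb : b.re = 0) :
    inner ℝ (cross a b) (cross c d) =
      inner ℝ a c * inner ℝ b d - inner ℝ a d * inner ℝ b c := by
  simp only [inner_eq, cross_re, cross_imI, cross_imJ, cross_imK, ha, hb]; ring

theorem cross_cross {a b c : ℍ[ℝ]} (ha : a.re = 0) (hb : b.re = 0) (hc : c.re = 0) :
    cross a (cross b c) = (inner ℝ a c : ℝ) • b - (inner ℝ a b : ℝ) • c := by
  ext <;> simp [inner_eq, ha, hb, hc] <;> ring

/-- A vector orthogonal to two independent vectors is a multiple of their cross product. -/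
theorem smul_eq_inner_cross_smul {z a b : ℍ[ℝ]} (hz : z.re = 0) (ha : a.re = 0) (hb : b.re = 0)
    (hza : inner ℝ z a = 0) (hzb : inner ℝ z b = 0) :
    (inner ℝ (cross a b) (cross a b) : ℝ) • z = (inner ℝ z (cross a b) : ℝ) • cross a b := by
  have h1 : cross z (cross a b) = 0 := by rw [cross_cross hz ha hb, hza, hzb]; simp
  have h2 := cross_cross (a := cross a b) (b := z) (c := cross a b) (by simp) hz (by simp)
  rw [h1, cross_zero_right, real_inner_comm z] at h2
  rw [eq_comm, sub_eq_zero] at h2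
  rw [h2, real_inner_comm]

/-- `(w, u, v)` is a positively oriented orthonormal basis of the imaginary quaternions. -/
structure IsPosFrame (w u v : ℍ[ℝ]) : Prop where
  re_u : u.re = 0
  re_v : v.re = 0
  norm_u : inner ℝ u u = 1
  norm_v : inner ℝ v v = 1
  orth : inner ℝ u v = 0
  cross_uv : w = cross u v

namespace IsPosFrame

variable {w u v : ℍ[ℝ]} (h : IsPosFrame w u v)
include h

theorem re_w : w.re = 0 := by rw [h.cross_uv]; simp

theorem norm_w : inner ℝ w w = 1 := by
  rw [h.cross_uv, inner_cross_cross h.re_u h.re_v, h.norm_u, h.norm_v, h.orth]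
  norm_num

theorem inner_wu : inner ℝ w u = 0 := by
  rw [h.cross_uv, real_inner_comm, inner_cross_self_left]

theorem inner_wv : inner ℝ w v = 0 := by
  rw [h.cross_uv, real_inner_comm, inner_cross_self_right]

theorem cross_wu : cross w u = v := by
  rw [h.cross_uv, cross_anticomm, cross_cross h.re_u h.re_u h.re_v, h.norm_u, h.orth]; simp

theorem cross_vw : cross v w = u := by
  rw [h.cross_uv, cross_cross h.re_v h.re_u h.re_v, h.norm_v, real_inner_comm, h.orth]; simp

theorem expand {z : ℍ[ℝ]} (hz : z.re = 0) :
    z = (inner ℝ z u : ℝ) • u + (inner ℝ z v : ℝ) • v + (inner ℝ z w : ℝ) • w := by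
  have hvu : inner ℝ v u = 0 := by rw [real_inner_comm, h.orth]
  have key := smul_eq_inner_cross_smul (z := z - (inner ℝ z u : ℝ) • u - (inner ℝ z v : ℝ) • v)
    (by simp [hz, h.re_u, h.re_v]) h.re_u h.re_v
    (by simp only [inner_sub_left, inner_smul_left, h.norm_u, hvu]; simp)
    (by simp only [inner_sub_left, inner_smul_left, h.norm_v, h.orth]; simp)
  have hw : inner ℝ (z - (inner ℝ z u : ℝ) • u - (inner ℝ z v : ℝ) • v) w = inner ℝ z w := by
    rw [inner_sub_left, inner_sub_left, inner_smul_left, inner_smul_left, real_inner_comm w u,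
      real_inner_comm w v, h.inner_wu, h.inner_wv]
    simp
  rw [← h.cross_uv, h.norm_w, one_smul, hw] at key
  rw [← key]
  abel

end IsPosFrame

/-! ### The nearly Kähler structure in left-invariant coordinates -/

theorem star_mul_self_of_norm {p : ℍ[ℝ]} (h : ‖p‖ = 1) : star p * p = 1 := by
  rw [Quaternion.star_mul_self, Quaternion.normSq_eq_norm_mul_self, h]; simp

theorem self_mul_star_of_norm {p : ℍ[ℝ]} (h : ‖p‖ = 1) : p * star p = 1 := by
  rw [Quaternion.self_mul_star, Quaternion.normSq_eq_norm_mul_self, h]; simp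

theorem inner_mul_left_of_norm {u : ℍ[ℝ]} (hu : ‖u‖ = 1) (c d : ℍ[ℝ]) :
    inner ℝ (u * c) (u * d) = inner ℝ c d := by
  have hn : ‖u‖ ^ 2 = 1 := by rw [hu]; norm_num
  rw [norm_sq_eq] at hn
  simp only [inner_eq, Quaternion.re_mul, Quaternion.imI_mul, Quaternion.imJ_mul,
    Quaternion.imK_mul]
  linear_combination (c.re * d.re + c.imI * d.imI + c.imJ * d.imJ + c.imK * d.imK) * hn

theorem ne_zero_of_norm {p : ℍ[ℝ]} (h : ‖p‖ = 1) : p ≠ 0 := by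
  rintro rfl; simp at h

theorem J_leftVec (x a : HH) (h1 : x.1 ≠ 0) (h2 : x.2 ≠ 0) :
    J x (leftVec x a) = leftVec x (J (1, 1) a) := by
  ext1
  · simp only [J, leftVec, mul_assoc, inv_mul_cancel_left₀ h2, inv_one, one_mul,
      Prod.smul_fst, mul_smul_comm, mul_sub]
  · simp only [J, leftVec, mul_assoc, inv_mul_cancel_left₀ h1, inv_one, one_mul,
      Prod.smul_snd, mul_smul_comm, mul_add, mul_neg]

theorem P_leftVec (x a : HH) (h1 : x.1 ≠ 0) (h2 : x.2 ≠ 0) :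
    P x (leftVec x a) = leftVec x (a.2, a.1) := by
  ext1
  · simp only [P, leftVec, mul_assoc, inv_mul_cancel_left₀ h2]
  · simp only [P, leftVec, mul_assoc, inv_mul_cancel_left₀ h1]

theorem leftCoord_leftVec (x a : HH) (h1 : x.1 ≠ 0) (h2 : x.2 ≠ 0) :
    leftCoord x (leftVec x a) = a := by
  ext1 <;> simp [leftCoord, leftVec, h1, h2]

theorem leftVec_smul (x a : HH) (r : ℝ) : leftVec x (r • a) = r • leftVec x a := by
  ext1 <;> simp [leftVec]

theorem leftVec_add (x a b : HH) : leftVec x (a + b) = leftVec x a + leftVec x b := by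
  ext1 <;> simp [leftVec, mul_add]

theorem leftVec_sub (x a b : HH) : leftVec x (a - b) = leftVec x a - leftVec x b := by
  ext1 <;> simp [leftVec, mul_sub]

theorem leftVec_injective (x : HH) (h1 : x.1 ≠ 0) (h2 : x.2 ≠ 0) :
    Function.Injective (leftVec x) := by
  intro a b h
  rw [← leftCoord_leftVec x a h1 h2, h, leftCoord_leftVec x b h1 h2]

theorem J_one (a : HH) :
    J (1, 1) a = (1 / Real.sqrt 3) • ((2 : ℝ) • a.2 - a.1, a.2 - (2 : ℝ) • a.1) := by
  simp only [J, inv_one, one_mul]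
  congr 2
  abel

theorem inv_sqrt_three_mul_self : (1 / Real.sqrt 3) * (1 / Real.sqrt 3) = 1 / 3 := by
  rw [one_div_mul_one_div, Real.mul_self_sqrt (by norm_num)]

theorem g_one (a b : HH) : g (1, 1) a b =
    4 / 3 * (inner ℝ a.1 b.1 + inner ℝ a.2 b.2)
      - 2 / 3 * (inner ℝ a.1 b.2 + inner ℝ a.2 b.1) := by
  have h3 := inv_sqrt_three_mul_self
  rw [g, J_one, J_one]
  simp only [euclid, Prod.smul_fst, Prod.smul_snd, inner_smul_left, inner_smul_right,
    inner_sub_left, inner_sub_right, conj_trivial]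
  linear_combination (1 / 2) * (5 * (inner ℝ a.1 b.1 + inner ℝ a.2 b.2)
      - 4 * (inner ℝ a.1 b.2 + inner ℝ a.2 b.1)) * h3

theorem g_J_leftVec (x a b : HH) (h1 : ‖x.1‖ = 1) (h2 : ‖x.2‖ = 1) :
    g x (J x (leftVec x a)) (leftVec x b) =
      2 / Real.sqrt 3 * (inner ℝ a.2 b.1 - inner ℝ a.1 b.2) := by
  rw [J_leftVec x a (ne_zero_of_norm h1) (ne_zero_of_norm h2), g_leftVec x _ _ h1 h2, g_one, J_one]
  simp only [Prod.smul_fst, Prod.smul_snd, inner_smul_left, inner_sub_left, conj_trivial]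
  ring

theorem conn_leftVec (x a b : HH) (h1 : x.1 ≠ 0) (h2 : x.2 ≠ 0) :
    conn x (leftVec x a) (leftVec x b) = leftVec x (Gam a b) := by
  rw [conn, leftCoord_leftVec x a h1 h2, leftCoord_leftVec x b h1 h2]

/-- The tensor `JG` in left-invariant coordinates. -/
theorem JG_leftVec (x a b : HH) (h1 : x.1 ≠ 0) (h2 : x.2 ≠ 0) :
    J x (G x (leftVec x a) (leftVec x b)) = leftVec x
      ((2 / 3 : ℝ) • (cross a.1 b.1 - cross a.1 b.2 - cross a.2 b.1),
       (2 / 3 : ℝ) • (cross a.2 b.2 - cross a.1 b.2 - cross a.2 b.1)) := by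
  have h3 := inv_sqrt_three_mul_self
  rw [G, J_leftVec x b h1 h2, conn_leftVec x _ _ h1 h2, conn_leftVec x _ _ h1 h2,
    J_leftVec x _ h1 h2, ← leftVec_sub, J_leftVec x _ h1 h2]
  congr 1
  have hG : ∀ (r : ℝ) (u v : HH), Gam u (r • v) = r • Gam u v := by
    intro r u v
    simp only [Gam, Prod.smul_fst, Prod.smul_snd, cross_smul_right, Prod.smul_mk, smul_sub,
      smul_add, smul_comm r (1 / 3 : ℝ)]
  have hJ : ∀ (r : ℝ) (u : HH), J (1, 1) (r • u) = r • J (1, 1) u := by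
    intro r u
    rw [J_one, J_one, smul_comm r]
    simp only [Prod.smul_fst, Prod.smul_snd, Prod.smul_mk, smul_sub, smul_comm r (2 : ℝ)]
  rw [J_one b, hG, J_one (Gam a b), ← smul_sub, hJ, J_one, smul_smul, h3]
  simp only [Gam, Prod.smul_mk, Prod.mk_sub_mk, cross_smul_right, cross_sub_right]
  ext1
  · simp only
    module
  · simp only
    module

/-! ### Normal form of the tangent spaces -/

section NormalForm

variable {V : Type*} [AddCommGroup V] [Module ℝ V]

/-- The pointwise conditions on the left-trivialised differential `(a, b)` of a Lagrangian
immersion: `a` and `b` take imaginary values, `(a, b)` is injective, the pairing of `b` with `a` is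
symmetric, and the cubic condition holds that comes from `d ω = 0` for the Kähler form `ω`. -/
structure IsLagrangianPair (a b : V →ₗ[ℝ] ℍ[ℝ]) : Prop where
  re_fst : ∀ X, (a X).re = 0
  re_snd : ∀ X, (b X).re = 0
  injective : ∀ X, a X = 0 → b X = 0 → X = 0
  symm : ∀ X Y, inner ℝ (b X) (a Y) = inner ℝ (b Y) (a X)
  cubic : ∀ X Y Z, inner ℝ (b X) (cross (a Y) (a Z)) + inner ℝ (b Y) (cross (a Z) (a X))
      + inner ℝ (b Z) (cross (a X) (a Y)) =
    inner ℝ (a X) (cross (b Y) (b Z)) + inner ℝ (a Y) (cross (b Z) (b X))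
      + inner ℝ (a Z) (cross (b X) (b Y))

/-- The normal form of an adapted frame in left-invariant coordinates, for the positive frame
`(w, u, v)`. -/
structure IsNormalFrame (a b : V →ₗ[ℝ] ℍ[ℝ]) (e : Fin 3 → V) (Λ : ℝ) (w u v : ℍ[ℝ]) : Prop where
  posFrame : IsPosFrame w u v
  fst_zero : a (e 0) = 0
  snd_zero : b (e 0) = -(Real.sqrt 3 / 2) • w
  fst_one : a (e 1) = Real.sin Λ • u
  snd_one : b (e 1) = (Real.sin Λ / 2 - Real.sqrt 3 / 2 * Real.cos Λ) • u
  fst_two : a (e 2) = Real.sin Λ • v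
  snd_two : b (e 2) = (Real.sin Λ / 2 + Real.sqrt 3 / 2 * Real.cos Λ) • v

namespace IsLagrangianPair

variable {a b : V →ₗ[ℝ] ℍ[ℝ]} (h : IsLagrangianPair a b)
include h

/-- The kernel of `a` is at most a line unless `a = 0`. -/
theorem exists_smul_of_mem_ker {X Y Z : V} (hX : a X = 0) (hY : a Y = 0) (hX0 : X ≠ 0)
    (hZ : a Z ≠ 0) : ∃ c : ℝ, c • X = Y := by
  have hbX : b X ≠ 0 := fun h0 => hX0 (h.injective X hX h0)
  have h1 : inner ℝ (a Z) (cross (b X) (b Y)) = 0 := by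
    have := h.cubic Z X Y
    simpa [hX, hY] using this.symm
  have h2 : inner ℝ (a Z) (b X) = 0 := by
    rw [real_inner_comm, h.symm, hX, inner_zero_right]
  have h3 : inner ℝ (a Z) (b Y) = 0 := by
    rw [real_inner_comm, h.symm, hY, inner_zero_right]
  have h4 := smul_eq_inner_cross_smul (h.re_fst Z) (h.re_snd X) (h.re_snd Y) h2 h3
  rw [h1, zero_smul] at h4
  have h5 : cross (b X) (b Y) = 0 := by
    rcases smul_eq_zero.1 h4 with h5 | h5
    · exact inner_self_eq_zero.1 h5
    · exact absurd h5 hZ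
  have h6 := cross_cross (a := b X) (b := b X) (c := b Y) (h.re_snd X) (h.re_snd X) (h.re_snd Y)
  rw [h5, cross_zero_right, eq_comm, sub_eq_zero] at h6
  have hn : inner ℝ (b X) (b X) ≠ 0 := fun h0 => hbX (inner_self_eq_zero.1 h0)
  refine ⟨inner ℝ (b X) (b Y) / inner ℝ (b X) (b X), ?_⟩
  rw [← sub_eq_zero]
  apply h.injective
  · simp [hX, hY]
  · rw [map_sub, map_smul, div_eq_inv_mul, mul_smul, h6, smul_smul, inv_mul_cancel₀ hn, one_smul,
      sub_self]

theorem finrank_ker (hV : ¬ Function.Injective a) (ha : a ≠ 0) :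
    Module.finrank ℝ (LinearMap.ker a) = 1 := by
  obtain ⟨Z, hZ⟩ : ∃ Z, a Z ≠ 0 := by
    by_contra! h0
    exact ha (LinearMap.ext h0)
  have hk : LinearMap.ker a ≠ ⊥ := fun h0 => hV (LinearMap.ker_eq_bot.1 h0)
  obtain ⟨T, hT, hT0⟩ := Submodule.exists_mem_ne_zero_of_ne_bot hk
  refine finrank_eq_one (⟨T, hT⟩ : LinearMap.ker a) (by simpa using hT0) ?_
  rintro ⟨Y, hY⟩
  obtain ⟨c, hc⟩ := h.exists_smul_of_mem_ker hT hY hT0 hZ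
  exact ⟨c, Subtype.ext hc⟩

theorem finrank_range [FiniteDimensional ℝ V] (hd : Module.finrank ℝ V = 3)
    (hV : ¬ Function.Injective a) (ha : a ≠ 0) :
    Module.finrank ℝ (LinearMap.range a) = 2 := by
  have h1 := LinearMap.finrank_range_add_finrank_ker a
  rw [h.finrank_ker hV ha, hd] at h1
  omega

end IsLagrangianPair

/-- The traceless symmetric matrix with rows `(A, B)` and `(B, -A)` is `k` times the reflection
whose axis is spanned by the unit vector `(c, s)`. -/
theorem exists_half_angle (A B : ℝ) : ∃ c s k : ℝ, 0 ≤ k ∧ c ^ 2 + s ^ 2 = 1 ∧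
    A = k * (c ^ 2 - s ^ 2) ∧ B = 2 * k * (c * s) := by
  set z : ℂ := ⟨A, B⟩ with hz
  have h1 : ‖z‖ * Real.cos z.arg = A := Complex.norm_mul_cos_arg z
  have h2 : ‖z‖ * Real.sin z.arg = B := Complex.norm_mul_sin_arg z
  refine ⟨Real.cos (z.arg / 2), Real.sin (z.arg / 2), ‖z‖, norm_nonneg _, Real.cos_sq_add_sin_sq _,
    ?_, ?_⟩
  · rw [← Real.cos_two_mul', mul_div_cancel₀ _ two_ne_zero, h1]
  · rw [← h2, show z.arg = 2 * (z.arg / 2) by ring, Real.sin_two_mul]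
    ring_nf

theorem exists_cot_eq {x : ℝ} (hx : 0 ≤ x) : ∃ Λ : ℝ, 0 ≤ Λ ∧ Λ ≤ Real.pi / 2 ∧
    0 < Real.sin Λ ∧ Real.cos Λ = x * Real.sin Λ := by
  have h0 : 0 ≤ Real.arctan x := by simpa using hx
  refine ⟨Real.pi / 2 - Real.arctan x, by linarith [Real.arctan_lt_pi_div_two x], by linarith,
    ?_, ?_⟩
  · rw [Real.sin_pi_div_two_sub]
    exact Real.cos_arctan_pos x
  · rw [Real.sin_pi_div_two_sub, Real.cos_pi_div_two_sub, Real.sin_arctan, Real.cos_arctan]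
    ring

/-- The imaginary quaternion `x i + y j + z k`. -/
def ofImag (x y z : ℝ) : ℍ[ℝ] := ⟨0, x, y, z⟩

@[simp] theorem ofImag_re (x y z : ℝ) : (ofImag x y z).re = 0 := rfl
@[simp] theorem ofImag_imI (x y z : ℝ) : (ofImag x y z).imI = x := rfl
@[simp] theorem ofImag_imJ (x y z : ℝ) : (ofImag x y z).imJ = y := rfl
@[simp] theorem ofImag_imK (x y z : ℝ) : (ofImag x y z).imK = z := rfl

/-- The imaginary quaternion with given coordinates. -/
def imLift : EuclideanSpace ℝ (Fin 3) →ₗ[ℝ] ℍ[ℝ] where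
  toFun y := ofImag (y 0) (y 1) (y 2)
  map_add' x y := by ext <;> simp
  map_smul' r y := by ext <;> simp

@[simp] theorem imLift_re (y : EuclideanSpace ℝ (Fin 3)) : (imLift y).re = 0 := rfl
@[simp] theorem imLift_imI (y : EuclideanSpace ℝ (Fin 3)) : (imLift y).imI = y 0 := rfl
@[simp] theorem imLift_imJ (y : EuclideanSpace ℝ (Fin 3)) : (imLift y).imJ = y 1 := rfl
@[simp] theorem imLift_imK (y : EuclideanSpace ℝ (Fin 3)) : (imLift y).imK = y 2 := rfl

/-- Coordinates of the imaginary part. -/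
def imCoord : ℍ[ℝ] →ₗ[ℝ] EuclideanSpace ℝ (Fin 3) where
  toFun z := !₂[z.imI, z.imJ, z.imK]
  map_add' x y := by ext i; fin_cases i <;> simp
  map_smul' r y := by ext i; fin_cases i <;> simp

@[simp] theorem imCoord_zero (z : ℍ[ℝ]) : imCoord z 0 = z.imI := rfl
@[simp] theorem imCoord_one (z : ℍ[ℝ]) : imCoord z 1 = z.imJ := rfl
@[simp] theorem imCoord_two (z : ℍ[ℝ]) : imCoord z 2 = z.imK := rfl

theorem imLift_imCoord {z : ℍ[ℝ]} (hz : z.re = 0) : imLift (imCoord z) = z := by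
  ext <;> simp [hz]

/-- An injective linear map of a 3-dimensional space to the imaginary quaternions is onto. -/
theorem exists_eq_of_injective [FiniteDimensional ℝ V] (hd : Module.finrank ℝ V = 3)
    {b : V →ₗ[ℝ] ℍ[ℝ]} (hb : Function.Injective b) (hre : ∀ X, (b X).re = 0) {z : ℍ[ℝ]}
    (hz : z.re = 0) : ∃ X, b X = z := by
  have h1 : Function.Injective (imCoord ∘ₗ b) := by
    intro X Y hXY
    apply hb
    rw [← imLift_imCoord (hre X), ← imLift_imCoord (hre Y)]
    exact congrArg imLift hXY
  have h2 : Function.Surjective (imCoord ∘ₗ b) :=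
    (LinearMap.injective_iff_surjective_of_finrank_eq_finrank (by simp [hd])).1 h1
  obtain ⟨X, hX⟩ := h2 (imCoord z)
  refine ⟨X, ?_⟩
  rw [← imLift_imCoord (hre X), ← imLift_imCoord hz]
  exact congrArg imLift hX

/-- If `a` is not injective, there is a normal frame with `0 ≤ Λ ≤ π / 2`. On the plane spanned by the
image of `a`, the map `a X ↦ b X`, taken modulo the normal `w`, is symmetric, and its trace is `1`
by the cubic condition; the frame diagonalises it, with eigenvalues `1 / 2 ∓ (√3 / 2) cot Λ`. -/
theorem IsLagrangianPair.exists_normalFrame [FiniteDimensional ℝ V]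
    (hd : Module.finrank ℝ V = 3) {a b : V →ₗ[ℝ] ℍ[ℝ]} (h : IsLagrangianPair a b)
    (hV : ¬ Function.Injective a) : ∃ (e : Fin 3 → V) (Λ : ℝ) (w u v : ℍ[ℝ]),
      0 ≤ Λ ∧ Λ ≤ Real.pi / 2 ∧ IsNormalFrame a b e Λ w u v := by
  have hs3 : Real.sqrt 3 * Real.sqrt 3 = 3 := Real.mul_self_sqrt (by norm_num)
  have hs0 : Real.sqrt 3 ≠ 0 := by positivity
  by_cases ha : a = 0
  · have hb : Function.Injective b := by
      rw [injective_iff_map_eq_zero]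
      intro X hX
      exact h.injective X (by rw [ha]; rfl) hX
    -- if `a = 0`, the preimage under `b` of any orthonormal frame will do, with `Λ = 0`
    have hex : ∀ z : ℍ[ℝ], z.re = 0 → ∃ X, b X = z := fun z hz =>
      exists_eq_of_injective hd hb h.re_snd hz
    have hp : IsPosFrame (ofImag 1 0 0) (ofImag 0 1 0) (ofImag 0 0 1) := by
      constructor
      · simp
      · simp
      · rw [inner_eq]; simp
      · rw [inner_eq]; simp
      · rw [inner_eq]; simp
      · ext <;> simp
    obtain ⟨e0, h0⟩ := hex (-(Real.sqrt 3 / 2) • (ofImag 1 0 0)) (by simp)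
    obtain ⟨e1, h1⟩ := hex (-(Real.sqrt 3 / 2) • (ofImag 0 1 0)) (by simp)
    obtain ⟨e2, h2⟩ := hex ((Real.sqrt 3 / 2) • (ofImag 0 0 1)) (by simp)
    refine ⟨![e0, e1, e2], 0, _, _, _, le_rfl, by positivity, hp, ?_, ?_, ?_, ?_, ?_, ?_⟩
    · simp [ha]
    · simpa using h0
    · simp [ha]
    · simpa using h1
    · simp [ha]
    · simpa using h2
  · have hr := h.finrank_range hd hV ha
    let B := (stdOrthonormalBasis ℝ (LinearMap.range a)).reindex (finCongr hr)
    set m1 : ℍ[ℝ] := (B 0 : ℍ[ℝ]) with hm1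
    set m2 : ℍ[ℝ] := (B 1 : ℍ[ℝ]) with hm2
    obtain ⟨X1, hX1⟩ : ∃ X, a X = m1 := (B 0).2
    obtain ⟨X2, hX2⟩ : ∃ X, a X = m2 := (B 1).2
    have hB := B.orthonormal
    have n1 : inner ℝ m1 m1 = 1 := by
      exact ((orthonormal_iff_ite.1 hB) 0 0).trans (by simp)
    have n2 : inner ℝ m2 m2 = 1 := by
      exact ((orthonormal_iff_ite.1 hB) 1 1).trans (by simp)
    have n12 : inner ℝ m1 m2 = 0 := by
      exact ((orthonormal_iff_ite.1 hB) 0 1).trans (by simp)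
    have n21 : inner ℝ m2 m1 = 0 := by rw [real_inner_comm, n12]
    have r1 : m1.re = 0 := by rw [← hX1, h.re_fst]
    have r2 : m2.re = 0 := by rw [← hX2, h.re_fst]
    have hp : IsPosFrame (cross m1 m2) m1 m2 := ⟨r1, r2, n1, n2, n12, rfl⟩
    set n : ℍ[ℝ] := cross m1 m2 with hn
    obtain ⟨T, hT, hT0⟩ : ∃ T, a T = 0 ∧ T ≠ 0 := by
      by_contra! h0
      exact hV ((injective_iff_map_eq_zero a).2 h0)
    have hbT0 : b T ≠ 0 := fun h0 => hT0 (h.injective T hT h0)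
    have hbT : ∃ r : ℝ, b T = r • n := by
      refine ⟨inner ℝ (b T) n, ?_⟩
      have h1 : inner ℝ (b T) m1 = 0 := by rw [← hX1, h.symm, hT, inner_zero_right]
      have h2 : inner ℝ (b T) m2 = 0 := by rw [← hX2, h.symm, hT, inner_zero_right]
      conv_lhs => rw [hp.expand (h.re_snd T)]
      rw [h1, h2]; simp
    obtain ⟨ρ, hρ⟩ := hbT
    have hρ0 : ρ ≠ 0 := by
      rintro rfl
      exact hbT0 (by rw [hρ, zero_smul])
    -- the component of `b X` along the normal is removed by subtracting a multiple of `T`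
    have hproj : ∀ X, ∃ Y, a Y = a X ∧ b Y =
        (inner ℝ (b X) m1 : ℝ) • m1 + (inner ℝ (b X) m2 : ℝ) • m2 := by
      intro X
      refine ⟨X - (inner ℝ (b X) n / ρ) • T, by simp [hT], ?_⟩
      rw [map_sub, map_smul, hρ, smul_smul, div_mul_cancel₀ _ hρ0, sub_eq_iff_eq_add]
      exact hp.expand (h.re_snd X)
    obtain ⟨Y1, hY1, hY1b⟩ := hproj X1
    obtain ⟨Y2, hY2, hY2b⟩ := hproj X2
    rw [hX1] at hY1
    rw [hX2] at hY2
    have hk : inner ℝ (b X2) m1 = inner ℝ (b X1) m2 := by rw [← hX1, h.symm, hX2]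
    have htr : inner ℝ (b X1) m1 + inner ℝ (b X2) m2 = 1 := by
      have hc := h.cubic T X1 X2
      rw [hT, hX1, hX2, ← hn, hρ] at hc
      simp only [inner_smul_left, hp.norm_w, cross_zero_left, cross_zero_right, inner_zero_left,
        inner_zero_right, cross_smul_left, cross_smul_right, inner_smul_right, conj_trivial] at hc
      rw [inner_cross_cyc m1, inner_cross_cyc m2, inner_cross_cyc n, hp.cross_wu,
        hp.cross_vw] at hc
      have : ρ * (inner ℝ (b X1) m1 + inner ℝ (b X2) m2 - 1) = 0 := by linear_combination -hc
      rcases mul_eq_zero.1 this with h0 | h0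
      · exact absurd h0 hρ0
      · linarith
    rw [hk] at hY2b
    set k11 : ℝ := inner ℝ (b X1) m1
    set k12 : ℝ := inner ℝ (b X1) m2
    set k22 : ℝ := inner ℝ (b X2) m2
    -- the eigenvalues of the symmetric matrix `k` of trace one are `1 / 2 ± κ`, and `cot Λ` is
    -- proportional to `κ`
    obtain ⟨c, s, κ, hκ, hcs, hA, hB⟩ := exists_half_angle (k11 - 1 / 2) k12
    obtain ⟨Λ, hΛ0, hΛ1, -, hcot⟩ :=
      exists_cot_eq (x := 2 * κ / Real.sqrt 3) (by positivity)
    have hcot' : Real.sqrt 3 / 2 * Real.cos Λ = κ * Real.sin Λ := by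
      rw [hcot]; field_simp
    have hk11 : k11 = 1 / 2 + κ * (c ^ 2 - s ^ 2) := by linarith
    have hk22 : k22 = 1 / 2 - κ * (c ^ 2 - s ^ 2) := by linarith
    set u : ℍ[ℝ] := (-s) • m1 + c • m2 with hu
    set v : ℍ[ℝ] := c • m1 + s • m2 with hv
    have hw : cross u v = -n := by
      rw [hu, hv]
      simp only [cross_add_left, cross_add_right, cross_smul_left, cross_smul_right, cross_self,
        cross_anticomm m1 m2, ← hn]
      match_scalars
      linear_combination -hcs
    have hpos : IsPosFrame (cross u v) u v := by
      refine ⟨by simp [hu, r1, r2], by simp [hv, r1, r2], ?_, ?_, ?_, rfl⟩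
      · simp only [hu, inner_add_left, inner_add_right, inner_smul_left, inner_smul_right,
          conj_trivial, n1, n2, n12, n21]
        linear_combination hcs
      · simp only [hv, inner_add_left, inner_add_right, inner_smul_left, inner_smul_right,
          conj_trivial, n1, n2, n12, n21]
        linear_combination hcs
      · simp only [hu, hv, inner_add_left, inner_add_right, inner_smul_left, inner_smul_right,
          conj_trivial, n1, n2, n12, n21]
        ring
    have hbu : b ((-s) • Y1 + c • Y2) = (1 / 2 - κ) • u := by
      rw [map_add, map_smul, map_smul, hY1b, hY2b, hu, hk11, hk22, hB]
      match_scalars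
      · linear_combination (s * κ) * hcs
      · linear_combination (-c * κ) * hcs
    have hbv : b (c • Y1 + s • Y2) = (1 / 2 + κ) • v := by
      rw [map_add, map_smul, map_smul, hY1b, hY2b, hv, hk11, hk22, hB]
      match_scalars
      · linear_combination (c * κ) * hcs
      · linear_combination (s * κ) * hcs
    refine ⟨![(Real.sqrt 3 / (2 * ρ)) • T, Real.sin Λ • ((-s) • Y1 + c • Y2),
      Real.sin Λ • (c • Y1 + s • Y2)], Λ, _, u, v, hΛ0, hΛ1, hpos, ?_, ?_, ?_, ?_, ?_, ?_⟩
    · simp [hT]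
    · simp only [Matrix.cons_val_zero]
      rw [hw, map_smul, hρ, smul_smul, smul_neg, neg_smul, neg_neg]
      congr 1
      field_simp
    · simp only [Matrix.cons_val_one, Matrix.cons_val_zero]
      rw [map_smul, map_add, map_smul, map_smul, hY1, hY2]
    · simp only [Matrix.cons_val_one, Matrix.cons_val_zero]
      rw [map_smul, hbu, smul_smul, hcot']
      congr 1
      ring
    · simp only [Matrix.cons_val]
      rw [map_smul, map_add, map_smul, map_smul, hY1, hY2]
    · simp only [Matrix.cons_val]
      rw [map_smul, hbv, smul_smul, hcot']
      congr 1
      ring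

end NormalForm

/-! ### Adapted frames and normal frames -/

section Adapted

variable {M : Type*} [TopologicalSpace M] [ChartedSpace (EuclideanSpace ℝ (Fin 3)) M]

/-- The first component of the left-trivialised differential, `p⁻¹ dp`. -/
noncomputable def fstForm (f : M → HH) (x : M) : TangentSpace (𝓡 3) x →ₗ[ℝ] ℍ[ℝ] :=
  LinearMap.mulLeft ℝ (star (f x).1) ∘ₗ LinearMap.fst ℝ ℍ[ℝ] ℍ[ℝ] ∘ₗ (diff f x).toLinearMap

/-- The second component of the left-trivialised differential, `q⁻¹ dq`. -/
noncomputable def sndForm (f : M → HH) (x : M) : TangentSpace (𝓡 3) x →ₗ[ℝ] ℍ[ℝ] :=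
  LinearMap.mulLeft ℝ (star (f x).2) ∘ₗ LinearMap.snd ℝ ℍ[ℝ] ℍ[ℝ] ∘ₗ (diff f x).toLinearMap

theorem fstForm_apply (f : M → HH) (x : M) (X : TangentSpace (𝓡 3) x) :
    fstForm f x X = star (f x).1 * (diff f x X).1 := rfl

theorem sndForm_apply (f : M → HH) (x : M) (X : TangentSpace (𝓡 3) x) :
    sndForm f x X = star (f x).2 * (diff f x X).2 := rfl

theorem diff_eq_leftVec {f : M → HH} {x : M} (h1 : ‖(f x).1‖ = 1) (h2 : ‖(f x).2‖ = 1)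
    (X : TangentSpace (𝓡 3) x) : diff f x X = leftVec (f x) (fstForm f x X, sndForm f x X) := by
  ext1
  · rw [leftVec, fstForm_apply, ← mul_assoc, self_mul_star_of_norm h1, one_mul]
  · rw [leftVec, sndForm_apply, ← mul_assoc, self_mul_star_of_norm h2, one_mul]

theorem cos_two_pi_div_three : Real.cos (2 * Real.pi / 3) = -(1 / 2) := by
  rw [show 2 * Real.pi / 3 = Real.pi - Real.pi / 3 by ring, Real.cos_pi_sub, Real.cos_pi_div_three]

theorem sin_two_pi_div_three : Real.sin (2 * Real.pi / 3) = Real.sqrt 3 / 2 := by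
  rw [show 2 * Real.pi / 3 = Real.pi - Real.pi / 3 by ring, Real.sin_pi_sub, Real.sin_pi_div_three]

/-- The eigenvalue equation of `P` for the angle `2 Λ + 2 π / 3`, where `s = sin Λ`, `c = cos Λ` and
`k = 1 / √3`, is solved by the multiples of `(s, s / 2 - (√3 / 2) c)`. -/
theorem eigen_solve {A B s c k : ℝ} (hsc : s ^ 2 + c ^ 2 = 1) (hk : k * k = 1 / 3)
    (h1 : B = (-(c ^ 2 - s ^ 2) / 2 - 3 * k * (s * c)) * A
      + (-(s * c) + (c ^ 2 - s ^ 2) * (3 * k / 2)) * (k * (2 * B - A)))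
    (h2 : A = (-(c ^ 2 - s ^ 2) / 2 - 3 * k * (s * c)) * B
      + (-(s * c) + (c ^ 2 - s ^ 2) * (3 * k / 2)) * (k * (B - 2 * A))) :
    A = s * (s * A + c * (k * (A - 2 * B))) ∧
    B = (s / 2 - 3 * k / 2 * c) * (s * A + c * (k * (A - 2 * B))) := by
  constructor
  · linear_combination (-A / 2) * hsc + h2 / 2 - (3 / 2) * (c ^ 2 - s ^ 2) * (A - B / 2) * hk
  · linear_combination h1 / 2 - (3 / 2) * k ^ 2 * B * hsc
      + (-(3 / 2) * B + (3 / 4) * A * (c ^ 2 + s ^ 2)) * hk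

/-- The solution of the eigenvalue equation of `P` in left-invariant coordinates: `A` and `B` are
multiples of one quaternion `u`. -/
theorem eigen_solve_quat {A B : ℍ[ℝ]} {s c θ : ℝ} (hsc : s ^ 2 + c ^ 2 = 1)
    (hcos : Real.cos θ = -(c ^ 2 - s ^ 2) / 2 - Real.sqrt 3 * (s * c))
    (hsin : Real.sin θ = -(s * c) + (c ^ 2 - s ^ 2) * (Real.sqrt 3 / 2))
    (h : ((B, A) : HH) = Real.cos θ • (A, B) + Real.sin θ • J (1, 1) (A, B)) :
    ∃ u : ℍ[ℝ], u = s • A + c • (1 / Real.sqrt 3) • (A - (2 : ℝ) • B) ∧ A = s • u ∧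
      B = (s / 2 - Real.sqrt 3 / 2 * c) • u := by
  have hk := inv_sqrt_three_mul_self
  have h3 : Real.sqrt 3 = 3 * (1 / Real.sqrt 3) := by
    rw [← mul_div_assoc, mul_one, eq_div_iff (by positivity), Real.mul_self_sqrt (by norm_num)]
  set k := 1 / Real.sqrt 3
  rw [h3] at hcos hsin
  rw [h3]
  refine ⟨_, rfl, ?_⟩
  rw [J_one, hcos, hsin] at h
  have e1 := congrArg Prod.fst h
  have e2 := congrArg Prod.snd h
  simp only [Prod.fst_add, Prod.snd_add, Prod.smul_fst, Prod.smul_snd] at e1 e2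
  have key : ∀ φ : ℍ[ℝ] →ₗ[ℝ] ℝ,
      φ A = s * (s * φ A + c * (k * (φ A - 2 * φ B))) ∧
      φ B = (s / 2 - 3 * k / 2 * c) * (s * φ A + c * (k * (φ A - 2 * φ B))) := by
    intro φ
    have f1 := congrArg φ e1
    have f2 := congrArg φ e2
    simp only [map_add, map_smul, map_sub, smul_eq_mul] at f1 f2
    refine eigen_solve hsc hk ?_ ?_
    · linear_combination f1
    · linear_combination f2
  constructor <;> refine ext_inner_left ℝ fun z => ?_
  · simp only [inner_smul_right, inner_add_right, inner_sub_right]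
    exact (key (innerₗ _ z)).1
  · simp only [inner_smul_right, inner_add_right, inner_sub_right]
    exact (key (innerₗ _ z)).2

theorem g_one_smul (A B : ℍ[ℝ]) (s t s' t' : ℝ) :
    g (1, 1) (s • A, t • A) (s' • B, t' • B) =
      (4 / 3 * (s * s' + t * t') - 2 / 3 * (s * t' + t * s')) * inner ℝ A B := by
  rw [g_one]
  simp only [inner_smul_left, inner_smul_right, conj_trivial]
  ring

/-- The eigenvalue equations give the vectors `u` and `v`, and the symmetry of the pairing makes them
orthogonal where `sin Λ cos Λ ≠ 0`; the metric does so elsewhere. -/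
theorem normalFrame_of_adaptedFrame {f : M → HH} {x : M} (h1 : ‖(f x).1‖ = 1)
    (h2 : ‖(f x).2‖ = 1) (hL : IsLagrangianPair (fstForm f x) (sndForm f x))
    {e : Fin 3 → TangentSpace (𝓡 3) x} {Λ : ℝ} (he : IsAdaptedFrame f x e Λ) :
    ∃ w u v : ℍ[ℝ], IsNormalFrame (fstForm f x) (sndForm f x) e Λ w u v := by
  have h10 := ne_zero_of_norm h1
  have h20 := ne_zero_of_norm h2
  have hs3 : Real.sqrt 3 * Real.sqrt 3 = 3 := Real.mul_self_sqrt (by norm_num)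
  have hsc : Real.sin Λ ^ 2 + Real.cos Λ ^ 2 = 1 := Real.sin_sq_add_cos_sq Λ
  have eig : ∀ i, ((sndForm f x (e i), fstForm f x (e i)) : HH) =
      Real.cos (doubleAngle Λ i) • (fstForm f x (e i), sndForm f x (e i)) +
      Real.sin (doubleAngle Λ i) • J (1, 1) (fstForm f x (e i), sndForm f x (e i)) := by
    intro i
    have h := he.eigen i
    rw [diff_eq_leftVec h1 h2, P_leftVec _ _ h10 h20, J_leftVec _ _ h10 h20, ← leftVec_smul,
      ← leftVec_smul, ← leftVec_add] at h
    exact leftVec_injective _ h10 h20 h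
  have orth : ∀ i j, g (1, 1) (fstForm f x (e i), sndForm f x (e i))
      (fstForm f x (e j), sndForm f x (e j)) = if i = j then 1 else 0 := by
    intro i j
    rw [← he.orthonormal i j, diff_eq_leftVec h1 h2, diff_eq_leftVec h1 h2, g_leftVec _ _ _ h1 h2]
  have e0 := eigen_solve_quat (θ := 2 * Real.pi / 3) (s := 0) (c := 1) (by norm_num)
    (by rw [cos_two_pi_div_three]; norm_num) (by rw [sin_two_pi_div_three]; norm_num) (eig 0)
  have e1 := eigen_solve_quat (θ := 2 * Λ + 2 * Real.pi / 3) hsc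
    (by
      rw [Real.cos_add, cos_two_pi_div_three, sin_two_pi_div_three, Real.cos_two_mul',
        Real.sin_two_mul]
      ring)
    (by
      rw [Real.sin_add, cos_two_pi_div_three, sin_two_pi_div_three, Real.cos_two_mul',
        Real.sin_two_mul]
      ring) (eig 1)
  have e2 := eigen_solve_quat (θ := -2 * Λ + 2 * Real.pi / 3) (s := Real.sin Λ) (c := -Real.cos Λ)
    (by rw [neg_sq, hsc])
    (by
      rw [Real.cos_add, cos_two_pi_div_three, sin_two_pi_div_three, neg_mul, Real.cos_neg,
        Real.sin_neg, Real.cos_two_mul', Real.sin_two_mul]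
      ring)
    (by
      rw [Real.sin_add, cos_two_pi_div_three, sin_two_pi_div_three, neg_mul, Real.cos_neg,
        Real.sin_neg, Real.cos_two_mul', Real.sin_two_mul]
      ring) (eig 2)
  obtain ⟨t, -, ht, -⟩ := e0
  obtain ⟨u, hu, hu1, hu2⟩ := e1
  obtain ⟨v, hv, hv1, hv2⟩ := e2
  rw [zero_smul] at ht
  have hv2' : sndForm f x (e 2) = (Real.sin Λ / 2 + Real.sqrt 3 / 2 * Real.cos Λ) • v := by
    rw [hv2]; congr 1; ring
  have reu : u.re = 0 := by rw [hu]; simp [hL.re_fst, hL.re_snd]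
  have rev : v.re = 0 := by rw [hv]; simp [hL.re_fst, hL.re_snd]
  have nu : inner ℝ u u = 1 := by
    have h := orth 1 1
    rw [hu1, hu2, g_one_smul, if_pos rfl] at h
    linear_combination h - inner ℝ u u * hsc - inner ℝ u u * (Real.cos Λ) ^ 2 / 3 * hs3
  have nv : inner ℝ v v = 1 := by
    have h := orth 2 2
    rw [hv1, hv2', g_one_smul, if_pos rfl] at h
    linear_combination h - inner ℝ v v * hsc - inner ℝ v v * (Real.cos Λ) ^ 2 / 3 * hs3
  have nuv : inner ℝ u v = 0 := by
    have h := orth 1 2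
    rw [hu1, hu2, hv1, hv2', g_one_smul, if_neg (by decide)] at h
    have h' := hL.symm (e 1) (e 2)
    rw [hu1, hu2, hv1, hv2'] at h'
    simp only [inner_smul_left, inner_smul_right, conj_trivial, real_inner_comm u v] at h'
    have g1 : (Real.sin Λ ^ 2 - Real.cos Λ ^ 2) * inner ℝ u v = 0 := by
      linear_combination h + inner ℝ u v * (Real.cos Λ) ^ 2 / 3 * hs3
    have g2 : (Real.sqrt 3 * (Real.sin Λ * Real.cos Λ)) * inner ℝ u v = 0 := by
      linear_combination -h'
    have g3 : (Real.sin Λ * Real.cos Λ) * inner ℝ u v = 0 := by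
      rcases mul_eq_zero.1 g2 with h0 | h0
      · rcases mul_eq_zero.1 h0 with h0 | h0
        · exact absurd h0 (by positivity)
        · rw [h0, zero_mul]
      · rw [h0, mul_zero]
    linear_combination (Real.sin Λ ^ 2 - Real.cos Λ ^ 2) * g1 + 4 * (Real.sin Λ * Real.cos Λ) * g3
      - inner ℝ u v * (Real.sin Λ ^ 2 + Real.cos Λ ^ 2 + 1) * hsc
  refine ⟨cross u v, u, v, ⟨reu, rev, nu, nv, nuv, rfl⟩, ht, ?_, hu1, hu2, hv1, hv2'⟩
  have h := he.orient₂₃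
  rw [diff_eq_leftVec h1 h2, diff_eq_leftVec h1 h2, diff_eq_leftVec h1 h2, JG_leftVec _ _ _ h10 h20,
    ← leftVec_smul] at h
  have h' := congrArg Prod.snd (leftVec_injective _ h10 h20 h)
  simp only [Prod.smul_snd, hu1, hu2, hv1, hv2', cross_smul_left, cross_smul_right] at h'
  have h'' : (Real.sqrt 3 * (1 / Real.sqrt 3)) • sndForm f x (e 0)
      = -(Real.sqrt 3 / 2) • cross u v := by
    rw [mul_smul, ← h']
    match_scalars
    linear_combination (-(Real.sqrt 3) / 2) * hsc - (Real.sqrt 3 * (Real.cos Λ) ^ 2 / 6) * hs3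
  rwa [mul_one_div_cancel (by positivity), one_smul] at h''

theorem adaptedFrame_of_normalFrame {f : M → HH} {x : M} (h1 : ‖(f x).1‖ = 1)
    (h2 : ‖(f x).2‖ = 1)
    {e : Fin 3 → TangentSpace (𝓡 3) x} {Λ : ℝ} {w u v : ℍ[ℝ]}
    (h : IsNormalFrame (fstForm f x) (sndForm f x) e Λ w u v) : IsAdaptedFrame f x e Λ := by
  have h10 := ne_zero_of_norm h1
  have h20 := ne_zero_of_norm h2
  have hs3 : Real.sqrt 3 * Real.sqrt 3 = 3 := Real.mul_self_sqrt (by norm_num)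
  have h3 : 1 / Real.sqrt 3 = Real.sqrt 3 / 3 := by
    rw [div_eq_div_iff (by positivity) (by norm_num), hs3, one_mul]
  have hsc : Real.sin Λ ^ 2 + Real.cos Λ ^ 2 = 1 := Real.sin_sq_add_cos_sq Λ
  have hp := h.posFrame
  have d0 : diff f x (e 0) = leftVec (f x) ((0 : ℝ) • w, -(Real.sqrt 3 / 2) • w) := by
    rw [diff_eq_leftVec h1 h2, h.fst_zero, h.snd_zero, zero_smul]
  have d1 : diff f x (e 1) = leftVec (f x)
      (Real.sin Λ • u, (Real.sin Λ / 2 - Real.sqrt 3 / 2 * Real.cos Λ) • u) := by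
    rw [diff_eq_leftVec h1 h2, h.fst_one, h.snd_one]
  have d2 : diff f x (e 2) = leftVec (f x)
      (Real.sin Λ • v, (Real.sin Λ / 2 + Real.sqrt 3 / 2 * Real.cos Λ) • v) := by
    rw [diff_eq_leftVec h1 h2, h.fst_two, h.snd_two]
  have ovu : inner ℝ v u = 0 := by rw [real_inner_comm, hp.orth]
  have ouw : inner ℝ u w = 0 := by rw [real_inner_comm, hp.inner_wu]
  have ovw : inner ℝ v w = 0 := by rw [real_inner_comm, hp.inner_wv]
  refine ⟨?_, ?_, ?_, ?_, ?_⟩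
  · intro i j
    fin_cases i <;> fin_cases j <;>
      simp only [Fin.zero_eta, Fin.mk_one, Fin.reduceFinMk, d0, d1, d2, g_leftVec _ _ _ h1 h2,
        g_one_smul, hp.norm_w, hp.norm_u, hp.norm_v, hp.inner_wu, hp.inner_wv, hp.orth, ovu, ouw,
        ovw, mul_zero, mul_one, if_true, Fin.reduceEq, if_false]
    · linear_combination hs3 / 3
    · linear_combination hsc + (Real.cos Λ) ^ 2 / 3 * hs3
    · linear_combination hsc + (Real.cos Λ) ^ 2 / 3 * hs3
  · intro i
    fin_cases i <;>
      simp only [Fin.zero_eta, Fin.mk_one, Fin.reduceFinMk, d0, d1, d2, P_leftVec _ _ h10 h20,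
        J_leftVec _ _ h10 h20, ← leftVec_smul, ← leftVec_add, J_one] <;>
      congr 1 <;> ext1 <;>
      simp only [Prod.fst_add, Prod.snd_add, Prod.smul_fst, Prod.smul_snd, doubleAngle,
        Matrix.cons_val, Real.cos_add, Real.sin_add, cos_two_pi_div_three, sin_two_pi_div_three,
        neg_mul, Real.cos_neg, Real.sin_neg, Real.cos_two_mul', Real.sin_two_mul] <;>
      match_scalars <;> rw [h3] <;> grobner
  · rw [d0, d1, d2, JG_leftVec _ _ _ h10 h20, ← leftVec_smul]
    congr 1
    ext1 <;>
    simp only [Prod.smul_fst, Prod.smul_snd, cross_smul_left, cross_smul_right, hp.cross_wu] <;>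
    match_scalars <;> rw [h3] <;> grobner
  · rw [d0, d1, d2, JG_leftVec _ _ _ h10 h20, ← leftVec_smul]
    congr 1
    ext1 <;>
    simp only [Prod.smul_fst, Prod.smul_snd, cross_smul_left, cross_smul_right, ← hp.cross_uv] <;>
    match_scalars <;> rw [h3] <;> grobner
  · rw [d0, d1, d2, JG_leftVec _ _ _ h10 h20, ← leftVec_smul]
    congr 1
    ext1 <;>
    simp only [Prod.smul_fst, Prod.smul_snd, cross_smul_left, cross_smul_right, hp.cross_vw] <;>
    match_scalars <;> rw [h3] <;> grobner

end Adapted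

/-! ### The Maurer–Cartan equation -/

section MaurerCartan

variable {V : Type*} [NormedAddCommGroup V] [NormedSpace ℝ V]

/-- The pullback `p⁻¹ dp` of the Maurer–Cartan form by a map `p` to the unit quaternions. -/
noncomputable def mc (p : V → ℍ[ℝ]) (y : V) : V →ₗ[ℝ] ℍ[ℝ] :=
  LinearMap.mulLeft ℝ (star (p y)) ∘ₗ (fderiv ℝ p y).toLinearMap

theorem mc_apply (p : V → ℍ[ℝ]) (y v : V) : mc p y v = star (p y) * fderiv ℝ p y v := rfl

theorem mul_mc {p : V → ℍ[ℝ]} {y : V} (h : ‖p y‖ = 1) (v : V) :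
    p y * mc p y v = fderiv ℝ p y v := by
  rw [mc_apply, ← mul_assoc, self_mul_star_of_norm h, one_mul]

/-- Quaternionic conjugation as a continuous linear map. -/
noncomputable def starCLM : ℍ[ℝ] →L[ℝ] ℍ[ℝ] :=
  LinearMap.toContinuousLinearMap
    { toFun := star
      map_add' := star_add
      map_smul' := fun r a => by ext <;> simp }

@[simp] theorem starCLM_apply (a : ℍ[ℝ]) : starCLM a = star a := rfl

theorem contDiff_star_quat {n : WithTop ℕ∞} : ContDiff ℝ n (fun a : ℍ[ℝ] => star a) :=
  starCLM.contDiff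

theorem hasFDerivAt_star_comp {p : V → ℍ[ℝ]} {y : V} (h : DifferentiableAt ℝ p y) :
    HasFDerivAt (fun z => star (p z))
      (starCLM.comp (fderiv ℝ p y)) y :=
  starCLM.hasFDerivAt.comp y h.hasFDerivAt

/-- A smooth map from an open set to the unit quaternions. -/
structure IsUnitMap (p : V → ℍ[ℝ]) (Ω : Set V) : Prop where
  isOpen : IsOpen Ω
  smooth : ContDiffOn ℝ ∞ p Ω
  norm_eq : ∀ y ∈ Ω, ‖p y‖ = 1

namespace IsUnitMap

variable {p q : V → ℍ[ℝ]} {Ω : Set V} (h : IsUnitMap p Ω) {y : V} (hy : y ∈ Ω)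
include h hy

theorem contDiffAt : ContDiffAt ℝ ∞ p y := h.smooth.contDiffAt (h.isOpen.mem_nhds hy)

theorem differentiableAt : DifferentiableAt ℝ p y := (h.contDiffAt hy).differentiableAt (by simp)

theorem contDiffAt_mc (v : V) : ContDiffAt ℝ ∞ (fun z => mc p z v) y := by
  have h1 := h.contDiffAt hy
  have h2 : ContDiffAt ℝ ∞ (fun z => fderiv ℝ p z v) y :=
    (h1.fderiv_right (m := ∞) (by simp)).clm_apply contDiffAt_const
  exact (contDiff_star_quat.contDiffAt.comp y h1).mul h2

theorem differentiableAt_mc (v : V) : DifferentiableAt ℝ (fun z => mc p z v) y :=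
  (h.contDiffAt_mc hy v).differentiableAt (by simp)

theorem star_fderiv_mul (v : V) : star (fderiv ℝ p y v) * p y = -mc p y v := by
  have h1 : HasFDerivAt (fun z => star (p z) * p z) _ y :=
    (hasFDerivAt_star_comp (h.differentiableAt hy)).mul' (h.differentiableAt hy).hasFDerivAt
  have h2 : (fun z => star (p z) * p z) =ᶠ[nhds y] fun _ => 1 := by
    filter_upwards [h.isOpen.mem_nhds hy] with z hz
    exact star_mul_self_of_norm (h.norm_eq z hz)
  have h3 := h2.fderiv_eq (𝕜 := ℝ)
  rw [h1.fderiv, fderiv_fun_const] at h3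
  have h4 := congrArg (fun L : V →L[ℝ] ℍ[ℝ] => L v) h3
  simp at h4
  rw [mc_apply, eq_neg_iff_add_eq_zero, add_comm]
  exact h4

theorem mc_re (v : V) : (mc p y v).re = 0 := by
  have h1 := h.star_fderiv_mul hy v
  have h2 : star (mc p y v) = -mc p y v := by
    rw [← h1, mc_apply, star_mul, star_star]
  have h3 := congrArg (fun a : ℍ[ℝ] => a.re) h2
  simp at h3
  linarith

/-- The Maurer–Cartan equation. -/
theorem fderiv_mc (v w : V) :
    fderiv ℝ (fun z => mc p z w) y v - fderiv ℝ (fun z => mc p z v) y w =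
      -((2 : ℝ) • cross (mc p y v) (mc p y w)) := by
  have h1 := h.contDiffAt hy
  have hd : ∀ u u' : V, fderiv ℝ (fun z => mc p z u) y u' =
      star (p y) * (fderiv ℝ (fderiv ℝ p) y u' u) + star (fderiv ℝ p y u') * fderiv ℝ p y u := by
    intro u u'
    have h2 : HasFDerivAt (fderiv ℝ p) (fderiv ℝ (fderiv ℝ p) y) y :=
      ((h1.fderiv_right (m := ∞) (by simp)).differentiableAt (by simp)).hasFDerivAt
    have h3 : HasFDerivAt (fun z => fderiv ℝ p z u) ((fderiv ℝ (fderiv ℝ p) y).flip u) y := by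
      simpa using h2.clm_apply (hasFDerivAt_const u y)
    have h4 : HasFDerivAt (fun z => mc p z u) _ y :=
      (hasFDerivAt_star_comp (h.differentiableAt hy)).mul' h3
    rw [h4.fderiv]
    simp
  have hs : fderiv ℝ (fderiv ℝ p) y v w = fderiv ℝ (fderiv ℝ p) y w v :=
    (h1.isSymmSndFDerivAt (by
      rw [minSmoothness_of_isRCLikeNormedField]; exact WithTop.coe_le_coe.2 le_top)).eq v w
  have hm : ∀ u u' : V, star (fderiv ℝ p y u) * fderiv ℝ p y u' = -(mc p y u * mc p y u') := by
    intro u u'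
    rw [← neg_mul, ← h.star_fderiv_mul hy, mul_assoc, mul_mc (h.norm_eq y hy)]
  rw [hd, hd, hs, hm, hm, two_smul_cross]
  abel

end IsUnitMap

theorem fderiv_cross {a b : V → ℍ[ℝ]} {y : V}
    (ha : DifferentiableAt ℝ a y) (hb : DifferentiableAt ℝ b y) :
    DifferentiableAt ℝ (fun z => cross (a z) (b z)) y ∧ ∀ v,
      fderiv ℝ (fun z => cross (a z) (b z)) y v =
        cross (fderiv ℝ a y v) (b y) + cross (a y) (fderiv ℝ b y v) := by
  have h : HasFDerivAt (fun z => cross (a z) (b z))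
      ((1 / 2 : ℝ) • ((a y • fderiv ℝ b y + MulOpposite.op (b y) • fderiv ℝ a y)
        - (b y • fderiv ℝ a y + MulOpposite.op (a y) • fderiv ℝ b y))) y :=
    ((ha.hasFDerivAt.mul' hb.hasFDerivAt).sub
      (hb.hasFDerivAt.mul' ha.hasFDerivAt)).const_smul (1 / 2 : ℝ)
  refine ⟨h.differentiableAt, fun v => ?_⟩
  rw [h.fderiv]
  simp only [cross, smul_apply, sub_apply, add_apply, smul_eq_mul, MulOpposite.smul_eq_mul_unop,
    MulOpposite.unop_op, ← smul_add]
  congr 1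
  abel

/-- A local description `(p, q)` of a Lagrangian immersion on the open set `Ω` of a normed
space. -/
structure IsLagrangianPatch (p q : V → ℍ[ℝ]) (Ω : Set V) : Prop where
  fst : IsUnitMap p Ω
  snd : IsUnitMap q Ω
  injective : ∀ y ∈ Ω, ∀ v, mc p y v = 0 → mc q y v = 0 → v = 0
  symm : ∀ y ∈ Ω, ∀ v w, inner ℝ (mc q y v) (mc p y w) = inner ℝ (mc q y w) (mc p y v)

/-- The cubic condition is the vanishing of `dω` along a Lagrangian immersion, where `ω` is the
Kähler form; it follows from the symmetry of the pairing by the Maurer–Cartan equation. -/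
theorem IsLagrangianPatch.isLagrangianPair {p q : V → ℍ[ℝ]} {Ω : Set V}
    (h : IsLagrangianPatch p q Ω) {y : V} (hy : y ∈ Ω) : IsLagrangianPair (mc p y) (mc q y) := by
  refine ⟨h.fst.mc_re hy, h.snd.mc_re hy, h.injective y hy, h.symm y hy, ?_⟩
  have hD : ∀ u v w : V,
      inner ℝ (mc q y v) (fderiv ℝ (fun z => mc p z w) y u)
        + inner ℝ (fderiv ℝ (fun z => mc q z v) y u) (mc p y w) =
      inner ℝ (mc q y w) (fderiv ℝ (fun z => mc p z v) y u)
        + inner ℝ (fderiv ℝ (fun z => mc q z w) y u) (mc p y v) := by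
    intro u v w
    have h1 : (fun z => (inner ℝ (mc q z v) (mc p z w) : ℝ)) =ᶠ[nhds y]
        fun z => inner ℝ (mc q z w) (mc p z v) := by
      filter_upwards [h.fst.isOpen.mem_nhds hy] with z hz
      exact h.symm z hz v w
    have h2 := congrArg (fun L : V →L[ℝ] ℝ => L u) h1.fderiv_eq
    rwa [fderiv_inner_apply ℝ (h.snd.differentiableAt_mc hy v) (h.fst.differentiableAt_mc hy w),
      fderiv_inner_apply ℝ (h.snd.differentiableAt_mc hy w) (h.fst.differentiableAt_mc hy v)] at h2
  intro X Y Z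
  have c1 := hD X Y Z
  have c2 := hD Y Z X
  have c3 := hD Z X Y
  have a1 := congrArg (fun t => (inner ℝ (mc q y X) t : ℝ)) (h.fst.fderiv_mc hy Y Z)
  have a2 := congrArg (fun t => (inner ℝ (mc q y Y) t : ℝ)) (h.fst.fderiv_mc hy Z X)
  have a3 := congrArg (fun t => (inner ℝ (mc q y Z) t : ℝ)) (h.fst.fderiv_mc hy X Y)
  have b1 := congrArg (fun t => (inner ℝ t (mc p y X) : ℝ)) (h.snd.fderiv_mc hy Y Z)
  have b2 := congrArg (fun t => (inner ℝ t (mc p y Y) : ℝ)) (h.snd.fderiv_mc hy Z X)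
  have b3 := congrArg (fun t => (inner ℝ t (mc p y Z) : ℝ)) (h.snd.fderiv_mc hy X Y)
  simp only [inner_sub_left, inner_sub_right, inner_neg_left, inner_neg_right, inner_smul_left,
    inner_smul_right, conj_trivial, real_inner_comm (mc p y _) (cross _ _)] at a1 a2 a3 b1 b2 b3
  linarith

end MaurerCartan

/-! ### A Carleman inequality for the Dirac operator of three-space -/

section Carleman

/-- Euclidean three-space. -/
abbrev E3 : Type := EuclideanSpace ℝ (Fin 3)

/-- The standard basis of three-space. -/
noncomputable def stdE (i : Fin 3) : E3 := EuclideanSpace.single i 1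

/-- The imaginary units `i`, `j`, `k`. -/
noncomputable def imUnit (i : Fin 3) : ℍ[ℝ] := imLift (stdE i)

/-- The Dirac operator `i ∂₁ + j ∂₂ + k ∂₃` on quaternion valued functions. -/
noncomputable def dirac (u : E3 → ℍ[ℝ]) (x : E3) : ℍ[ℝ] :=
  ∑ i, imUnit i * fderiv ℝ u x (stdE i)

/-- The derivative of `u` along the linear vector field `A`. -/
noncomputable def lie {F : Type*} [NormedAddCommGroup F] [NormedSpace ℝ F] (A : E3 →L[ℝ] E3)
    (u : E3 → F) (x : E3) : F :=
  fderiv ℝ u x (A x)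

/-- The infinitesimal rotation `x ↦ e_k × x`. -/
noncomputable def rot (k : Fin 3) : E3 →L[ℝ] E3 :=
  LinearMap.toContinuousLinearMap
    { toFun := fun x => imCoord (cross (imUnit k) (imLift x))
      map_add' := fun x y => by rw [map_add, cross_add_right, map_add]
      map_smul' := fun r x => by rw [map_smul, cross_smul_right, map_smul]; rfl }

theorem rot_apply (k : Fin 3) (x : E3) : rot k x = imCoord (cross (imUnit k) (imLift x)) := rfl

/-- The spherical Dirac operator `∑ e_k L_k`, where the `L_k` generate the rotations. -/
noncomputable def spherical (u : E3 → ℍ[ℝ]) (x : E3) : ℍ[ℝ] := ∑ k, imUnit k * lie (rot k) u x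

/-- The Euler field. -/
noncomputable abbrev euler : E3 →L[ℝ] E3 := ContinuousLinearMap.id ℝ E3

theorem lie_eq_sum {F : Type*} [NormedAddCommGroup F] [NormedSpace ℝ F] (A : E3 →L[ℝ] E3)
    (u : E3 → F) (x : E3) : lie A u x = ∑ j, (A x j) • fderiv ℝ u x (stdE j) := by
  have h : A x = ∑ j, (A x j) • stdE j := by
    ext i
    fin_cases i <;> simp [Fin.sum_univ_three, stdE]
  conv_lhs => rw [lie, h]
  rw [map_sum]
  simp only [map_smul]

/-- Polar decomposition of the Dirac operator. -/
theorem imLift_mul_dirac (u : E3 → ℍ[ℝ]) (x : E3) :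
    imLift x * dirac u x = -lie euler u x + spherical u x := by
  rw [spherical, lie_eq_sum euler, dirac]
  simp only [lie_eq_sum, rot_apply, Fin.sum_univ_three, imCoord_zero, imCoord_one, imCoord_two,
    cross_imI, cross_imJ, cross_imK, ContinuousLinearMap.id_apply]
  ext <;> simp [imUnit, stdE] <;> ring

theorem contDiff_lie {F : Type*} [NormedAddCommGroup F] [NormedSpace ℝ F] {A : E3 →L[ℝ] E3}
    {u : E3 → F} (hu : ContDiff ℝ ∞ u) : ContDiff ℝ ∞ (lie A u) :=
  (hu.fderiv_right (m := ∞) (by simp)).clm_apply A.contDiff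

theorem hasCompactSupport_lie {F : Type*} [NormedAddCommGroup F] [NormedSpace ℝ F]
    {A : E3 →L[ℝ] E3} {u : E3 → F} (hu : HasCompactSupport u) : HasCompactSupport (lie A u) := by
  refine (hu.fderiv (𝕜 := ℝ)).mono fun x hx => ?_
  rw [Function.mem_support] at hx ⊢
  intro h0
  exact hx (by rw [lie, h0]; rfl)

/-- The divergence of the linear vector field `A` is its trace. -/
theorem integral_lie {A : E3 →L[ℝ] E3} {f : E3 → ℝ} (hf : ContDiff ℝ ∞ f)
    (hc : HasCompactSupport f) :
    ∫ x, lie A f x = -(∑ j, A (stdE j) j) * ∫ x, f x := by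
  have hproj : ∀ j : Fin 3, ContDiff ℝ ∞ (fun x : E3 => A x j) := fun j =>
    (EuclideanSpace.proj j : E3 →L[ℝ] ℝ).contDiff.comp A.contDiff
  have hder : ∀ (j : Fin 3) (x v : E3), fderiv ℝ (fun x : E3 => A x j) x v = A v j := by
    intro j x v
    have : HasFDerivAt (fun x : E3 => A x j)
        ((EuclideanSpace.proj j : E3 →L[ℝ] ℝ).comp A) x :=
      ((EuclideanSpace.proj j : E3 →L[ℝ] ℝ).comp A).hasFDerivAt
    rw [this.fderiv]
    rfl
  have hdf : ∀ j : Fin 3, ContDiff ℝ ∞ (fun x => fderiv ℝ f x (stdE j)) := fun j =>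
    (hf.fderiv_right (m := ∞) (by simp)).clm_apply contDiff_const
  have hdc : ∀ j : Fin 3, HasCompactSupport (fun x => fderiv ℝ f x (stdE j)) := fun j =>
    hc.fderiv_apply (𝕜 := ℝ) (stdE j)
  have hI : ∀ j : Fin 3, MeasureTheory.Integrable (fun x => A x j * fderiv ℝ f x (stdE j)) :=
    fun j => ((hproj j).continuous.mul (hdf j).continuous).integrable_of_hasCompactSupport
      (hdc j).mul_left
  simp only [lie_eq_sum, smul_eq_mul]
  rw [MeasureTheory.integral_finsetSum _ fun j _ => hI j, ← Finset.sum_neg_distrib, Finset.sum_mul]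
  refine Finset.sum_congr rfl fun j _ => ?_
  rw [integral_mul_fderiv_eq_neg_fderiv_mul_of_integrable]
  · simp only [hder]
    rw [MeasureTheory.integral_const_mul, neg_mul]
  · simp only [hder]
    exact (hf.continuous.integrable_of_hasCompactSupport hc).const_mul _
  · exact hI j
  · exact ((hproj j).continuous.mul hf.continuous).integrable_of_hasCompactSupport hc.mul_left
  · exact fun x _ => (hproj j).differentiable (by simp) x
  · exact fun x _ => hf.differentiable (by simp) x

theorem trace_euler : ∑ j, euler (stdE j) j = 3 := by
  simp [stdE]

theorem trace_rot (k : Fin 3) : ∑ j, rot k (stdE j) j = 0 := by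
  simp [rot_apply, Fin.sum_univ_three, stdE]

theorem integral_lie_euler {f : E3 → ℝ} (hf : ContDiff ℝ ∞ f) (hc : HasCompactSupport f) :
    ∫ x, lie euler f x = -3 * ∫ x, f x := by
  rw [integral_lie hf hc, trace_euler]

theorem integral_lie_rot {f : E3 → ℝ} (k : Fin 3) (hf : ContDiff ℝ ∞ f)
    (hc : HasCompactSupport f) : ∫ x, lie (rot k) f x = 0 := by
  rw [integral_lie hf hc, trace_rot]; simp

theorem lie_euler_comm {A : E3 →L[ℝ] E3} {u : E3 → ℍ[ℝ]} (hu : ContDiff ℝ ∞ u) (x : E3) :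
    lie euler (lie A u) x = lie A (lie euler u) x := by
  have hd : ∀ B : E3 →L[ℝ] E3, ∀ v : E3,
      fderiv ℝ (lie B u) x v = fderiv ℝ (fderiv ℝ u) x v (B x) + fderiv ℝ u x (B v) := by
    intro B v
    have h1 : HasFDerivAt (fderiv ℝ u) (fderiv ℝ (fderiv ℝ u) x) x :=
      ((hu.fderiv_right (m := ∞) (by simp)).differentiable (by simp) x).hasFDerivAt
    have h2 : HasFDerivAt (lie B u) _ x := h1.clm_apply (B.hasFDerivAt (x := x))
    rw [h2.fderiv]
    simp [add_comm]
  have hs : fderiv ℝ (fderiv ℝ u) x x (A x) = fderiv ℝ (fderiv ℝ u) x (A x) x :=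
    ((hu.contDiffAt (x := x)).isSymmSndFDerivAt (by
      rw [minSmoothness_of_isRCLikeNormedField]; exact WithTop.coe_le_coe.2 le_top)).eq _ _
  rw [lie, lie, hd, hd]
  simp [hs]

theorem lie_inner {A : E3 →L[ℝ] E3} {u v : E3 → ℍ[ℝ]} (hu : ContDiff ℝ ∞ u)
    (hv : ContDiff ℝ ∞ v) (x : E3) : lie A (fun y => (inner ℝ (u y) (v y) : ℝ)) x =
      inner ℝ (lie A u x) (v x) + inner ℝ (u x) (lie A v x) := by
  rw [lie, fderiv_inner_apply ℝ (hu.differentiable (by simp) x) (hv.differentiable (by simp) x),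
    add_comm]
  rfl

theorem lie_const_mul {A : E3 →L[ℝ] E3} {v : E3 → ℍ[ℝ]} (a : ℍ[ℝ])
    (hv : ContDiff ℝ ∞ v) (x : E3) : lie A (fun y => a * v y) x = a * lie A v x := by
  have h : HasFDerivAt (fun y => a * v y) _ x :=
    (hv.differentiable (by simp) x).hasFDerivAt.const_mul a
  rw [lie, h.fderiv]
  rfl

theorem contDiff_spherical {v : E3 → ℍ[ℝ]} (hv : ContDiff ℝ ∞ v) :
    ContDiff ℝ ∞ (spherical v) :=
  ContDiff.sum fun _ _ => contDiff_const.mul (contDiff_lie hv)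

theorem lie_euler_spherical {v : E3 → ℍ[ℝ]} (hv : ContDiff ℝ ∞ v) (x : E3) :
    lie euler (spherical v) x = spherical (lie euler v) x := by
  have h : HasFDerivAt (spherical v) _ x := HasFDerivAt.fun_sum fun k (_ : k ∈ Finset.univ) =>
    (((contDiff_lie (A := rot k) hv).differentiable (by simp) x).hasFDerivAt.const_mul (imUnit k))
  rw [lie, h.fderiv, spherical, sum_apply]
  refine Finset.sum_congr rfl fun k _ => ?_
  rw [← lie_euler_comm hv]
  rfl

theorem inner_imUnit_mul (k : Fin 3) (a b : ℍ[ℝ]) :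
    inner ℝ a (imUnit k * b) = -inner ℝ (imUnit k * a) b := by
  simp only [inner_eq, Quaternion.re_mul, Quaternion.imI_mul, Quaternion.imJ_mul,
    Quaternion.imK_mul, imUnit, imLift_re]
  ring

/-- The spherical Dirac operator is symmetric, here on `v` and the Euler derivative of `v`. -/
theorem integral_spherical_symm {v : E3 → ℍ[ℝ]} (hv : ContDiff ℝ ∞ v)
    (hc : HasCompactSupport v) :
    ∫ x, (inner ℝ (v x) (spherical (lie euler v) x) : ℝ) =
      ∫ x, inner ℝ (spherical v x) (lie euler v x) := by
  have hE := contDiff_lie (A := euler) hv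
  have hcE := hasCompactSupport_lie (A := euler) hc
  have hk : ∀ k, ContDiff ℝ ∞ (fun y => imUnit k * lie euler v y) := fun k =>
    contDiff_const.mul hE
  have hks : ∀ k, HasCompactSupport (fun y => (inner ℝ (v y) (imUnit k * lie euler v y) : ℝ)) :=
    fun k => hc.mono fun x hx => by
      rw [Function.mem_support] at hx ⊢
      intro h0
      exact hx (by rw [h0, inner_zero_left])
  have h1 : ∀ x, (inner ℝ (v x) (spherical (lie euler v) x) : ℝ)
      - inner ℝ (spherical v x) (lie euler v x) =
      ∑ k, lie (rot k) (fun y => (inner ℝ (v y) (imUnit k * lie euler v y) : ℝ)) x := by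
    intro x
    rw [spherical, spherical, inner_sum, sum_inner, ← Finset.sum_sub_distrib]
    refine Finset.sum_congr rfl fun k _ => ?_
    rw [lie_inner hv (hk k), lie_const_mul _ hE, inner_imUnit_mul k (lie (rot k) v x)]
    ring
  have hi1 : MeasureTheory.Integrable
      (fun x => (inner ℝ (v x) (spherical (lie euler v) x) : ℝ)) :=
    (hv.continuous.inner (contDiff_spherical hE).continuous).integrable_of_hasCompactSupport
      (hc.mono fun x hx => by
        rw [Function.mem_support] at hx ⊢
        intro h0
        exact hx (by rw [h0, inner_zero_left]))
  have hi2 : MeasureTheory.Integrable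
      (fun x => (inner ℝ (spherical v x) (lie euler v x) : ℝ)) :=
    ((contDiff_spherical hv).continuous.inner hE.continuous).integrable_of_hasCompactSupport
      (hcE.mono fun x hx => by
        rw [Function.mem_support] at hx ⊢
        intro h0
        exact hx (by rw [h0, inner_zero_right]))
  rw [← sub_eq_zero, ← MeasureTheory.integral_sub hi1 hi2]
  simp only [h1]
  rw [MeasureTheory.integral_finsetSum]
  · exact Finset.sum_eq_zero fun k _ => integral_lie_rot k (hv.inner ℝ (hk k)) (hks k)
  · exact fun k _ => (contDiff_lie (hv.inner ℝ (hk k))).continuous.integrable_of_hasCompactSupport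
      (hasCompactSupport_lie (hks k))

/-- Since the spherical Dirac operator is symmetric and commutes with the Euler field, the pairing of
the Euler derivative of `v` with `spherical v` is half of a divergence term. -/
theorem integral_euler_spherical {v : E3 → ℍ[ℝ]} (hv : ContDiff ℝ ∞ v)
    (hc : HasCompactSupport v) :
    2 * ∫ x, (inner ℝ (lie euler v x) (spherical v x) : ℝ) =
      -3 * ∫ x, inner ℝ (v x) (spherical v x) := by
  have hE := contDiff_lie (A := euler) hv
  have hcE := hasCompactSupport_lie (A := euler) hc
  have hS := contDiff_spherical hv
  have hi : ∀ a b : E3 → ℍ[ℝ], Continuous a → Continuous b → HasCompactSupport a →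
      MeasureTheory.Integrable (fun x => (inner ℝ (a x) (b x) : ℝ)) := fun a b ha hb hac =>
    (ha.inner hb).integrable_of_hasCompactSupport
      (hac.mono fun x hx => by
        rw [Function.mem_support] at hx ⊢
        intro h0
        exact hx (by rw [h0, inner_zero_left]))
  rw [← integral_lie_euler (hv.inner ℝ hS) (hc.mono fun x hx => by
        rw [Function.mem_support] at hx ⊢
        intro h0
        exact hx (by rw [h0, inner_zero_left]))]
  simp only [lie_inner hv hS, lie_euler_spherical hv]
  rw [MeasureTheory.integral_add (hi _ _ hE.continuous hS.continuous hcE)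
    (hi _ _ hv.continuous (contDiff_spherical hE).continuous hc), integral_spherical_symm hv hc,
    two_mul]
  congr 1
  refine MeasureTheory.integral_congr_ae (Filter.Eventually.of_forall fun x => ?_)
  exact real_inner_comm _ _

end Carleman

section Carleman

/-- The singularity of the weights at the origin is harmless for functions which vanish near it. -/
theorem contDiff_of_eventually_zero {F : Type*} [NormedAddCommGroup F] [NormedSpace ℝ F]
    {u : E3 → F} (h : ∀ x, x ≠ 0 → ContDiffAt ℝ ∞ u x) (h0 : u =ᶠ[nhds 0] 0) :
    ContDiff ℝ ∞ u := by
  rw [contDiff_iff_contDiffAt]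
  intro x
  by_cases hx : x = 0
  · subst hx
    exact contDiffAt_const.congr_of_eventuallyEq h0
  · exact h x hx

/-- The function `1 / |x|²`, which serves as the Carleman weight. -/
noncomputable def invSq (x : E3) : ℝ := (‖x‖ ^ 2)⁻¹

theorem invSq_nonneg (x : E3) : 0 ≤ invSq x := by unfold invSq; positivity

theorem contDiffAt_invSq {x : E3} (hx : x ≠ 0) : ContDiffAt ℝ ∞ invSq x :=
  (contDiff_norm_sq ℝ).contDiffAt.inv (by positivity)

theorem lie_invSq {x : E3} (hx : x ≠ 0) (A : E3 →L[ℝ] E3) :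
    lie A invSq x = -(2 * inner ℝ x (A x)) * invSq x ^ 2 := by
  have h1 : HasFDerivAt (fun y : E3 => ‖y‖ ^ 2) (2 • (innerSL ℝ x)) x :=
    (hasStrictFDerivAt_norm_sq x).hasFDerivAt
  have h2 : HasFDerivAt invSq _ x :=
    (hasDerivAt_inv (x := ‖x‖ ^ 2) (by positivity)).comp_hasFDerivAt x h1
  rw [lie, h2.fderiv]
  simp [invSq]
  ring

theorem inner_rot (k : Fin 3) (x : E3) : inner ℝ x (rot k x) = 0 := by
  simp only [PiLp.inner_apply, Fin.sum_univ_three, rot_apply]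
  fin_cases k <;> simp [imUnit, stdE] <;> ring

theorem lie_euler_invSq {x : E3} (hx : x ≠ 0) : lie euler invSq x = -2 * invSq x := by
  have h : ‖x‖ ^ 2 ≠ 0 := by positivity
  rw [lie_invSq hx, ContinuousLinearMap.id_apply, real_inner_self_eq_norm_sq, invSq]
  field_simp

theorem lie_mul {A : E3 →L[ℝ] E3} {u v : E3 → ℝ} {x : E3} (hu : DifferentiableAt ℝ u x)
    (hv : DifferentiableAt ℝ v x) :
    lie A (fun y => u y * v y) x = u x * lie A v x + lie A u x * v x := by
  rw [lie, fderiv_fun_mul hu hv]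
  simp [lie, mul_comm]

theorem lie_euler_weight {v : E3 → ℍ[ℝ]} (hv : ContDiff ℝ ∞ v) (h0 : v 0 = 0) (x : E3) :
    lie euler (fun x => invSq x * (inner ℝ (v x) (v x) : ℝ)) x =
      invSq x * (2 * inner ℝ (v x) (lie euler v x) - 2 * inner ℝ (v x) (v x)) := by
  by_cases hx : x = 0
  · subst hx
    simp [lie, h0]
  · rw [lie_mul ((contDiffAt_invSq hx).differentiableAt (by simp))
      ((hv.inner ℝ hv).differentiable (by simp) x), lie_euler_invSq hx, lie_inner hv hv,
      real_inner_comm (v x) (lie euler v x)]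
    ring

/-- The pointwise identity behind the Carleman inequality, for `a = lie euler v`, `s = spherical v` and
`ρ = 1 / |x|²`. The three bracketed terms on the right have integral zero, and the difference of the
two sides is `‖a + (3 / 2) v‖ ^ 2 + ‖s + (3 / 2 - 2 τ ρ) v‖ ^ 2`. -/
theorem conj_pointwise (a s v : ℍ[ℝ]) (ρ τ : ℝ) :
    4 * τ * (ρ * inner ℝ v v) ≤ ‖-a + s - (2 * τ * ρ) • v‖ ^ 2
      + (2 * inner ℝ a s + 3 * inner ℝ v s) + (9 / 2 * inner ℝ v v + 3 * inner ℝ v a)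
      - 2 * τ * (ρ * (2 * inner ℝ v a - 2 * inner ℝ v v) + 3 * (ρ * inner ℝ v v)) := by
  have h1 : 0 ≤ ‖a + (3 / 2 : ℝ) • v‖ ^ 2 + ‖s + (3 / 2 - 2 * τ * ρ) • v‖ ^ 2 := by positivity
  have h2 : -a + s - (2 * τ * ρ) • v =
      (s + (3 / 2 - 2 * τ * ρ) • v) - (a + (3 / 2 : ℝ) • v) := by module
  have h3 : inner ℝ (s + (3 / 2 - 2 * τ * ρ) • v) (a + (3 / 2 : ℝ) • v) =
      inner ℝ a s + 3 / 2 * inner ℝ v s + (3 / 2 - 2 * τ * ρ) * inner ℝ v a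
        + 3 / 2 * (3 / 2 - 2 * τ * ρ) * inner ℝ v v := by
    simp only [inner_add_left, inner_add_right, inner_smul_left, inner_smul_right, conj_trivial,
      real_inner_comm a s, real_inner_comm v s]
    ring
  rw [h2, norm_sub_sq_real, h3]
  linarith

theorem integrable_inner {a b : E3 → ℍ[ℝ]} (ha : Continuous a) (hb : Continuous b)
    (hc : HasCompactSupport a) : MeasureTheory.Integrable (fun x => (inner ℝ (a x) (b x) : ℝ)) :=
  (ha.inner hb).integrable_of_hasCompactSupport (hc.mono fun x hx => by
    rw [Function.mem_support] at hx ⊢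
    intro h0
    exact hx (by rw [h0, inner_zero_left]))

theorem contDiff_invSq_smul {F : Type*} [NormedAddCommGroup F] [NormedSpace ℝ F] {u : E3 → F}
    (hu : ContDiff ℝ ∞ u) (h0 : u =ᶠ[nhds 0] 0) : ContDiff ℝ ∞ (fun x => invSq x • u x) :=
  contDiff_of_eventually_zero (fun _ hx => (contDiffAt_invSq hx).smul hu.contDiffAt)
    (by filter_upwards [h0] with x hx; simp [hx])

/-- The integrated form of `conj_pointwise`. -/
theorem integral_le_of_pointwise {T F L f₁ f₂ f₃ f₄ : E3 → ℝ} {τ : ℝ}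
    (iT : MeasureTheory.Integrable T) (iF : MeasureTheory.Integrable F)
    (iL : MeasureTheory.Integrable L) (i₁ : MeasureTheory.Integrable f₁)
    (i₂ : MeasureTheory.Integrable f₂) (i₃ : MeasureTheory.Integrable f₃)
    (i₄ : MeasureTheory.Integrable f₄)
    (h : ∀ x, 4 * τ * F x ≤ T x + (2 * f₁ x + 3 * f₂ x) + (9 / 2 * f₃ x + 3 * f₄ x)
      - 2 * τ * (L x + 3 * F x))
    (h₁ : 2 * ∫ x, f₁ x = -3 * ∫ x, f₂ x) (h₂ : 2 * ∫ x, f₄ x = -3 * ∫ x, f₃ x)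
    (h₃ : ∫ x, L x = -3 * ∫ x, F x) : ∫ x, 4 * τ * F x ≤ ∫ x, T x := by
  have j₁ : MeasureTheory.Integrable (fun x => 2 * f₁ x + 3 * f₂ x) :=
    (i₁.const_mul 2).add (i₂.const_mul 3)
  have j₂ : MeasureTheory.Integrable (fun x => 9 / 2 * f₃ x + 3 * f₄ x) :=
    (i₃.const_mul (9 / 2)).add (i₄.const_mul 3)
  have j₃ : MeasureTheory.Integrable (fun x => L x + 3 * F x) := iL.add (iF.const_mul 3)
  have j₄ : MeasureTheory.Integrable (fun x => T x + (2 * f₁ x + 3 * f₂ x)) := iT.add j₁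
  have j₅ : MeasureTheory.Integrable
      (fun x => T x + (2 * f₁ x + 3 * f₂ x) + (9 / 2 * f₃ x + 3 * f₄ x)) := j₄.add j₂
  refine (MeasureTheory.integral_mono (iF.const_mul _) (j₅.sub (j₃.const_mul (2 * τ))) h).trans_eq ?_
  rw [MeasureTheory.integral_sub' j₅ (j₃.const_mul (2 * τ)), MeasureTheory.integral_add j₄ j₂,
    MeasureTheory.integral_add iT j₁, MeasureTheory.integral_add (i₁.const_mul 2) (i₂.const_mul 3),
    MeasureTheory.integral_add (i₃.const_mul _) (i₄.const_mul 3), MeasureTheory.integral_const_mul,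
    MeasureTheory.integral_const_mul, MeasureTheory.integral_const_mul,
    MeasureTheory.integral_const_mul, MeasureTheory.integral_const_mul,
    MeasureTheory.integral_add iL (iF.const_mul 3), MeasureTheory.integral_const_mul, h₃]
  linear_combination h₁ + (3 / 2) * h₂

/-- The Carleman inequality in the form of a lower bound for the conjugated operator. -/
theorem carleman_conj {v : E3 → ℍ[ℝ]} (hv : ContDiff ℝ ∞ v) (hc : HasCompactSupport v)
    (h0 : v =ᶠ[nhds 0] 0) (τ : ℝ) :
    ∫ x, 4 * τ * (invSq x * inner ℝ (v x) (v x)) ≤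
      ∫ x, ‖-lie euler v x + spherical v x - (2 * τ * invSq x) • v x‖ ^ 2 := by
  have hE := contDiff_lie (A := euler) hv
  have hcE := hasCompactSupport_lie (A := euler) hc
  have hS := contDiff_spherical hv
  have hvv : ContDiff ℝ ∞ (fun x => (inner ℝ (v x) (v x) : ℝ)) := hv.inner ℝ hv
  have hvvc : HasCompactSupport (fun x => (inner ℝ (v x) (v x) : ℝ)) :=
    hc.mono fun x hx => by
      rw [Function.mem_support] at hx ⊢
      intro h0
      exact hx (by rw [h0, inner_zero_left])
  have hF : ContDiff ℝ ∞ (fun x => invSq x * (inner ℝ (v x) (v x) : ℝ)) :=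
    contDiff_invSq_smul hvv (by filter_upwards [h0] with x hx; simp [hx])
  have hFc : HasCompactSupport (fun x => invSq x * (inner ℝ (v x) (v x) : ℝ)) := hvvc.mul_left
  have iF := hF.continuous.integrable_of_hasCompactSupport hFc (μ := MeasureTheory.volume)
  have iL := (contDiff_lie (A := euler) hF).continuous.integrable_of_hasCompactSupport
    (hasCompactSupport_lie hFc) (μ := MeasureTheory.volume)
  have i1 := integrable_inner hE.continuous hS.continuous hcE
  have i2 := integrable_inner hv.continuous hS.continuous hc
  have i3 := integrable_inner hv.continuous hv.continuous hc
  have i4 := integrable_inner hv.continuous hE.continuous hc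
  have hTd : ContDiff ℝ ∞
      (fun x => -lie euler v x + spherical v x - (2 * τ * invSq x) • v x) := by
    refine (hE.neg.add hS).sub ?_
    have h : ContDiff ℝ ∞ (fun x => (2 * τ) • invSq x • v x) :=
      (contDiff_invSq_smul hv h0).const_smul (2 * τ)
    simpa only [smul_smul] using h
  have hTc : HasCompactSupport
      (fun x => -lie euler v x + spherical v x - (2 * τ * invSq x) • v x) := by
    refine HasCompactSupport.intro' hc (isClosed_tsupport v) fun x hx => ?_
    have h1 : v x = 0 := image_eq_zero_of_notMem_tsupport hx
    have h2 : fderiv ℝ v x = 0 := fderiv_of_notMem_tsupport ℝ hx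
    simp [lie, spherical, h1, h2]
  have iT : MeasureTheory.Integrable
      (fun x => ‖-lie euler v x + spherical v x - (2 * τ * invSq x) • v x‖ ^ 2) := by
    simpa only [real_inner_self_eq_norm_sq] using integrable_inner hTd.continuous hTd.continuous hTc
  have e1 := integral_lie_euler hF hFc
  have e2 := integral_euler_spherical hv hc
  have e3 := integral_lie_euler hvv hvvc
  have e4 : ∫ x, lie euler (fun x => (inner ℝ (v x) (v x) : ℝ)) x =
      2 * ∫ x, (inner ℝ (v x) (lie euler v x) : ℝ) := by
    rw [← MeasureTheory.integral_const_mul]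
    congr 1
    ext x
    rw [lie_inner hv hv, real_inner_comm (v x) (lie euler v x)]
    ring
  refine integral_le_of_pointwise iT iF iL i1 i2 i3 i4 (fun x => ?_) e2 (e4.symm.trans e3) e1
  have h := conj_pointwise (lie euler v x) (spherical v x) (v x) (invSq x) τ
  rwa [← lie_euler_weight hv h0.self_of_nhds] at h

theorem lie_exp_smul {u : E3 → ℍ[ℝ]} (hu : ContDiff ℝ ∞ u) (τ : ℝ) {x : E3} (hx : x ≠ 0)
    (A : E3 →L[ℝ] E3) : lie A (fun y => Real.exp (τ * invSq y) • u y) x =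
      Real.exp (τ * invSq x) • (lie A u x + (τ * lie A invSq x) • u x) := by
  have h1 : HasFDerivAt invSq (fderiv ℝ invSq x) x :=
    ((contDiffAt_invSq hx).differentiableAt (by simp)).hasFDerivAt
  have h2 : HasFDerivAt (fun y => Real.exp (τ * invSq y) • u y) _ x :=
    ((h1.const_mul τ).exp).smul (hu.differentiable (by simp) x).hasFDerivAt
  rw [lie, h2.fderiv]
  simp [lie, smul_smul, mul_assoc]

/-- Conjugation of the Dirac operator with the exponential weight. -/
theorem conj_dirac {u : E3 → ℍ[ℝ]} (hu : ContDiff ℝ ∞ u) (τ : ℝ) {x : E3} (hx : x ≠ 0) :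
    -lie euler (fun y => Real.exp (τ * invSq y) • u y) x
      + spherical (fun y => Real.exp (τ * invSq y) • u y) x
      - (2 * τ * invSq x) • Real.exp (τ * invSq x) • u x =
      Real.exp (τ * invSq x) • (imLift x * dirac u x) := by
  rw [imLift_mul_dirac, lie_exp_smul hu τ hx, lie_euler_invSq hx, spherical, spherical]
  simp only [lie_exp_smul hu τ hx, lie_invSq hx, inner_rot]
  simp only [mul_zero, neg_zero, zero_mul, zero_smul, add_zero, mul_smul_comm,
    ← Finset.smul_sum]
  module

theorem norm_imLift_sq (x : E3) : ‖imLift x‖ ^ 2 = ‖x‖ ^ 2 := by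
  rw [norm_sq_eq, EuclideanSpace.norm_sq_eq]
  simp [Fin.sum_univ_three]

theorem exp_sq_weight (τ : ℝ) (x : E3) :
    Real.exp (τ * invSq x) ^ 2 = Real.exp (2 * τ * invSq x) := by
  rw [← Real.exp_nat_mul]
  congr 1
  push_cast
  ring

theorem norm_exp_smul_sq (t : ℝ) (a : ℍ[ℝ]) :
    ‖Real.exp t • a‖ ^ 2 = Real.exp t ^ 2 * ‖a‖ ^ 2 := by
  rw [norm_smul, mul_pow, Real.norm_eq_abs, sq_abs]

/-- The Carleman inequality for the Dirac operator with the weight `exp (τ / |x|²)`. -/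
theorem carleman {u : E3 → ℍ[ℝ]} (hu : ContDiff ℝ ∞ u) (hc : HasCompactSupport u)
    (h0 : u =ᶠ[nhds 0] 0) (τ : ℝ) :
    ∫ x, 4 * τ * (invSq x * (Real.exp (2 * τ * invSq x) * ‖u x‖ ^ 2)) ≤
      ∫ x, Real.exp (2 * τ * invSq x) * (‖x‖ ^ 2 * ‖dirac u x‖ ^ 2) := by
  have hexp : ∀ x, x ≠ 0 → ContDiffAt ℝ ∞ (fun y => Real.exp (τ * invSq y)) x := fun x hx =>
    (contDiffAt_const.mul (contDiffAt_invSq hx)).exp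
  have hv0 : (fun x => Real.exp (τ * invSq x) • u x) =ᶠ[nhds 0] 0 := by
    filter_upwards [h0] with x hx
    simp [hx]
  have hv : ContDiff ℝ ∞ (fun x => Real.exp (τ * invSq x) • u x) :=
    contDiff_of_eventually_zero (fun x hx => (hexp x hx).smul hu.contDiffAt) hv0
  have hvc : HasCompactSupport (fun x => Real.exp (τ * invSq x) • u x) :=
    hc.smul_left (f := fun x => Real.exp (τ * invSq x))
  have h := carleman_conj hv hvc hv0 τ
  have e1 : ∀ x, 4 * τ * (invSq x * (inner ℝ (Real.exp (τ * invSq x) • u x)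
      (Real.exp (τ * invSq x) • u x) : ℝ)) =
      4 * τ * (invSq x * (Real.exp (2 * τ * invSq x) * ‖u x‖ ^ 2)) := by
    intro x
    rw [real_inner_self_eq_norm_sq, norm_exp_smul_sq, exp_sq_weight]
  have e2 : ∀ᵐ x : E3, ‖-lie euler (fun y => Real.exp (τ * invSq y) • u y) x
      + spherical (fun y => Real.exp (τ * invSq y) • u y) x
      - (2 * τ * invSq x) • Real.exp (τ * invSq x) • u x‖ ^ 2 =
      Real.exp (2 * τ * invSq x) * (‖x‖ ^ 2 * ‖dirac u x‖ ^ 2) := by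
    -- at the origin the conjugated operator involves the junk value of the weight
    have : ∀ᵐ x : E3, x ≠ 0 := by
      rw [MeasureTheory.ae_iff]
      simp
    filter_upwards [this] with x hx
    rw [conj_dirac hu τ hx, norm_exp_smul_sq, exp_sq_weight, norm_mul, mul_pow, norm_imLift_sq]
  rw [MeasureTheory.integral_congr_ae e2] at h
  simpa only [e1] using h

end Carleman

section Carleman

open Metric MeasureTheory

theorem dirac_congr {u v : E3 → ℍ[ℝ]} {x : E3} (h : u =ᶠ[nhds x] v) : dirac u x = dirac v x := by
  rw [dirac, dirac, h.fderiv_eq]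

theorem contDiff_dirac {u : E3 → ℍ[ℝ]} (hu : ContDiff ℝ ∞ u) : ContDiff ℝ ∞ (dirac u) :=
  ContDiff.sum fun _ _ => contDiff_const.mul
    ((hu.fderiv_right (m := ∞) (by simp)).clm_apply contDiff_const)

theorem dirac_of_notMem_tsupport {u : E3 → ℍ[ℝ]} {x : E3} (h : x ∉ tsupport u) :
    dirac u x = 0 := by
  simp [dirac, fderiv_of_notMem_tsupport ℝ h]

theorem exists_cutoff {u : E3 → ℍ[ℝ]} {R₁ R₂ R : ℝ} (h1 : 0 < R₁) (h12 : R₁ < R₂) (h2 : R₂ < R)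
    (hu : ContDiffOn ℝ ∞ u (ball 0 R)) : ∃ U : E3 → ℍ[ℝ], ContDiff ℝ ∞ U ∧
      tsupport U ⊆ closedBall 0 R₂ ∧ ∀ x ∈ ball (0 : E3) R₁, U x = u x := by
  let χ : ContDiffBump (0 : E3) := ⟨R₁, R₂, h1, h12⟩
  have hs : tsupport (fun x => χ x • u x) ⊆ closedBall 0 R₂ :=
    (tsupport_smul_subset_left (fun x => χ x) u).trans χ.tsupport_eq.subset
  refine ⟨fun x => χ x • u x, ?_, hs, ?_⟩
  · rw [contDiff_iff_contDiffAt]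
    intro x
    by_cases hx : x ∈ ball (0 : E3) R
    · exact χ.contDiff.contDiffAt.smul (hu.contDiffAt (isOpen_ball.mem_nhds hx))
    · have hx' : x ∉ tsupport (fun x => χ x • u x) := fun h =>
        hx (closedBall_subset_ball h2 (hs h))
      exact contDiffAt_const.congr_of_eventuallyEq (notMem_tsupport_iff_eventuallyEq.1 hx')
  · intro x hx
    simp only
    rw [χ.one_of_mem_closedBall (ball_subset_closedBall hx), one_smul]

theorem sq_sum_le (a : Fin 3 → ℝ) : (∑ l, a l) ^ 2 ≤ 3 * ∑ l, a l ^ 2 := by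
  simp only [Fin.sum_univ_three]
  nlinarith [sq_nonneg (a 0 - a 1), sq_nonneg (a 1 - a 2), sq_nonneg (a 0 - a 2)]

/-- The Carleman inequality, with the error terms inside a ball absorbed. -/
theorem carleman_absorb {U : Fin 3 → E3 → ℍ[ℝ]} {R₁ R₂ K : ℝ} (h1 : 0 < R₁)
    (hU : ∀ l, ContDiff ℝ ∞ (U l)) (hs : ∀ l, tsupport (U l) ⊆ closedBall 0 R₂)
    (h0 : ∀ l, U l =ᶠ[nhds 0] 0)
    (hK : ∀ l, ∀ x ∈ ball (0 : E3) R₁, ‖dirac (U l) x‖ ≤ K * ∑ m, ‖U m x‖) :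
    ∃ C : ℝ, ∀ τ : ℝ, 9 * K ^ 2 * R₁ ^ 4 + 1 ≤ 4 * τ →
      Integrable (fun x => invSq x * (Real.exp (2 * τ * invSq x) * ∑ l, ‖U l x‖ ^ 2)) ∧
      ∫ x, invSq x * (Real.exp (2 * τ * invSq x) * ∑ l, ‖U l x‖ ^ 2) ≤
        C * Real.exp (2 * τ * (R₁ ^ 2)⁻¹) := by
  have hc : ∀ l, HasCompactSupport (U l) := fun l =>
    (isCompact_closedBall (0 : E3) R₂).of_isClosed_subset (isClosed_tsupport _) (hs l)
  -- a bound for the error term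
  have hq : Continuous (fun x : E3 => ‖x‖ ^ 2 * ∑ l, ‖dirac (U l) x‖ ^ 2) :=
    (continuous_norm.pow 2).mul (continuous_finsetSum _ fun l _ =>
      ((contDiff_dirac (hU l)).continuous.norm.pow 2))
  obtain ⟨B, hB⟩ := (isCompact_closedBall (0 : E3) R₂).bddAbove_image hq.continuousOn
  have hB' : ∀ x ∈ closedBall (0 : E3) R₂, ‖x‖ ^ 2 * ∑ l, ‖dirac (U l) x‖ ^ 2 ≤ B := fun x hx =>
    hB ⟨x, hx, rfl⟩
  refine ⟨|B| * volume.real (closedBall (0 : E3) R₂), fun τ hτ => ?_⟩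
  have hτ0 : 0 ≤ τ := by nlinarith [sq_nonneg (K * R₁ ^ 2)]
  have hzero : ∀ l, ∀ᶠ x in nhds (0 : E3), dirac (U l) x = 0 := by
    intro l
    filter_upwards [(h0 l).eventuallyEq_nhds] with x hx
    rw [dirac_congr hx]
    simp [dirac]
  have hexp : ∀ x : E3, x ≠ 0 → ContDiffAt ℝ ∞ (fun y => Real.exp (2 * τ * invSq y)) x :=
    fun x hx => (contDiffAt_const.mul (contDiffAt_invSq hx)).exp
  have hN : ∀ l, ContDiff ℝ ∞ (fun x => ‖U l x‖ ^ 2) := fun l => (hU l).norm_sq ℝ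
  have if1 : ∀ l, Integrable (fun x => invSq x * (Real.exp (2 * τ * invSq x) * ‖U l x‖ ^ 2)) := by
    intro l
    refine (contDiff_of_eventually_zero (fun x hx => (contDiffAt_invSq hx).mul
      ((hexp x hx).mul (hN l).contDiffAt)) ?_).continuous.integrable_of_hasCompactSupport
      (HasCompactSupport.intro' (hc l) (isClosed_tsupport _) fun x hx => ?_)
    · filter_upwards [h0 l] with x hx
      simp [hx]
    · simp [image_eq_zero_of_notMem_tsupport hx]
  have ih1 : ∀ l, Integrable
      (fun x => Real.exp (2 * τ * invSq x) * (‖x‖ ^ 2 * ‖dirac (U l) x‖ ^ 2)) := by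
    intro l
    refine (contDiff_of_eventually_zero (fun x hx => (hexp x hx).mul
      ((contDiff_norm_sq ℝ).contDiffAt.mul ((contDiff_dirac (hU l)).norm_sq ℝ).contDiffAt))
      ?_).continuous.integrable_of_hasCompactSupport
      (HasCompactSupport.intro' (hc l) (isClosed_tsupport _) fun x hx => ?_)
    · filter_upwards [hzero l] with x hx
      simp [hx]
    · simp [dirac_of_notMem_tsupport hx]
  set f : E3 → ℝ := fun x => invSq x * (Real.exp (2 * τ * invSq x) * ∑ l, ‖U l x‖ ^ 2) with hf
  have hfs : f = fun x => ∑ l, invSq x * (Real.exp (2 * τ * invSq x) * ‖U l x‖ ^ 2) := by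
    ext x
    simp only [hf, Finset.mul_sum]
  have iF : Integrable f := by
    rw [hfs]
    exact integrable_finsetSum _ fun l _ => if1 l
  have hf0 : ∀ x, 0 ≤ f x := fun x => mul_nonneg (invSq_nonneg x) (by positivity)
  refine ⟨iF, ?_⟩
  set h : E3 → ℝ := fun x =>
    Real.exp (2 * τ * invSq x) * (‖x‖ ^ 2 * ∑ l, ‖dirac (U l) x‖ ^ 2) with hh
  have hhs : h = fun x => ∑ l, Real.exp (2 * τ * invSq x) * (‖x‖ ^ 2 * ‖dirac (U l) x‖ ^ 2) := by
    ext x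
    simp only [hh, Finset.mul_sum]
  have iH : Integrable h := by
    rw [hhs]
    exact integrable_finsetSum _ fun l _ => ih1 l
  have hcar : 4 * τ * ∫ x, f x ≤ ∫ x, h x := by
    rw [hfs, hhs, integral_finsetSum _ fun l _ => if1 l, integral_finsetSum _ fun l _ => ih1 l,
      Finset.mul_sum]
    refine Finset.sum_le_sum fun l _ => ?_
    rw [← integral_const_mul]
    exact carleman (hU l) (hc l) (h0 l) τ
  set W := Real.exp (2 * τ * (R₁ ^ 2)⁻¹) with hW
  have iC : Integrable ((closedBall (0 : E3) R₂).indicator fun _ => |B| * W) :=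
    (integrable_indicator_iff measurableSet_closedBall).2
      (integrableOn_const measure_closedBall_lt_top.ne)
  have hpt : ∀ x, h x ≤ 9 * K ^ 2 * R₁ ^ 4 * f x
      + (closedBall (0 : E3) R₂).indicator (fun _ => |B| * W) x := by
    intro x
    have hind : 0 ≤ (closedBall (0 : E3) R₂).indicator (fun _ => |B| * W) x :=
      Set.indicator_nonneg (fun _ _ => by positivity) x
    by_cases hx : x ∈ ball (0 : E3) R₁
    · refine le_trans ?_ (le_add_of_nonneg_right hind)
      by_cases hx0 : x = 0
      · subst hx0
        simp [hh, hf, invSq]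
      have hb : ∑ l, ‖dirac (U l) x‖ ^ 2 ≤ 9 * K ^ 2 * ∑ l, ‖U l x‖ ^ 2 := by
        have h3 : ∀ l, ‖dirac (U l) x‖ ^ 2 ≤ K ^ 2 * (3 * ∑ l, ‖U l x‖ ^ 2) := by
          intro l
          refine (pow_le_pow_left₀ (norm_nonneg _) (hK l x hx) 2).trans ?_
          rw [mul_pow]
          exact mul_le_mul_of_nonneg_left (sq_sum_le _) (sq_nonneg _)
        refine (Finset.sum_le_sum fun l _ => h3 l).trans_eq ?_
        simp
        ring
      have hxR : ‖x‖ ≤ R₁ := by simpa using (mem_ball_zero_iff.1 hx).le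
      have hx2 : ‖x‖ ^ 2 ≤ R₁ ^ 4 * invSq x := by
        have : 0 < ‖x‖ := by simpa using hx0
        rw [invSq, ← div_eq_mul_inv, le_div_iff₀ (by positivity)]
        calc ‖x‖ ^ 2 * ‖x‖ ^ 2 = ‖x‖ ^ 4 := by ring
          _ ≤ R₁ ^ 4 := pow_le_pow_left₀ (norm_nonneg _) hxR 4
      calc h x ≤ Real.exp (2 * τ * invSq x) *
            ((R₁ ^ 4 * invSq x) * (9 * K ^ 2 * ∑ l, ‖U l x‖ ^ 2)) := by
            simp only [hh]
            have := invSq_nonneg x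
            gcongr
        _ = 9 * K ^ 2 * R₁ ^ 4 * f x := by
            simp only [hf]
            ring
    · by_cases hx2 : x ∈ closedBall (0 : E3) R₂
      · rw [Set.indicator_of_mem hx2]
        refine le_trans ?_ (le_add_of_nonneg_left (mul_nonneg (by positivity) (hf0 x)))
        have hxR : R₁ ≤ ‖x‖ := by simpa using hx
        have hw : Real.exp (2 * τ * invSq x) ≤ W := by
          rw [hW, Real.exp_le_exp, invSq]
          gcongr
        calc h x ≤ W * |B| := by
              simp only [hh]
              exact mul_le_mul hw ((hB' x hx2).trans (le_abs_self B)) (by positivity)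
                (by positivity)
          _ = |B| * W := mul_comm _ _
      · have hd : ∀ l, dirac (U l) x = 0 := fun l =>
          dirac_of_notMem_tsupport fun hh => hx2 (hs l hh)
        have : h x = 0 := by simp [hh, hd]
        rw [this]
        exact add_nonneg (mul_nonneg (by positivity) (hf0 x)) hind
  have hint := integral_mono iH ((iF.const_mul _).add iC) hpt
  rw [integral_add' (iF.const_mul _) iC, integral_const_mul,
    integral_indicator measurableSet_closedBall, setIntegral_const, smul_eq_mul] at hint
  have hfi : 0 ≤ ∫ x, f x := integral_nonneg hf0
  nlinarith

/-- Unique continuation from a point for solutions of a Dirac type differential inequality. -/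
theorem unique_continuation {u : Fin 3 → E3 → ℍ[ℝ]} {R K : ℝ}
    (hu : ∀ l, ContDiffOn ℝ ∞ (u l) (ball 0 R))
    (hK : ∀ l, ∀ x ∈ ball (0 : E3) R, ‖dirac (u l) x‖ ≤ K * ∑ m, ‖u m x‖)
    (h0 : ∀ l, u l =ᶠ[nhds 0] 0) : ∀ l, ∀ x ∈ ball (0 : E3) R, u l x = 0 := by
  intro l x₀ hx₀
  by_contra hne
  have hrR : ‖x₀‖ < R := by simpa using hx₀
  obtain ⟨r, hr, hrR⟩ := exists_between hrR
  obtain ⟨R₁, hR₁, hrR⟩ := exists_between hrR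
  obtain ⟨R₂, hR₂, hR⟩ := exists_between hrR
  have hr0 : 0 < r := (norm_nonneg _).trans_lt hr
  have hR₁0 : 0 < R₁ := hr0.trans hR₁
  choose U hU hs hUu using fun l => exists_cutoff hR₁0 hR₂ hR (hu l)
  have hUev : ∀ l, ∀ x ∈ ball (0 : E3) R₁, U l =ᶠ[nhds x] u l := by
    intro l x hx
    filter_upwards [isOpen_ball.mem_nhds hx] with y hy
    exact hUu l y hy
  obtain ⟨C, hC⟩ := carleman_absorb (K := K) hR₁0 hU hs
    (fun l => (hUev l 0 (by simpa using hR₁0)).trans (h0 l)) (by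
      intro l x hx
      rw [dirac_congr (hUev l x hx)]
      simp only [hUu _ x hx]
      exact hK l x (ball_subset_ball (hR₂.trans hR).le hx))
  -- near `x₀` the functions are bounded away from zero
  have hx₀R : x₀ ∈ ball (0 : E3) R₁ := by simpa using hr.trans hR₁
  have hpos : 0 < ∑ l, ‖U l x₀‖ ^ 2 := by
    refine Finset.sum_pos' (fun _ _ => by positivity) ⟨l, Finset.mem_univ _, ?_⟩
    rw [hUu l x₀ hx₀R]
    positivity
  have hcont : Continuous (fun x => ∑ l, ‖U l x‖ ^ 2) :=
    continuous_finsetSum _ fun l _ => (hU l).continuous.norm.pow 2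
  set c := (∑ l, ‖U l x₀‖ ^ 2) / 2 with hc
  have hc0 : 0 < c := by positivity
  obtain ⟨δ, hδ, hball⟩ : ∃ δ > 0, ∀ x ∈ ball x₀ δ, c < ∑ l, ‖U l x‖ ^ 2 ∧ ‖x‖ < r := by
    have h1 : ∀ᶠ x in nhds x₀, c < ∑ l, ‖U l x‖ ^ 2 :=
      (hcont.tendsto x₀).eventually (lt_mem_nhds (by rw [hc]; linarith))
    have h2 : ∀ᶠ x in nhds x₀, ‖x‖ < r := (continuous_norm.tendsto x₀).eventually (gt_mem_nhds hr)
    exact Metric.eventually_nhds_iff_ball.1 (h1.and h2)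
  have hU0 : ∀ l, U l 0 = 0 := fun l =>
    ((hUev l 0 (by simpa using hR₁0)).trans (h0 l)).self_of_nhds
  set m := (r ^ 2)⁻¹ * c * volume.real (ball x₀ δ) with hm
  have hvol : 0 < volume.real (ball x₀ δ) :=
    ENNReal.toReal_pos (measure_ball_pos _ _ hδ).ne' measure_ball_lt_top.ne
  have hm0 : 0 < m := by positivity
  have hlow : ∀ τ : ℝ, 9 * K ^ 2 * R₁ ^ 4 + 1 ≤ 4 * τ →
      m * Real.exp (2 * τ * (r ^ 2)⁻¹) ≤ C * Real.exp (2 * τ * (R₁ ^ 2)⁻¹) := by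
    intro τ hτ
    have hτ0 : 0 ≤ τ := by nlinarith [sq_nonneg (K * R₁ ^ 2)]
    obtain ⟨hi, hle⟩ := hC τ hτ
    refine le_trans ?_ hle
    have h1 : ∀ x ∈ ball x₀ δ, (r ^ 2)⁻¹ * (Real.exp (2 * τ * (r ^ 2)⁻¹) * c) ≤
        invSq x * (Real.exp (2 * τ * invSq x) * ∑ l, ‖U l x‖ ^ 2) := by
      intro x hx
      obtain ⟨hx1, hx2⟩ := hball x hx
      have hx0 : x ≠ 0 := by
        rintro rfl
        simp only [hU0, norm_zero] at hx1
        norm_num at hx1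
        linarith
      have hxp : 0 < ‖x‖ := by simpa using hx0
      have h2 : (r ^ 2)⁻¹ ≤ invSq x := by
        rw [invSq]
        gcongr
      have := invSq_nonneg x
      gcongr
    calc m * Real.exp (2 * τ * (r ^ 2)⁻¹)
        = ∫ _ in ball x₀ δ, (r ^ 2)⁻¹ * (Real.exp (2 * τ * (r ^ 2)⁻¹) * c) := by
          rw [setIntegral_const, smul_eq_mul, hm]
          ring
      _ ≤ ∫ x in ball x₀ δ, invSq x * (Real.exp (2 * τ * invSq x) * ∑ l, ‖U l x‖ ^ 2) :=
          setIntegral_mono_on (integrableOn_const measure_ball_lt_top.ne) hi.integrableOn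
            measurableSet_ball h1
      _ ≤ _ := setIntegral_le_integral hi
          (Filter.Eventually.of_forall fun x => mul_nonneg (invSq_nonneg x) (by positivity))
  -- the weight at radius `r` beats the weight at radius `R₁`
  have hgap : 0 < (r ^ 2)⁻¹ - (R₁ ^ 2)⁻¹ := by
    rw [sub_pos]
    gcongr
  have hlim : Filter.Tendsto (fun τ : ℝ => Real.exp (2 * τ * ((r ^ 2)⁻¹ - (R₁ ^ 2)⁻¹)))
      Filter.atTop Filter.atTop := by
    refine Real.tendsto_exp_atTop.comp (Filter.Tendsto.atTop_mul_const hgap ?_)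
    exact Filter.tendsto_id.const_mul_atTop (by norm_num)
  obtain ⟨τ, hτ1, hτ2⟩ := ((hlim.eventually_gt_atTop (C / m)).and
    (Filter.eventually_ge_atTop ((9 * K ^ 2 * R₁ ^ 4 + 1) / 4))).exists
  have h3 := hlow τ (by linarith)
  rw [mul_sub, Real.exp_sub, div_lt_div_iff₀ hm0 (Real.exp_pos _)] at hτ1
  linarith

end Carleman

/-! ### Unique continuation for Lagrangian immersions -/

section Cayley

open Metric

/-- `imLift` as a continuous linear map. -/
noncomputable def imLiftCLM : E3 →L[ℝ] ℍ[ℝ] := LinearMap.toContinuousLinearMap imLift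

theorem hasFDerivAt_imLift (y : E3) : HasFDerivAt (fun z : E3 => imLift z) imLiftCLM y :=
  imLiftCLM.hasFDerivAt

theorem contDiff_imLift : ContDiff ℝ ∞ (fun z : E3 => imLift z) := imLiftCLM.contDiff

theorem inner_mul_mul (c v d a : ℍ[ℝ]) :
    inner ℝ (c * v * d) a = inner ℝ v (star c * a * star d) := by
  simp only [inner_eq, Quaternion.re_mul, Quaternion.imI_mul, Quaternion.imJ_mul,
    Quaternion.imK_mul, Quaternion.re_star, Quaternion.imI_star, Quaternion.imJ_star,
    Quaternion.imK_star]
  ring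

theorem star_of_re_eq_zero {a : ℍ[ℝ]} (h : a.re = 0) : star a = -a := by
  ext <;> simp [h]

theorem mul_self_of_re_eq_zero {a : ℍ[ℝ]} (h : a.re = 0) : a * a = ((-‖a‖ ^ 2 : ℝ) : ℍ[ℝ]) := by
  rw [norm_sq_eq]
  ext <;> simp only [Quaternion.re_mul, Quaternion.imI_mul, Quaternion.imJ_mul, Quaternion.imK_mul,
    Quaternion.re_coe, Quaternion.imI_coe, Quaternion.imJ_coe, Quaternion.imK_coe, h] <;> ring

/-- The conformal factor `1 + |y|²` of the Cayley transform. -/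
noncomputable def cayN (y : E3) : ℝ := 1 + ‖imLift y‖ ^ 2

theorem cayN_pos (y : E3) : 0 < cayN y := by unfold cayN; positivity

theorem one_sub_mul_one_add (y : E3) :
    (1 - imLift y) * (1 + imLift y) = ((cayN y : ℝ) : ℍ[ℝ]) := by
  have h := mul_self_of_re_eq_zero (imLift_re y)
  rw [show (1 - imLift y) * (1 + imLift y) = 1 - imLift y * imLift y by noncomm_ring, h, cayN]
  ext <;> simp

theorem one_add_mul_one_sub (y : E3) :
    (1 + imLift y) * (1 - imLift y) = ((cayN y : ℝ) : ℍ[ℝ]) := by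
  rw [← one_sub_mul_one_add]; noncomm_ring

/-- The Maurer–Cartan form in the coordinates of the Cayley transform. -/
theorem mc_cayley {q : E3 → ℍ[ℝ]} {Ω : Set E3} (hq : IsUnitMap q Ω) {q₀ : ℍ[ℝ]} (h0 : ‖q₀‖ = 1)
    (hc : ∀ y ∈ Ω, (1 - imLift y) * (star q₀ * q y) = 1 + imLift y) {y : E3} (hy : y ∈ Ω)
    (v : E3) : mc q y v = (2 / cayN y ^ 2) • ((1 - imLift y) * imLift v * (1 + imLift y)) := by
  set N := cayN y with hN
  have hN0 : N ≠ 0 := (cayN_pos y).ne'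
  set Y := imLift y with hY
  set Q := star q₀ * q y with hQ
  have hplus : (1 + Y) * (1 - Y) = ((N : ℝ) : ℍ[ℝ]) := one_add_mul_one_sub y
  have hminus : (1 - Y) * (1 + Y) = ((N : ℝ) : ℍ[ℝ]) := one_sub_mul_one_add y
  have hsY : star Y = -Y := star_of_re_eq_zero (imLift_re y)
  -- the derivative of the Cayley relation
  have h1 : HasFDerivAt (fun z => (1 - imLift z) * (star q₀ * q z)) _ y :=
    ((hasFDerivAt_imLift y).const_sub 1).mul'
      ((hq.differentiableAt hy).hasFDerivAt.const_mul (star q₀))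
  have h2 : HasFDerivAt (fun z => 1 + imLift z) _ y := (hasFDerivAt_imLift y).const_add 1
  have h3 : (fun z => (1 - imLift z) * (star q₀ * q z)) =ᶠ[nhds y] fun z => 1 + imLift z := by
    filter_upwards [hq.isOpen.mem_nhds hy] with z hz
    exact hc z hz
  have h4 := h3.fderiv_eq (𝕜 := ℝ)
  rw [h1.fderiv, h2.fderiv] at h4
  have h5 : (1 - Y) * (star q₀ * fderiv ℝ q y v) - imLift v * Q = imLift v := by
    have := congrArg (fun L : E3 →L[ℝ] ℍ[ℝ] => L v) h4
    simpa [imLiftCLM, ← sub_eq_add_neg] using this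
  have hNQ : (N : ℝ) • Q = (1 + Y) * (1 + Y) := by
    rw [← Quaternion.coe_mul_eq_smul, ← hplus, mul_assoc, hc y hy]
  have hNQ' : (N : ℝ) • star Q = (1 - Y) * (1 - Y) := by
    have := congrArg star hNQ
    simpa [hsY, ← sub_eq_add_neg] using this
  have hY2 : (N : ℝ) • (1 : ℍ[ℝ]) = 1 - Y * Y := by
    rw [← Quaternion.coe_mul_eq_smul, mul_one, ← hplus]; noncomm_ring
  have hN1Q : (N : ℝ) • (1 + Q) = (2 : ℝ) • (1 + Y) := by
    rw [smul_add, hNQ, hY2, two_smul]; noncomm_ring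
  have hmc : mc q y v = star Q * (star q₀ * fderiv ℝ q y v) := by
    rw [mc_apply, hQ, star_mul, star_star, mul_assoc, ← mul_assoc q₀, self_mul_star_of_norm h0,
      one_mul]
  have h6 : (N : ℝ) • (star q₀ * fderiv ℝ q y v) = (1 + Y) * (imLift v * (1 + Q)) := by
    rw [← Quaternion.coe_mul_eq_smul, ← hplus, mul_assoc, sub_eq_iff_eq_add.1 h5]
    noncomm_ring
  have h7 : (N ^ 3 : ℝ) • mc q y v = (N ^ 3 : ℝ) •
      (2 / N ^ 2) • ((1 - Y) * imLift v * (1 + Y)) := by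
    calc (N ^ 3 : ℝ) • mc q y v
        = ((N : ℝ) • star Q) * ((N : ℝ) • (N : ℝ) • (star q₀ * fderiv ℝ q y v)) := by
          rw [hmc]
          simp only [smul_mul_assoc, mul_smul_comm, smul_smul]
          congr 1
          ring
      _ = (1 - Y) * (1 - Y) * ((1 + Y) * (imLift v * ((N : ℝ) • (1 + Q)))) := by
          rw [hNQ', h6]
          simp only [mul_smul_comm]
      _ = (1 - Y) * ((1 - Y) * (1 + Y)) * (imLift v * ((2 : ℝ) • (1 + Y))) := by
          rw [hN1Q]; noncomm_ring
      _ = _ := by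
          rw [hminus, Quaternion.mul_coe_eq_smul, smul_mul_assoc, mul_smul_comm, mul_smul_comm,
            smul_smul, smul_smul, ← mul_assoc]
          congr 1
          field_simp
  exact smul_right_injective _ (pow_ne_zero 3 hN0) h7

/-- The components `(1 + y) p⁻¹ ∂ᵢp (1 - y)` of the differential of `p`, in the rotated frame
which is adapted to the Cayley transform. -/
noncomputable def twist (p : E3 → ℍ[ℝ]) (i : Fin 3) (y : E3) : ℍ[ℝ] :=
  (1 + imLift y) * mc p y (stdE i) * (1 - imLift y)

theorem star_one_add (y : E3) : star (1 + imLift y) = 1 - imLift y := by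
  rw [star_add, star_one, star_of_re_eq_zero (imLift_re y), sub_eq_add_neg]

theorem star_one_sub (y : E3) : star (1 - imLift y) = 1 + imLift y := by
  rw [← star_one_add, star_star]

section Twist

variable {p q : E3 → ℍ[ℝ]} {Ω : Set E3} {q₀ : ℍ[ℝ]} {y : E3}

theorem twist_re (hp : IsUnitMap p Ω) (hy : y ∈ Ω) (i : Fin 3) : (twist p i y).re = 0 := by
  have h : star (twist p i y) = -twist p i y := by
    rw [twist, star_mul, star_mul, star_one_add, star_one_sub,
      star_of_re_eq_zero (hp.mc_re hy _), neg_mul, mul_neg, mul_assoc]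
  have h' := congrArg (fun a : ℍ[ℝ] => a.re) h
  simp only [Quaternion.re_star, Quaternion.re_neg] at h'
  linarith

theorem mc_eq_twist (p : E3 → ℍ[ℝ]) (i : Fin 3) (y : E3) :
    (cayN y ^ 2) • mc p y (stdE i) = (1 - imLift y) * twist p i y * (1 + imLift y) := by
  have h1 := one_sub_mul_one_add y
  calc (cayN y ^ 2) • mc p y (stdE i)
      = ((1 - imLift y) * (1 + imLift y)) * mc p y (stdE i)
        * ((1 - imLift y) * (1 + imLift y)) := by
        rw [h1, Quaternion.mul_coe_eq_smul, Quaternion.coe_mul_eq_smul, smul_smul, pow_two]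
    _ = _ := by rw [twist]; noncomm_ring

theorem twist_cross (i j : Fin 3) (y : E3) :
    (cayN y) • ((1 + imLift y) * cross (mc p y (stdE i)) (mc p y (stdE j)) * (1 - imLift y)) =
      cross (twist p i y) (twist p j y) := by
  have h1 := one_sub_mul_one_add y
  have h : ∀ a b : ℍ[ℝ], (cayN y) • ((1 + imLift y) * (a * b) * (1 - imLift y)) =
      ((1 + imLift y) * a * (1 - imLift y)) * ((1 + imLift y) * b * (1 - imLift y)) := by
    intro a b
    calc (cayN y) • ((1 + imLift y) * (a * b) * (1 - imLift y))
        = (1 + imLift y) * a * ((cayN y) • (b * (1 - imLift y))) := by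
          rw [mul_smul_comm]; noncomm_ring
      _ = _ := by rw [← Quaternion.coe_mul_eq_smul, ← h1]; noncomm_ring
  rw [cross, cross, twist, twist, ← h, ← h, mul_smul_comm, smul_mul_assoc, smul_comm (cayN y),
    ← smul_sub (cayN y), ← sub_mul, ← mul_sub]

/-- Conjugation by `1 - y` is a similarity of the imaginary quaternions; it preserves the cross product
up to scale. -/
theorem cross_conj (a b : ℍ[ℝ]) (y : E3) :
    cross ((1 - imLift y) * a * (1 + imLift y)) ((1 - imLift y) * b * (1 + imLift y)) =
      (cayN y) • ((1 - imLift y) * cross a b * (1 + imLift y)) := by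
  have h1 := one_add_mul_one_sub y
  have h : ∀ a b : ℍ[ℝ], (cayN y) • ((1 - imLift y) * (a * b) * (1 + imLift y)) =
      ((1 - imLift y) * a * (1 + imLift y)) * ((1 - imLift y) * b * (1 + imLift y)) := by
    intro a b
    calc (cayN y) • ((1 - imLift y) * (a * b) * (1 + imLift y))
        = (1 - imLift y) * a * ((cayN y) • (b * (1 + imLift y))) := by
          rw [mul_smul_comm]; noncomm_ring
      _ = _ := by rw [← Quaternion.coe_mul_eq_smul, ← h1]; noncomm_ring
  rw [cross, cross, ← h, ← h, mul_smul_comm, smul_mul_assoc, smul_comm (cayN y),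
    ← smul_sub (cayN y), ← sub_mul, ← mul_sub]

theorem cross_imUnit : cross (imUnit 0) (imUnit 1) = imUnit 2 ∧
    cross (imUnit 1) (imUnit 2) = imUnit 0 ∧ cross (imUnit 2) (imUnit 0) = imUnit 1 := by
  refine ⟨?_, ?_, ?_⟩ <;> ext <;> simp [imUnit, stdE]

variable (h : IsLagrangianPatch p q Ω) (h0 : ‖q₀‖ = 1)
  (hc : ∀ y ∈ Ω, (1 - imLift y) * (star q₀ * q y) = 1 + imLift y) (hy : y ∈ Ω)
include h h0 hc hy

theorem inner_mc_cayley (v : E3) (a : ℍ[ℝ]) : inner ℝ (mc q y v) a =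
    2 / cayN y ^ 2 * inner ℝ (imLift v) ((1 + imLift y) * a * (1 - imLift y)) := by
  rw [mc_cayley h.snd h0 hc hy, inner_smul_left, inner_mul_mul, star_one_sub, star_one_add]
  simp

/-- The twisted components form a symmetric matrix. -/
theorem twist_symm (i j : Fin 3) :
    inner ℝ (imUnit i) (twist p j y) = inner ℝ (imUnit j) (twist p i y) := by
  have h1 := h.symm y hy (stdE i) (stdE j)
  rw [inner_mc_cayley h h0 hc hy, inner_mc_cayley h h0 hc hy] at h1
  have h2 : (2 / cayN y ^ 2) ≠ 0 := by have := cayN_pos y; positivity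
  exact mul_left_cancel₀ h2 h1

/-- The cubic condition expresses the trace of the twisted matrix by quadratic terms. -/
theorem twist_trace : 2 * (inner ℝ (imUnit 0) (twist p 0 y) + inner ℝ (imUnit 1) (twist p 1 y)
      + inner ℝ (imUnit 2) (twist p 2 y)) =
    inner ℝ (imUnit 0) (cross (twist p 1 y) (twist p 2 y))
      + inner ℝ (imUnit 1) (cross (twist p 2 y) (twist p 0 y))
      + inner ℝ (imUnit 2) (cross (twist p 0 y) (twist p 1 y)) := by
  have hN := cayN_pos y
  have h1 := (h.isLagrangianPair hy).cubic (stdE 0) (stdE 1) (stdE 2)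
  have hl : ∀ i j k : Fin 3, inner ℝ (mc q y (stdE i))
      (cross (mc p y (stdE j)) (mc p y (stdE k))) =
      2 / cayN y ^ 3 * inner ℝ (imUnit i) (cross (twist p j y) (twist p k y)) := by
    intro i j k
    rw [inner_mc_cayley h h0 hc hy, ← twist_cross, inner_smul_right, imUnit]
    field_simp
  have hr : ∀ i j k : Fin 3, cross (imUnit j) (imUnit k) = imUnit i →
      inner ℝ (mc p y (stdE i)) (cross (mc q y (stdE j)) (mc q y (stdE k))) =
      4 / cayN y ^ 3 * inner ℝ (imUnit i) (twist p i y) := by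
    intro i j k hijk
    rw [mc_cayley h.snd h0 hc hy, mc_cayley h.snd h0 hc hy, cross_smul_left, cross_smul_right,
      cross_conj]
    change inner ℝ _ ((2 / cayN y ^ 2) • (2 / cayN y ^ 2) • cayN y •
      ((1 - imLift y) * cross (imUnit j) (imUnit k) * (1 + imLift y))) = _
    rw [hijk, inner_smul_right, inner_smul_right, inner_smul_right, real_inner_comm, inner_mul_mul,
      star_one_sub, star_one_add, twist]
    field_simp
    ring
  obtain ⟨c1, c2, c3⟩ := cross_imUnit
  rw [hl, hl, hl, hr 0 1 2 c2, hr 1 2 0 c3, hr 2 0 1 c1] at h1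
  field_simp at h1
  linarith

end Twist

end Cayley

section CayleyEstimate

open Metric

theorem norm_one_sub_sq (y : E3) : ‖1 - imLift y‖ ^ 2 = cayN y := by
  rw [cayN, norm_sq_eq, norm_sq_eq]
  simp
  ring

theorem norm_one_add_eq (y : E3) : ‖1 + imLift y‖ = ‖1 - imLift y‖ := by
  rw [← star_one_sub, Quaternion.norm_star]

theorem norm_mc_le_twist (p : E3 → ℍ[ℝ]) (i : Fin 3) (y : E3) :
    ‖mc p y (stdE i)‖ ≤ ‖twist p i y‖ := by
  have h1 : 1 ≤ cayN y := by unfold cayN; nlinarith [sq_nonneg ‖imLift y‖]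
  have h := congrArg norm (mc_eq_twist p i y)
  rw [norm_smul, norm_mul, norm_mul, norm_one_add_eq, Real.norm_of_nonneg (by positivity)] at h
  have h2 : cayN y ^ 2 * ‖mc p y (stdE i)‖ = cayN y * ‖twist p i y‖ := by
    rw [h, ← norm_one_sub_sq]; ring
  nlinarith [norm_nonneg (mc p y (stdE i)), norm_nonneg (twist p i y),
    mul_nonneg (sub_nonneg.2 h1) (norm_nonneg (mc p y (stdE i)))]

theorem norm_imUnit (i : Fin 3) : ‖imUnit i‖ = 1 := by
  have h : ‖imUnit i‖ ^ 2 = 1 ^ 2 := by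
    rw [norm_sq_eq]
    fin_cases i <;> simp [imUnit, stdE]
  exact (sq_eq_sq₀ (norm_nonneg _) zero_le_one).1 h

theorem norm_cross_le (a b : ℍ[ℝ]) : ‖cross a b‖ ≤ ‖a‖ * ‖b‖ := by
  rw [cross, norm_smul]
  have := norm_sub_le (a * b) (b * a)
  rw [norm_mul, norm_mul] at this
  rw [Real.norm_of_nonneg (by norm_num)]
  linarith

theorem norm_le_sum_coord (a : ℍ[ℝ]) : ‖a‖ ≤ |a.re| + |a.imI| + |a.imJ| + |a.imK| := by
  have h : ‖a‖ ^ 2 ≤ (|a.re| + |a.imI| + |a.imJ| + |a.imK|) ^ 2 := by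
    rw [norm_sq_eq, ← sq_abs a.re, ← sq_abs a.imI, ← sq_abs a.imJ, ← sq_abs a.imK]
    have h1 := abs_nonneg a.re
    have h2 := abs_nonneg a.imI
    have h3 := abs_nonneg a.imJ
    have h4 := abs_nonneg a.imK
    nlinarith [mul_nonneg h1 h2, mul_nonneg h1 h3, mul_nonneg h1 h4, mul_nonneg h2 h3,
      mul_nonneg h2 h4, mul_nonneg h3 h4]
  exact (sq_le_sq₀ (norm_nonneg _) (by positivity)).1 h

theorem abs_inner_imUnit_le (i : Fin 3) (a : ℍ[ℝ]) : |inner ℝ (imUnit i) a| ≤ ‖a‖ := by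
  have := abs_real_inner_le_norm (imUnit i) a
  rwa [norm_imUnit, one_mul] at this

theorem inner_imUnit_zero (a : ℍ[ℝ]) : inner ℝ (imUnit 0) a = a.imI := by
  simp [inner_eq, imUnit, stdE]

theorem inner_imUnit_one (a : ℍ[ℝ]) : inner ℝ (imUnit 1) a = a.imJ := by
  simp [inner_eq, imUnit, stdE]

theorem inner_imUnit_two (a : ℍ[ℝ]) : inner ℝ (imUnit 2) a = a.imK := by
  simp [inner_eq, imUnit, stdE]

/-- For a symmetric matrix field, the Dirac operator applied to the `l`-th column is controlled by
the derivative of the trace and by the exterior derivatives of the columns. -/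
theorem norm_dirac_symm_le (D : Fin 3 → Fin 3 → ℍ[ℝ]) (hre : ∀ i l, (D i l).re = 0)
    (hs : ∀ i l m, inner ℝ (imUnit m) (D i l) = inner ℝ (imUnit l) (D i m)) (l : Fin 3) :
    ‖∑ i, imUnit i * D i l‖ ≤ |∑ i, inner ℝ (imUnit i) (D l i)|
      + 4 * ∑ i, ∑ j, ‖D i j - D j i‖ := by
  set S := ∑ i, ∑ j, ‖D i j - D j i‖ with hS
  have hle : ∀ i j, ‖D i j - D j i‖ ≤ S := fun i j =>
    (Finset.single_le_sum (f := fun j => ‖D i j - D j i‖) (fun _ _ => norm_nonneg _)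
      (Finset.mem_univ j)).trans
      (Finset.single_le_sum (f := fun i => ∑ j, ‖D i j - D j i‖)
        (fun _ _ => Finset.sum_nonneg fun _ _ => norm_nonneg _) (Finset.mem_univ i))
  have him : ∀ i j, |inner ℝ (imUnit l) (D i j - D j i)| ≤ S := fun i j =>
    (abs_inner_imUnit_le _ _).trans (hle i j)
  have e1 : (∑ i, imUnit i * D i l).imI = inner ℝ (imUnit l) (D 1 2 - D 2 1) := by
    rw [inner_sub_right, ← hs 1 l 2, ← hs 2 l 1, inner_imUnit_one, inner_imUnit_two]
    simp [Fin.sum_univ_three, imUnit, stdE, hre]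
    ring
  have e2 : (∑ i, imUnit i * D i l).imJ = inner ℝ (imUnit l) (D 2 0 - D 0 2) := by
    rw [inner_sub_right, ← hs 2 l 0, ← hs 0 l 2, inner_imUnit_zero, inner_imUnit_two]
    simp [Fin.sum_univ_three, imUnit, stdE, hre]
    ring
  have e3 : (∑ i, imUnit i * D i l).imK = inner ℝ (imUnit l) (D 0 1 - D 1 0) := by
    rw [inner_sub_right, ← hs 0 l 1, ← hs 1 l 0, inner_imUnit_one, inner_imUnit_zero]
    simp [Fin.sum_univ_three, imUnit, stdE, hre]
    ring
  have e0 : (∑ i, imUnit i * D i l).re = -(∑ i, inner ℝ (imUnit i) (D l i))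
      - ∑ i, inner ℝ (imUnit i) (D i l - D l i) := by
    rw [← sub_eq_zero]
    simp only [Fin.sum_univ_three, inner_sub_right, inner_imUnit_zero, inner_imUnit_one,
      inner_imUnit_two]
    simp [imUnit, stdE]
    ring
  have h0 : |(∑ i, imUnit i * D i l).re| ≤ |∑ i, inner ℝ (imUnit i) (D l i)| + S := by
    have h1 : |∑ i, inner ℝ (imUnit i) (D i l - D l i)| ≤ S := by
      refine (Finset.abs_sum_le_sum_abs _ _).trans (Finset.sum_le_sum fun i _ => ?_)
      exact (abs_inner_imUnit_le _ _).trans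
        (Finset.single_le_sum (f := fun j => ‖D i j - D j i‖) (fun _ _ => norm_nonneg _)
          (Finset.mem_univ l))
    rw [e0]
    have := abs_sub (-(∑ i, inner ℝ (imUnit i) (D l i)))
      (∑ i, inner ℝ (imUnit i) (D i l - D l i))
    rw [abs_neg] at this
    linarith
  have := norm_le_sum_coord (∑ i, imUnit i * D i l)
  rw [e1, e2, e3] at this
  linarith [him 1 2, him 2 0, him 0 1]

theorem contDiffOn_twist {p : E3 → ℍ[ℝ]} {Ω : Set E3} (hp : IsUnitMap p Ω) (l : Fin 3) :
    ContDiffOn ℝ ∞ (twist p l) Ω := fun _ hy =>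
  (((contDiff_const.add contDiff_imLift).contDiffAt.mul (hp.contDiffAt_mc hy _)).mul
    (contDiff_const.sub contDiff_imLift).contDiffAt).contDiffWithinAt

section

variable {p q : E3 → ℍ[ℝ]} {Ω : Set E3} {q₀ : ℍ[ℝ]} {y : E3}

theorem fderiv_twist (hp : IsUnitMap p Ω) (hy : y ∈ Ω) (l : Fin 3) (v : E3) :
    fderiv ℝ (twist p l) y v = imLift v * mc p y (stdE l) * (1 - imLift y)
      + (1 + imLift y) * fderiv ℝ (fun z => mc p z (stdE l)) y v * (1 - imLift y)
      - (1 + imLift y) * mc p y (stdE l) * imLift v := by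
  have h1 : HasFDerivAt (twist p l) _ y :=
    (((hasFDerivAt_imLift y).const_add 1).mul' (hp.differentiableAt_mc hy _).hasFDerivAt).mul'
      ((hasFDerivAt_imLift y).const_sub 1)
  rw [h1.fderiv]
  simp [imLiftCLM]
  noncomm_ring

theorem fderiv_twist_re (hp : IsUnitMap p Ω) (hy : y ∈ Ω) (l : Fin 3) (v : E3) :
    (fderiv ℝ (twist p l) y v).re = 0 := by
  have hd := (((contDiffOn_twist hp l).contDiffAt (hp.isOpen.mem_nhds hy)).differentiableAt
    (by simp)).hasFDerivAt
  have h2 : (fun z => inner ℝ (1 : ℍ[ℝ]) (twist p l z)) =ᶠ[nhds y] fun _ => (0 : ℝ) := by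
    filter_upwards [hp.isOpen.mem_nhds hy] with z hz
    simp [inner_eq, twist_re hp hz]
  have h3 := congrArg (fun L : E3 →L[ℝ] ℝ => L v) (h2.fderiv_eq (𝕜 := ℝ))
  rw [fderiv_inner_apply ℝ (differentiableAt_const _) hd.differentiableAt] at h3
  simpa [inner_eq] using h3

/-- The exterior derivatives of the columns of the twisted matrix are of order zero. -/
theorem norm_fderiv_twist_sub_le (hp : IsUnitMap p Ω) (hy : y ∈ Ω) (i j : Fin 3) {A : ℝ}
    (hA : ∀ l, ‖twist p l y‖ ≤ A) (hA' : ‖1 + imLift y‖ ≤ A) :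
    ‖fderiv ℝ (twist p j) y (stdE i) - fderiv ℝ (twist p i) y (stdE j)‖ ≤
      4 * A * (‖twist p i y‖ + ‖twist p j y‖) := by
  have hA0 : 0 ≤ A := (norm_nonneg _).trans hA'
  have hA'' : ‖1 - imLift y‖ ≤ A := by rwa [← norm_one_add_eq]
  have h1 : 1 ≤ cayN y := by unfold cayN; nlinarith [sq_nonneg ‖imLift y‖]
  have hmc := hp.fderiv_mc hy (stdE i) (stdE j)
  set a := mc p y (stdE i)
  set b := mc p y (stdE j)
  have hkey : fderiv ℝ (twist p j) y (stdE i) - fderiv ℝ (twist p i) y (stdE j) =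
      imUnit i * b * (1 - imLift y) - (1 + imLift y) * b * imUnit i
        - (imUnit j * a * (1 - imLift y) - (1 + imLift y) * a * imUnit j)
        + (1 + imLift y) * (-((2 : ℝ) • cross a b)) * (1 - imLift y) := by
    rw [fderiv_twist hp hy, fderiv_twist hp hy, ← hmc, imUnit, imUnit]
    noncomm_ring
  have hc : ‖(1 + imLift y) * (-((2 : ℝ) • cross a b)) * (1 - imLift y)‖ ≤
      2 * (‖twist p i y‖ * ‖twist p j y‖) := by
    have h3 : (1 + imLift y) * (-((2 : ℝ) • cross a b)) * (1 - imLift y) =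
        -((2 : ℝ) • ((1 + imLift y) * cross a b * (1 - imLift y))) := by
      simp only [mul_neg, neg_mul, mul_smul_comm, smul_mul_assoc]
    have h4 := congrArg norm (twist_cross (p := p) i j y)
    rw [norm_smul, Real.norm_of_nonneg (cayN_pos y).le] at h4
    have h5 := norm_cross_le (twist p i y) (twist p j y)
    rw [h3, norm_neg, norm_smul, Real.norm_of_nonneg zero_le_two]
    have h6 := norm_nonneg ((1 + imLift y) * cross a b * (1 - imLift y))
    change cayN y * ‖(1 + imLift y) * cross a b * (1 - imLift y)‖ = _ at h4
    nlinarith [mul_nonneg (sub_nonneg.2 h1) h6]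
  have ht : ∀ (k : Fin 3) (c c' : ℍ[ℝ]), ‖c‖ ≤ ‖c'‖ →
      ‖imUnit k * c * (1 - imLift y)‖ ≤ A * ‖c'‖ ∧ ‖(1 + imLift y) * c * imUnit k‖ ≤ A * ‖c'‖ := by
    intro k c c' hc
    rw [norm_mul, norm_mul, norm_mul, norm_mul, norm_imUnit, one_mul, mul_one, mul_comm]
    exact ⟨mul_le_mul hA'' hc (norm_nonneg _) hA0, mul_le_mul hA' hc (norm_nonneg _) hA0⟩
  have hb := ht i b (twist p j y) (norm_mc_le_twist p j y)
  have ha := ht j a (twist p i y) (norm_mc_le_twist p i y)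
  have hab : ‖twist p i y‖ * ‖twist p j y‖ ≤ A * ‖twist p j y‖ :=
    mul_le_mul_of_nonneg_right (hA i) (norm_nonneg _)
  have hab' : ‖twist p i y‖ * ‖twist p j y‖ ≤ A * ‖twist p i y‖ := by
    rw [mul_comm]; exact mul_le_mul_of_nonneg_right (hA j) (norm_nonneg _)
  rw [hkey]
  have n1 := norm_add_le (imUnit i * b * (1 - imLift y) - (1 + imLift y) * b * imUnit i
        - (imUnit j * a * (1 - imLift y) - (1 + imLift y) * a * imUnit j))
        ((1 + imLift y) * (-((2 : ℝ) • cross a b)) * (1 - imLift y))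
  have n2 := norm_sub_le (imUnit i * b * (1 - imLift y) - (1 + imLift y) * b * imUnit i)
        (imUnit j * a * (1 - imLift y) - (1 + imLift y) * a * imUnit j)
  have n3 := norm_sub_le (imUnit i * b * (1 - imLift y)) ((1 + imLift y) * b * imUnit i)
  have n4 := norm_sub_le (imUnit j * a * (1 - imLift y)) ((1 + imLift y) * a * imUnit j)
  nlinarith [mul_nonneg hA0 (norm_nonneg (twist p i y)), mul_nonneg hA0 (norm_nonneg (twist p j y))]

variable (h : IsLagrangianPatch p q Ω) (h0 : ‖q₀‖ = 1)
  (hc : ∀ y ∈ Ω, (1 - imLift y) * (star q₀ * q y) = 1 + imLift y) (hy : y ∈ Ω)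
include h h0 hc hy

/-- The Dirac operator applied to the twisted columns is bounded by the columns themselves. -/
theorem norm_dirac_twist_le {A : ℝ} (hA : ∀ l, ‖twist p l y‖ ≤ A) (hA' : ‖1 + imLift y‖ ≤ A)
    (hA'' : ∀ i l, ‖fderiv ℝ (twist p l) y (stdE i)‖ ≤ A) (l : Fin 3) :
    ‖dirac (twist p l) y‖ ≤ 100 * A * ∑ m, ‖twist p m y‖ := by
  have hA0 : 0 ≤ A := (norm_nonneg _).trans hA'
  have hd : ∀ l, DifferentiableAt ℝ (twist p l) y := fun l =>
    ((contDiffOn_twist h.fst l).contDiffAt (h.fst.isOpen.mem_nhds hy)).differentiableAt (by simp)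
  have hmem := h.fst.isOpen.mem_nhds hy
  have hsymm : ∀ i l m, inner ℝ (imUnit m) (fderiv ℝ (twist p l) y (stdE i)) =
      inner ℝ (imUnit l) (fderiv ℝ (twist p m) y (stdE i)) := by
    intro i l m
    have h2 : (fun z => (inner ℝ (imUnit m) (twist p l z) : ℝ)) =ᶠ[nhds y]
        fun z => inner ℝ (imUnit l) (twist p m z) := by
      filter_upwards [hmem] with z hz
      exact twist_symm h h0 hc hz m l
    have h3 := congrArg (fun L : E3 →L[ℝ] ℝ => L (stdE i)) (h2.fderiv_eq (𝕜 := ℝ))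
    rw [fderiv_inner_apply ℝ (differentiableAt_const _) (hd _),
      fderiv_inner_apply ℝ (differentiableAt_const _) (hd _)] at h3
    simpa using h3
  have hdi : ∀ i l, fderiv ℝ (fun z => (inner ℝ (imUnit i) (twist p i z) : ℝ)) y (stdE l) =
      inner ℝ (imUnit i) (fderiv ℝ (twist p i) y (stdE l)) := by
    intro i l
    rw [fderiv_inner_apply ℝ (differentiableAt_const _) (hd _)]
    simp
  have hcr := fun i j => fderiv_cross (hd i) (hd j)
  have hci : ∀ k i j v, fderiv ℝ
      (fun z => (inner ℝ (imUnit k) (cross (twist p i z) (twist p j z)) : ℝ)) y v =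
      inner ℝ (imUnit k) (cross (fderiv ℝ (twist p i) y v) (twist p j y)
      + cross (twist p i y) (fderiv ℝ (twist p j) y v)) := by
    intro k i j v
    rw [fderiv_inner_apply ℝ (differentiableAt_const _) (hcr i j).1, (hcr i j).2]
    simp
  have hcb : ∀ k i j l, |(inner ℝ (imUnit k) (cross (fderiv ℝ (twist p i) y (stdE l)) (twist p j y)
      + cross (twist p i y) (fderiv ℝ (twist p j) y (stdE l))) : ℝ)| ≤
      A * (‖twist p i y‖ + ‖twist p j y‖) := by
    intro k i j l
    refine (abs_inner_imUnit_le _ _).trans ((norm_add_le _ _).trans ?_)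
    have n1 := norm_cross_le (fderiv ℝ (twist p i) y (stdE l)) (twist p j y)
    have n2 := norm_cross_le (twist p i y) (fderiv ℝ (twist p j) y (stdE l))
    have n3 := mul_le_mul_of_nonneg_right (hA'' l i) (norm_nonneg (twist p j y))
    have n4 := mul_le_mul_of_nonneg_left (hA'' l j) (norm_nonneg (twist p i y))
    linarith
  have hdin : ∀ i, DifferentiableAt ℝ (fun z => (inner ℝ (imUnit i) (twist p i z) : ℝ)) y :=
    fun i => (differentiableAt_const _).inner ℝ (hd i)
  have hdcn : ∀ k i j, DifferentiableAt ℝ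
      (fun z => (inner ℝ (imUnit k) (cross (twist p i z) (twist p j z)) : ℝ)) y :=
    fun k i j => (differentiableAt_const _).inner ℝ (hcr i j).1
  -- the derivative of the trace
  have htr : |∑ i, inner ℝ (imUnit i) (fderiv ℝ (twist p i) y (stdE l))| ≤
      A * ∑ m, ‖twist p m y‖ := by
    have h2 : (fun z => (2 : ℝ) * ((inner ℝ (imUnit 0) (twist p 0 z) : ℝ)
        + inner ℝ (imUnit 1) (twist p 1 z) + inner ℝ (imUnit 2) (twist p 2 z))) =ᶠ[nhds y]
        fun z => (inner ℝ (imUnit 0) (cross (twist p 1 z) (twist p 2 z)) : ℝ)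
      + inner ℝ (imUnit 1) (cross (twist p 2 z) (twist p 0 z))
      + inner ℝ (imUnit 2) (cross (twist p 0 z) (twist p 1 z)) := by
      filter_upwards [hmem] with z hz
      exact twist_trace h h0 hc hz
    have h3 := congrArg (fun L : E3 →L[ℝ] ℝ => L (stdE l)) (h2.fderiv_eq (𝕜 := ℝ))
    rw [(((hdin 0).hasFDerivAt.fun_add (hdin 1).hasFDerivAt).fun_add
        (hdin 2).hasFDerivAt |>.const_mul (2 : ℝ)).fderiv,
      (((hdcn 0 1 2).hasFDerivAt.fun_add (hdcn 1 2 0).hasFDerivAt).fun_add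
        (hdcn 2 0 1).hasFDerivAt).fderiv] at h3
    simp only [smul_apply, add_apply, hdi, hci, smul_eq_mul] at h3
    have b1 := abs_le.1 (hcb 0 1 2 l)
    have b2 := abs_le.1 (hcb 1 2 0 l)
    have b3 := abs_le.1 (hcb 2 0 1 l)
    rw [Fin.sum_univ_three, Fin.sum_univ_three, abs_le]
    constructor <;> linarith
  have hE : ∑ i, ∑ j, ‖fderiv ℝ (twist p j) y (stdE i) - fderiv ℝ (twist p i) y (stdE j)‖ ≤
      24 * A * ∑ m, ‖twist p m y‖ := by
    refine (Finset.sum_le_sum fun i _ => Finset.sum_le_sum fun j _ =>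
      norm_fderiv_twist_sub_le h.fst hy i j hA hA').trans (le_of_eq ?_)
    simp only [Fin.sum_univ_three]
    ring
  -- `1 + 4 * 24 ≤ 100`
  have := norm_dirac_symm_le (fun i l => fderiv ℝ (twist p l) y (stdE i))
    (fun i l => fderiv_twist_re h.fst hy l _) hsymm l
  rw [dirac]
  have hs : 0 ≤ A * ∑ m, ‖twist p m y‖ := by positivity
  linarith

end

theorem IsUnitMap.mono {V : Type*} [NormedAddCommGroup V] [NormedSpace ℝ V] {p : V → ℍ[ℝ]}
    {Ω Ω' : Set V} (h : IsUnitMap p Ω) (hs : Ω' ⊆ Ω) (ho : IsOpen Ω') : IsUnitMap p Ω' :=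
  ⟨ho, h.smooth.mono hs, fun y hy => h.norm_eq y (hs hy)⟩

/-- On a compact set, the twisted components have a common bound together with their first
derivatives. -/
theorem exists_twist_bound {p : E3 → ℍ[ℝ]} {Ω K : Set E3}
    (hsm : ∀ l, ContDiffOn ℝ ∞ (twist p l) Ω) (ho : IsOpen Ω) (hK : IsCompact K) (hs : K ⊆ Ω) :
    ∃ A : ℝ, ∀ y ∈ K, (∀ l, ‖twist p l y‖ ≤ A) ∧ ‖1 + imLift y‖ ≤ A ∧
      ∀ i l, ‖fderiv ℝ (twist p l) y (stdE i)‖ ≤ A := by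
  have e1 : ∀ l, ∃ A : ℝ, ∀ y ∈ K, ‖twist p l y‖ ≤ A := fun l =>
    hK.exists_bound_of_continuousOn ((hsm l).continuousOn.mono hs)
  have e2 : ∃ A : ℝ, ∀ y ∈ K, ‖1 + imLift y‖ ≤ A :=
    hK.exists_bound_of_continuousOn (contDiff_const.add contDiff_imLift).continuous.continuousOn
  have e3 : ∀ l, ∃ A : ℝ, ∀ y ∈ K, ‖fderiv ℝ (twist p l) y‖ ≤ A := fun l =>
    hK.exists_bound_of_continuousOn
      (((hsm l).continuousOn_fderiv_of_isOpen ho (by simp)).mono hs)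
  choose a ha using e1
  obtain ⟨b, hb⟩ := e2
  choose c hc using e3
  have hle : ∀ (t : Fin 3 → ℝ) (l : Fin 3), t l ≤ ∑ m, |t m| := fun t l =>
    (le_abs_self _).trans (Finset.single_le_sum (f := fun m => |t m|) (fun _ _ => abs_nonneg _)
      (Finset.mem_univ l))
  have pa : 0 ≤ ∑ m, |a m| := Finset.sum_nonneg fun _ _ => abs_nonneg _
  have pc : 0 ≤ ∑ m, |c m| := Finset.sum_nonneg fun _ _ => abs_nonneg _
  have pb := abs_nonneg b
  have pb' := le_abs_self b
  refine ⟨(∑ m, |a m|) + |b| + ∑ m, |c m|, fun y hy => ⟨fun l => ?_, ?_, fun i l => ?_⟩⟩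
  · linarith [ha l y hy, hle a l]
  · linarith [hb y hy]
  · have h1 := (fderiv ℝ (twist p l) y).le_opNorm (stdE i)
    have h2 : ‖stdE i‖ = 1 := by simp [stdE]
    rw [h2, mul_one] at h1
    linarith [hc l y hy, hle c l]

/-- Unique continuation for Lagrangian immersions in Cayley coordinates of the second factor: if
`dp` vanishes near a point, it vanishes on a ball of definite size. -/
theorem mc_eq_zero_of_eventually {p q : E3 → ℍ[ℝ]} {q₀ : ℍ[ℝ]} {R : ℝ}
    (h : IsLagrangianPatch p q (ball 0 R)) (h0 : ‖q₀‖ = 1)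
    (hc : ∀ y ∈ ball (0 : E3) R, (1 - imLift y) * (star q₀ * q y) = 1 + imLift y) {y₁ : E3}
    (hy₁ : y₁ ∈ ball (0 : E3) (R / 4)) (hz : ∀ᶠ y in nhds y₁, mc p y = 0) :
    ∀ y ∈ ball y₁ (R / 2), mc p y = 0 := by
  have hsub : ∀ y ∈ ball y₁ (R / 2), y ∈ ball (0 : E3) (3 * R / 4) := by
    intro y hy
    rw [mem_ball, dist_eq_norm] at hy
    rw [mem_ball_zero_iff] at hy₁ ⊢
    have := norm_add_le (y - y₁) y₁
    rw [sub_add_cancel] at this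
    linarith
  have hR : 0 < R := by
    rw [mem_ball_zero_iff] at hy₁
    linarith [norm_nonneg y₁]
  have hcb : closedBall (0 : E3) (3 * R / 4) ⊆ ball 0 R := closedBall_subset_ball (by linarith)
  have hsm := fun l => contDiffOn_twist h.fst l
  obtain ⟨A, hA⟩ := exists_twist_bound hsm isOpen_ball (isCompact_closedBall _ _) hcb
  have htr : ∀ x ∈ ball (0 : E3) (R / 2), y₁ + x ∈ ball (0 : E3) (3 * R / 4) := by
    intro x hx
    refine hsub _ ?_
    rw [mem_ball, dist_eq_norm, add_sub_cancel_left]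
    simpa using hx
  have htr' : ∀ x ∈ ball (0 : E3) (R / 2), y₁ + x ∈ ball (0 : E3) R := fun x hx =>
    hcb (ball_subset_closedBall (htr x hx))
  have hfd : ∀ l x, dirac (fun x => twist p l (y₁ + x)) x = dirac (twist p l) (y₁ + x) := by
    intro l x
    simp only [dirac, fderiv_comp_add_left]
  have key := unique_continuation (u := fun l x => twist p l (y₁ + x)) (R := R / 2)
    (K := 100 * A) (fun l => ?_) (fun l x hx => ?_) (fun l => ?_)
  · intro y hy
    have hb : ∀ l, mc p y (stdE l) = 0 := by
      intro l
      have h1 := key l (y - y₁) (by simpa [dist_eq_norm] using hy)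
      simp only [add_sub_cancel] at h1
      have h2 := norm_mc_le_twist p l y
      rw [h1, norm_zero] at h2
      exact norm_le_zero_iff.1 h2
    refine LinearMap.ext fun v => ?_
    have hv : v = ∑ j, v j • stdE j := by
      ext i
      fin_cases i <;> simp [Fin.sum_univ_three, stdE]
    rw [hv, map_sum]
    simp [hb]
  · exact (hsm l).comp (contDiff_const.add contDiff_id).contDiffOn htr'
  · rw [hfd]
    obtain ⟨a1, a2, a3⟩ := hA _ (ball_subset_closedBall (htr x hx))
    exact norm_dirac_twist_le h h0 hc (htr' x hx) a1 a2 a3 l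
  · have ht : Filter.Tendsto (fun x : E3 => y₁ + x) (nhds 0) (nhds y₁) :=
      (continuous_const.add continuous_id).tendsto' 0 y₁ (by simp)
    filter_upwards [ht.eventually hz] with x hx
    simp [twist, hx]

end CayleyEstimate

/-! ### Local coordinates -/

section LocalInverse

variable {V V' : Type*} [NormedAddCommGroup V] [NormedSpace ℝ V] [CompleteSpace V]
  [NormedAddCommGroup V'] [NormedSpace ℝ V']

/-- The inverse function theorem for a smooth map on an open set: the local inverse is smooth on
its whole domain. -/
theorem exists_smooth_local_inverse {Y : V → V'} {Ω : Set V} (ho : IsOpen Ω)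
    (hY : ContDiffOn ℝ ∞ Y Ω) {y₀ : V} (hy₀ : y₀ ∈ Ω) (L : V ≃L[ℝ] V')
    (hL : fderiv ℝ Y y₀ = (L : V →L[ℝ] V')) :
    ∃ Θ : OpenPartialHomeomorph V V', y₀ ∈ Θ.source ∧ Θ.source ⊆ Ω ∧ ⇑Θ = Y ∧
      ContDiffOn ℝ ∞ Θ.symm Θ.target ∧
      ∀ y ∈ Θ.source, ∃ L : V ≃L[ℝ] V', HasFDerivAt Y (L : V →L[ℝ] V') y := by
  have hc : ∀ y ∈ Ω, ContDiffAt ℝ ∞ Y y := fun y hy => hY.contDiffAt (ho.mem_nhds hy)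
  have hd : HasFDerivAt Y (L : V →L[ℝ] V') y₀ := by
    rw [← hL]
    exact ((hc y₀ hy₀).differentiableAt (by simp)).hasFDerivAt
  let Θ₀ := (hc y₀ hy₀).toOpenPartialHomeomorph Y hd (by simp)
  have hopen : IsOpen (Ω ∩ fderiv ℝ Y ⁻¹' Set.range ((↑) : (V ≃L[ℝ] V') → V →L[ℝ] V')) :=
    (hY.continuousOn_fderiv_of_isOpen ho (by simp)).isOpen_inter_preimage ho
      ContinuousLinearEquiv.isOpen
  refine ⟨Θ₀.restrOpen _ hopen, ?_, ?_, rfl, ?_, ?_⟩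
  · exact ⟨(hc y₀ hy₀).mem_toOpenPartialHomeomorph_source hd (by simp), hy₀, L, hL.symm⟩
  · exact fun y hy => hy.2.1
  · intro z hz
    have hs := (Θ₀.restrOpen _ hopen).map_target hz
    obtain ⟨L', hL'⟩ := hs.2.2
    refine (OpenPartialHomeomorph.contDiffAt_symm _ (f₀' := L') hz ?_ ?_).contDiffWithinAt
    · rw [hL']
      exact ((hc _ hs.2.1).differentiableAt (by simp)).hasFDerivAt
    · exact hc _ hs.2.1
  · intro y hy
    obtain ⟨L', hL'⟩ := hy.2.2
    refine ⟨L', ?_⟩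
    rw [hL']
    exact ((hc _ hy.2.1).differentiableAt (by simp)).hasFDerivAt

end LocalInverse

section Reparametrisation

variable {V V' : Type*} [NormedAddCommGroup V] [NormedSpace ℝ V]
  [NormedAddCommGroup V'] [NormedSpace ℝ V']

theorem mc_comp {p : V → ℍ[ℝ]} {θ : V' → V} {z : V'} (hp : DifferentiableAt ℝ p (θ z))
    (hθ : DifferentiableAt ℝ θ z) (v : V') : mc (p ∘ θ) z v = mc p (θ z) (fderiv ℝ θ z v) := by
  rw [mc_apply, mc_apply, fderiv_comp z hp hθ]
  rfl

theorem IsUnitMap.comp {p : V → ℍ[ℝ]} {Ω : Set V} (h : IsUnitMap p Ω) {θ : V' → V} {Ω' : Set V'}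
    (ho : IsOpen Ω') (hθ : ContDiffOn ℝ ∞ θ Ω') (hm : Set.MapsTo θ Ω' Ω) :
    IsUnitMap (p ∘ θ) Ω' :=
  ⟨ho, h.smooth.comp hθ hm, fun _ hz => h.norm_eq _ (hm hz)⟩

theorem IsLagrangianPatch.comp {p q : V → ℍ[ℝ]} {Ω : Set V} (h : IsLagrangianPatch p q Ω)
    {θ : V' → V} {Ω' : Set V'} (ho : IsOpen Ω') (hθ : ContDiffOn ℝ ∞ θ Ω')
    (hm : Set.MapsTo θ Ω' Ω) (hi : ∀ z ∈ Ω', ∀ v, fderiv ℝ θ z v = 0 → v = 0) :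
    IsLagrangianPatch (p ∘ θ) (q ∘ θ) Ω' := by
  have hd : ∀ z ∈ Ω', DifferentiableAt ℝ θ z := fun z hz =>
    (hθ.contDiffAt (ho.mem_nhds hz)).differentiableAt (by simp)
  have hp : ∀ z ∈ Ω', ∀ v, mc (p ∘ θ) z v = mc p (θ z) (fderiv ℝ θ z v) := fun z hz v =>
    mc_comp (h.fst.differentiableAt (hm hz)) (hd z hz) v
  have hq : ∀ z ∈ Ω', ∀ v, mc (q ∘ θ) z v = mc q (θ z) (fderiv ℝ θ z v) := fun z hz v =>
    mc_comp (h.snd.differentiableAt (hm hz)) (hd z hz) v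
  refine ⟨h.fst.comp ho hθ hm, h.snd.comp ho hθ hm, ?_, ?_⟩
  · intro z hz v h1 h2
    rw [hp z hz] at h1
    rw [hq z hz] at h2
    exact hi z hz v (h.injective _ (hm hz) _ h1 h2)
  · intro z hz v w
    rw [hp z hz, hq z hz, hp z hz, hq z hz]
    exact h.symm _ (hm hz) _ _

theorem fderiv_fderiv_symm {Y : V → V'} {Θ : OpenPartialHomeomorph V V'} (hY : ⇑Θ = Y)
    {z : V'} (hz : z ∈ Θ.target) (hs : DifferentiableAt ℝ Θ.symm z)
    (hd : DifferentiableAt ℝ Y (Θ.symm z)) (v : V') :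
    fderiv ℝ Y (Θ.symm z) (fderiv ℝ Θ.symm z v) = v := by
  have h1 : (Y ∘ Θ.symm) =ᶠ[nhds z] id := by
    filter_upwards [Θ.open_target.mem_nhds hz] with x hx
    rw [← hY]
    exact Θ.right_inv hx
  have h2 := h1.fderiv_eq (𝕜 := ℝ)
  rw [fderiv_comp z hd hs, fderiv_id] at h2
  exact congrArg (fun A : V' →L[ℝ] V' => A v) h2

end Reparametrisation

/-! ### Minimality -/

section Minimality

variable {V : Type*} [NormedAddCommGroup V] [NormedSpace ℝ V] {p q : V → ℍ[ℝ]} {Ω : Set V} {y : V}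

/-- Let `t` span the kernel of `dp`. The cubic condition, differentiated in the direction `t`,
says that the trace of the derivative of the normal field `q⁻¹ dq(t)` vanishes: the surface `p` is
minimal. -/
theorem IsLagrangianPatch.inner_fderiv_add_eq_zero (h : IsLagrangianPatch p q Ω) {t : V}
    (ht0 : t ≠ 0) (ht : ∀ z ∈ Ω, mc p z t = 0) (hy : y ∈ Ω) {u v : V}
    (huu : inner ℝ (mc p y u) (mc p y u) = (1 : ℝ)) (hvv : inner ℝ (mc p y v) (mc p y v) = (1 : ℝ))
    (huv : inner ℝ (mc p y u) (mc p y v) = (0 : ℝ)) :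
    inner ℝ (mc p y u) (fderiv ℝ (fun z => mc q z t) y u)
      + inner ℝ (mc p y v) (fderiv ℝ (fun z => mc q z t) y v) = 0 := by
  have horth : ∀ z ∈ Ω, ∀ w, inner ℝ (mc q z t) (mc p z w) = 0 := by
    intro z hz w
    rw [h.symm z hz, ht z hz, inner_zero_right]
  -- `dp` is constant in the direction `t`
  have hat : ∀ w, fderiv ℝ (fun z => mc p z w) y t = 0 := by
    intro w
    have h1 := h.fst.fderiv_mc hy t w
    have h2 : (fun z => mc p z t) =ᶠ[nhds y] fun _ => 0 := by
      filter_upwards [h.fst.isOpen.mem_nhds hy] with z hz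
      exact ht z hz
    rw [h2.fderiv_eq (𝕜 := ℝ), fderiv_fun_const, ht y hy, cross_zero_left] at h1
    simpa using h1
  have hbt : ∀ w, fderiv ℝ (fun z => mc q z w) y t =
      fderiv ℝ (fun z => mc q z t) y w - (2 : ℝ) • cross (mc q y t) (mc q y w) := by
    intro w
    rw [sub_eq_add_neg, ← h.snd.fderiv_mc hy t w]
    abel
  -- the cubic condition with `t` as one of the arguments
  have hcub : ∀ z ∈ Ω, inner ℝ (cross (mc p z u) (mc p z v))
      (cross (mc p z u) (mc p z v) - cross (mc p z u) (mc q z v)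
        - cross (mc q z u) (mc p z v)) = 0 := by
    intro z hz
    have hpr := h.isLagrangianPair hz
    have h1 := hpr.cubic t u v
    have c1 : inner ℝ (mc p z u) (cross (mc q z v) (mc q z t)) =
        inner ℝ (mc q z t) (cross (mc p z u) (mc q z v)) := by
      rw [inner_cross_cyc, inner_cross_cyc]
    have c2 : inner ℝ (mc p z v) (cross (mc q z t) (mc q z u)) =
        inner ℝ (mc q z t) (cross (mc q z u) (mc p z v)) := inner_cross_cyc _ _ _
    rw [ht z hz, inner_zero_left, cross_zero_left, cross_zero_right, inner_zero_right,
      inner_zero_right, c1, c2] at h1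
    have hβ : mc q z t ≠ 0 := fun h0 => ht0 (h.injective z hz t (ht z hz) h0)
    have h2 := smul_eq_inner_cross_smul (hpr.re_snd t) (hpr.re_fst u) (hpr.re_fst v)
      (horth z hz u) (horth z hz v)
    set ν := cross (mc p z u) (mc p z v) with hν
    rcases eq_or_ne ν 0 with h0 | h0
    · rw [h0, inner_zero_left]
    have h3 := congrArg (fun x : ℍ[ℝ] => (inner ℝ x (ν - cross (mc p z u) (mc q z v)
        - cross (mc q z u) (mc p z v)) : ℝ)) h2
    simp only [inner_smul_left, conj_trivial] at h3
    have h4 : inner ℝ (mc q z t) (ν - cross (mc p z u) (mc q z v)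
        - cross (mc q z u) (mc p z v)) = (0 : ℝ) := by
      rw [inner_sub_right, inner_sub_right]
      linarith
    rw [h4, mul_zero, eq_comm, mul_eq_zero] at h3
    refine h3.resolve_left fun h5 => ?_
    rw [h5, zero_smul] at h2
    exact (smul_ne_zero (inner_self_ne_zero.2 h0) hβ) h2
  -- the derivative of the cubic condition in the direction `t`
  have dν := fderiv_cross (h.fst.differentiableAt_mc hy u) (h.fst.differentiableAt_mc hy v)
  have d1 := fderiv_cross (h.fst.differentiableAt_mc hy u) (h.snd.differentiableAt_mc hy v)
  have d2 := fderiv_cross (h.snd.differentiableAt_mc hy u) (h.fst.differentiableAt_mc hy v)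
  have hder : inner ℝ (cross (mc p y u) (mc p y v))
      (cross (mc p y u) (fderiv ℝ (fun z => mc q z v) y t)
        + cross (fderiv ℝ (fun z => mc q z u) y t) (mc p y v)) = (0 : ℝ) := by
    have e1 : (fun z => (inner ℝ (cross (mc p z u) (mc p z v))
      (cross (mc p z u) (mc p z v) - cross (mc p z u) (mc q z v)
        - cross (mc q z u) (mc p z v)) : ℝ)) =ᶠ[nhds y] fun _ => 0 := by
      filter_upwards [h.fst.isOpen.mem_nhds hy] with z hz
      exact hcub z hz
    have e2 := congrArg (fun A : V →L[ℝ] ℝ => A t) (e1.fderiv_eq (𝕜 := ℝ))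
    have e3 := (dν.1.hasFDerivAt.fun_sub d1.1.hasFDerivAt).fun_sub d2.1.hasFDerivAt
    rw [fderiv_inner_apply ℝ dν.1 e3.differentiableAt, e3.fderiv] at e2
    simp only [sub_apply, dν.2, d1.2, d2.2, hat, cross_zero_left, cross_zero_right,
      fderiv_fun_const, Pi.zero_apply, zero_apply, add_zero, zero_add, inner_zero_left,
      inner_sub_right, zero_sub] at e2
    rw [inner_neg_right] at e2
    rw [inner_add_right]
    linarith
  have hpr := h.isLagrangianPair hy
  have hfr : IsPosFrame (cross (mc p y u) (mc p y v)) (mc p y u) (mc p y v) :=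
    ⟨hpr.re_fst u, hpr.re_fst v, huu, hvv, huv, rfl⟩
  have hβ := smul_eq_inner_cross_smul (hpr.re_snd t) (hpr.re_fst u) (hpr.re_fst v)
      (horth y hy u) (horth y hy v)
  set ν := cross (mc p y u) (mc p y v) with hν
  rw [hfr.norm_w, one_smul] at hβ
  have s1 : ∀ X, inner ℝ ν (cross (mc p y u) X) = inner ℝ (mc p y v) X := by
    intro X
    rw [inner_cross_cyc, inner_cross_cyc, hfr.cross_wu, real_inner_comm]
  have s2 : ∀ X, inner ℝ ν (cross X (mc p y v)) = inner ℝ (mc p y u) X := by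
    intro X
    rw [inner_cross_cyc, hfr.cross_vw, real_inner_comm]
  have s3 : ∀ X, inner ℝ (mc p y v) (cross ν X) = inner ℝ (mc p y u) X := by
    intro X
    rw [inner_cross_cyc, s2]
  have s4 : ∀ X, inner ℝ (mc p y u) (cross ν X) = -inner ℝ (mc p y v) X := by
    intro X
    rw [inner_cross_cyc, cross_anticomm, inner_neg_right, s1]
  rw [inner_add_right, s1, s2, hbt, hbt, hβ, inner_sub_right, inner_sub_right, inner_smul_right,
    inner_smul_right, cross_smul_left, cross_smul_left, inner_smul_right, inner_smul_right, s3, s4,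
    real_inner_comm (mc q y v), real_inner_comm (mc q y u), h.symm y hy u v] at hder
  linarith

end Minimality

/-! ### The local surface -/

section LocalSurface

open Metric

/-- A Lagrangian patch over `D × I` whose first factor does not depend on the second variable
gives a minimal surface; its unit normal is the direction of `q⁻¹ ∂ₜq`. -/
theorem IsLagrangianPatch.isMinimalSurface {p q : Plane × ℝ → ℍ[ℝ]} {D : Set Plane} {I : Set ℝ}
    (h : IsLagrangianPatch p q (D ×ˢ I)) (hD : IsOpen D) {t₀ : ℝ} (ht₀ : t₀ ∈ I)
    (ht : ∀ z ∈ D ×ˢ I, mc p z (0, 1) = 0)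
    (hi : ∀ z ∈ D, ∀ v, fderiv ℝ p (z, t₀) (v, 0) = 0 → v = 0) :
    IsMinimalSurface D (fun z => p (z, t₀))
      (fun z => p (z, t₀) * (‖mc q (z, t₀) (0, 1)‖⁻¹ • mc q (z, t₀) (0, 1))) := by
  have hmem : ∀ {z : Plane}, z ∈ D → (z, t₀) ∈ D ×ˢ I := fun hz => ⟨hz, ht₀⟩
  have hn : ∀ z ∈ D, ‖p (z, t₀)‖ = 1 := fun z hz => h.fst.norm_eq _ (hmem hz)
  have hβ : ∀ z ∈ D, mc q (z, t₀) (0, 1) ≠ 0 := by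
    intro z hz h0
    have := h.injective _ (hmem hz) (0, 1) (ht _ (hmem hz)) h0
    simp at this
  have horth : ∀ z ∈ D, ∀ w, inner ℝ (mc p (z, t₀) w) (mc q (z, t₀) (0, 1)) = 0 := by
    intro z hz w
    rw [real_inner_comm, h.symm _ (hmem hz), ht _ (hmem hz), inner_zero_right]
  -- restriction to the slice
  have hsl : ∀ {G : Plane × ℝ → ℍ[ℝ]} {z : Plane}, DifferentiableAt ℝ G (z, t₀) →
      HasFDerivAt (fun w => G (w, t₀))
        ((fderiv ℝ G (z, t₀)).comp (ContinuousLinearMap.inl ℝ Plane ℝ)) z :=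
    fun {G z} hG => HasFDerivAt.comp (f := fun w => (w, t₀)) z hG.hasFDerivAt
      (hasFDerivAt_prodMk_left z t₀)
  have hsl' : ∀ {G : Plane × ℝ → ℍ[ℝ]} {z : Plane}, DifferentiableAt ℝ G (z, t₀) → ∀ v,
      fderiv ℝ (fun w => G (w, t₀)) z v = fderiv ℝ G (z, t₀) (v, 0) := by
    intro G z hG v
    rw [(hsl hG).fderiv]
    rfl
  have hemb : ContDiff ℝ ∞ (fun w : Plane => (w, t₀)) := contDiff_id.prodMk contDiff_const
  have hdp : ∀ z ∈ D, ∀ v, fderiv ℝ (fun w => p (w, t₀)) z v =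
      p (z, t₀) * mc p (z, t₀) (v, 0) := by
    intro z hz v
    rw [hsl' (h.fst.differentiableAt (hmem hz)), mul_mc (hn z hz)]
  have hsp : ContDiffOn ℝ ∞ (fun z => p (z, t₀)) D :=
    h.fst.smooth.comp hemb.contDiffOn fun z hz => hmem hz
  refine ⟨hD, hsp, hn, ?_, ?_, ?_, ?_, ?_, ?_⟩
  · intro z hz
    refine (injective_iff_map_eq_zero _).2 fun v hv => hi z hz v ?_
    rwa [hsl' (h.fst.differentiableAt (hmem hz))] at hv
  · intro z hz
    have h1 : ContDiffAt ℝ ∞ (fun w => mc q (w, t₀) (0, 1)) z :=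
      ContDiffAt.comp (g := fun x => mc q x (0, 1)) (f := fun w => (w, t₀)) z
        (h.snd.contDiffAt_mc (hmem hz) (0, 1)) hemb.contDiffAt
    have h2 : ContDiffAt ℝ ∞ (fun w => ‖mc q (w, t₀) (0, 1)‖⁻¹) z :=
      (h1.norm ℝ (hβ z hz)).inv (norm_ne_zero_iff.2 (hβ z hz))
    exact ((hsp.contDiffAt (hD.mem_nhds hz)).mul (h2.smul h1)).contDiffWithinAt
  · intro z hz
    rw [norm_mul, hn z hz, norm_smul, norm_inv, norm_norm, one_mul,
      inv_mul_cancel₀ (norm_ne_zero_iff.2 (hβ z hz))]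
  · intro z hz
    have h1 : inner ℝ (p (z, t₀) * (‖mc q (z, t₀) (0, 1)‖⁻¹ • mc q (z, t₀) (0, 1)))
        (p (z, t₀) * 1) = (0 : ℝ) := by
      rw [inner_mul_left_of_norm (hn z hz), inner_smul_left]
      have := h.snd.mc_re (hmem hz) (0, 1)
      simp [inner_eq, this]
    simpa using h1
  · intro z hz u
    rw [hdp z hz, inner_mul_left_of_norm (hn z hz), inner_smul_left, real_inner_comm,
      horth z hz, mul_zero]
  · intro z hz u v hu hv huv
    have hz' := hmem hz
    -- the second fundamental form in terms of the normal field
    have hsig : ∀ u, sigma (fun z => p (z, t₀))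
        (fun z => p (z, t₀) * (‖mc q (z, t₀) (0, 1)‖⁻¹ • mc q (z, t₀) (0, 1))) z u u =
        -(‖mc q (z, t₀) (0, 1)‖⁻¹ * inner ℝ (mc p (z, t₀) (u, 0))
          (fderiv ℝ (fun x => mc q x (0, 1)) (z, t₀) (u, 0))) := by
      intro u
      have e1 : (fun w => fderiv ℝ (fun z => p (z, t₀)) w u) =ᶠ[nhds z]
          fun w => p (w, t₀) * mc p (w, t₀) (u, 0) := by
        filter_upwards [hD.mem_nhds hz] with w hw
        exact hdp w hw u
      have e2 : HasFDerivAt (fun x => p x * mc p x (u, 0)) _ (z, t₀) :=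
        (h.fst.differentiableAt hz').hasFDerivAt.mul'
          (h.fst.differentiableAt_mc hz' (u, 0)).hasFDerivAt
      have e3 : fderiv ℝ (fun w => p (w, t₀) * mc p (w, t₀) (u, 0)) z u =
          p (z, t₀) * (fderiv ℝ (fun x => mc p x (u, 0)) (z, t₀) (u, 0)
            + mc p (z, t₀) (u, 0) * mc p (z, t₀) (u, 0)) := by
        rw [hsl' e2.differentiableAt, e2.fderiv, mul_add, ← mul_assoc, mul_mc (hn z hz)]
        simp
      have e4 : inner ℝ (fderiv ℝ (fun x => mc p x (u, 0)) (z, t₀) (u, 0))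
          (mc q (z, t₀) (0, 1)) = -inner ℝ (mc p (z, t₀) (u, 0))
          (fderiv ℝ (fun x => mc q x (0, 1)) (z, t₀) (u, 0)) := by
        have a1 : (fun x => (inner ℝ (mc p x (u, 0)) (mc q x (0, 1)) : ℝ)) =ᶠ[nhds (z, t₀)]
            fun _ => 0 := by
          filter_upwards [h.fst.isOpen.mem_nhds hz'] with x hx
          rw [real_inner_comm, h.symm _ hx, ht _ hx, inner_zero_right]
        have a2 := congrArg (fun A : Plane × ℝ →L[ℝ] ℝ => A (u, 0)) (a1.fderiv_eq (𝕜 := ℝ))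
        rw [fderiv_inner_apply ℝ (h.fst.differentiableAt_mc hz' _)
          (h.snd.differentiableAt_mc hz' _), fderiv_fun_const] at a2
        simp only [Pi.zero_apply, zero_apply] at a2
        linarith
      have e5 : inner ℝ (mc p (z, t₀) (u, 0) * mc p (z, t₀) (u, 0)) (mc q (z, t₀) (0, 1))
          = (0 : ℝ) := by
        rw [mul_self_of_re_eq_zero (h.fst.mc_re hz' _)]
        rw [inner_eq, h.snd.mc_re hz' (0, 1), Quaternion.imI_coe, Quaternion.imJ_coe,
          Quaternion.imK_coe]
        ring
      rw [sigma, e1.fderiv_eq (𝕜 := ℝ), e3, inner_mul_left_of_norm (hn z hz), inner_smul_right,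
        inner_add_left, e4, e5]
      ring
    rw [hdp z hz, norm_mul, hn z hz, one_mul] at hu hv
    rw [hdp z hz, hdp z hz, inner_mul_left_of_norm (hn z hz)] at huv
    have key := h.inner_fderiv_add_eq_zero (t := (0, 1)) (by simp) ht hz' (u := (u, 0))
      (v := (v, 0)) (by rw [real_inner_self_eq_norm_sq, hu]; norm_num)
      (by rw [real_inner_self_eq_norm_sq, hv]; norm_num) huv
    rw [hsig, hsig]
    linear_combination -(‖mc q (z, t₀) (0, 1)‖⁻¹) * key

/-- A linear map of rank two of a three-dimensional space extends to an isomorphism onto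
`Plane × ℝ`, after composition with a linear map on the left. -/
theorem exists_linear_complement {V : Type*} [NormedAddCommGroup V] [NormedSpace ℝ V]
    [FiniteDimensional ℝ V] (hd : Module.finrank ℝ V = 3) (A : V →L[ℝ] ℍ[ℝ])
    (hk : Module.finrank ℝ (LinearMap.ker (A : V →ₗ[ℝ] ℍ[ℝ])) = 1) :
    ∃ (L : ℍ[ℝ] →L[ℝ] Plane) (l : V →L[ℝ] ℝ) (T : V ≃L[ℝ] Plane × ℝ),
      (T : V →L[ℝ] Plane × ℝ) = (L.comp A).prod l := by
  have hr : Module.finrank ℝ (LinearMap.range (A : V →ₗ[ℝ] ℍ[ℝ])) = 2 := by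
    have := LinearMap.finrank_range_add_finrank_ker (A : V →ₗ[ℝ] ℍ[ℝ])
    omega
  let e : LinearMap.range (A : V →ₗ[ℝ] ℍ[ℝ]) ≃ₗ[ℝ] Plane :=
    LinearEquiv.ofFinrankEq _ _ (by rw [hr]; simp)
  let k : LinearMap.ker (A : V →ₗ[ℝ] ℍ[ℝ]) ≃ₗ[ℝ] ℝ :=
    LinearEquiv.ofFinrankEq _ _ (by rw [hk]; simp)
  obtain ⟨L, hL⟩ := LinearMap.exists_extend e.toLinearMap
  obtain ⟨l, hl⟩ := LinearMap.exists_extend k.toLinearMap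
  have hL' : ∀ x, L (A x) = e ⟨A x, x, rfl⟩ := fun x =>
    congrArg (fun f : _ →ₗ[ℝ] Plane => f ⟨A x, x, rfl⟩) hL
  have hl' : ∀ x (hx : x ∈ LinearMap.ker (A : V →ₗ[ℝ] ℍ[ℝ])), l x = k ⟨x, hx⟩ := fun x hx =>
    congrArg (fun f : _ →ₗ[ℝ] ℝ => f ⟨x, hx⟩) hl
  let T₀ : V →ₗ[ℝ] Plane × ℝ := (L ∘ₗ (A : V →ₗ[ℝ] ℍ[ℝ])).prod l
  have hinj : Function.Injective T₀ := by
    refine (injective_iff_map_eq_zero _).2 fun x hx => ?_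
    have h1 : L (A x) = 0 := congrArg Prod.fst hx
    have h2 : l x = 0 := congrArg Prod.snd hx
    rw [hL', LinearEquiv.map_eq_zero_iff] at h1
    have h3 : A x = 0 := congrArg Subtype.val h1
    rw [hl' x h3, LinearEquiv.map_eq_zero_iff] at h2
    exact congrArg Subtype.val h2
  refine ⟨LinearMap.toContinuousLinearMap L, LinearMap.toContinuousLinearMap l,
    (T₀.linearEquivOfInjective hinj (by simp [hd])).toContinuousLinearEquiv, ?_⟩
  ext x <;> rfl

/-- Near a point where `dp ≠ 0`, the first component of a Lagrangian patch with nowhere injective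
`dp` factors through a minimal surface. -/
theorem IsLagrangianPatch.exists_local_surface {V : Type*} [NormedAddCommGroup V]
    [NormedSpace ℝ V] [FiniteDimensional ℝ V] (hd : Module.finrank ℝ V = 3) {p q : V → ℍ[ℝ]}
    {Ω : Set V} (h : IsLagrangianPatch p q Ω)
    (hni : ∀ y ∈ Ω, ¬ Function.Injective (fderiv ℝ p y)) {y₀ : V} (hy₀ : y₀ ∈ Ω)
    (h0 : fderiv ℝ p y₀ ≠ 0) :
    ∃ (W : Set V) (L : ℍ[ℝ] →L[ℝ] Plane) (D : Set Plane) (φ N : Plane → ℍ[ℝ]),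
      IsOpen W ∧ y₀ ∈ W ∧ W ⊆ Ω ∧ IsMinimalSurface D φ N ∧ (fun y => L (p y)) '' W = D ∧
      (∀ y ∈ W, p y = φ (L (p y))) ∧
      ∀ y ∈ W, Function.Surjective fun v => L (fderiv ℝ p y v) := by
  have hΩ := h.fst.isOpen
  have hpr := h.isLagrangianPair hy₀
  have hker : ∀ y ∈ Ω, ∀ v, mc p y v = 0 ↔ fderiv ℝ p y v = 0 := by
    intro y hy v
    constructor
    · intro h1
      rw [← mul_mc (h.fst.norm_eq y hy), h1, mul_zero]
    · intro h1
      rw [mc_apply, h1, mul_zero]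
  have hk : Module.finrank ℝ (LinearMap.ker (fderiv ℝ p y₀ : V →ₗ[ℝ] ℍ[ℝ])) = 1 := by
    have e1 : LinearMap.ker (fderiv ℝ p y₀ : V →ₗ[ℝ] ℍ[ℝ]) = LinearMap.ker (mc p y₀) := by
      ext v
      exact (hker y₀ hy₀ v).symm
    rw [e1]
    refine hpr.finrank_ker (fun hi => hni y₀ hy₀ ?_) (fun h1 => h0 ?_)
    · refine (injective_iff_map_eq_zero _).2 fun v hv => ?_
      exact (injective_iff_map_eq_zero _).1 hi v ((hker y₀ hy₀ v).2 hv)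
    · ext1 v
      exact (hker y₀ hy₀ v).1 (by rw [h1]; rfl)
  obtain ⟨L, l, T, hT⟩ := exists_linear_complement hd (fderiv ℝ p y₀) hk
  let Y : V → Plane × ℝ := fun y => (L (p y), l y)
  have hYd : ∀ y ∈ Ω, HasFDerivAt Y ((L.comp (fderiv ℝ p y)).prod l) y := fun y hy =>
    (L.hasFDerivAt.comp y (h.fst.differentiableAt hy).hasFDerivAt).prodMk l.hasFDerivAt
  have hYs : ContDiffOn ℝ ∞ Y Ω :=
    (L.contDiff.comp_contDiffOn h.fst.smooth).prodMk l.contDiff.contDiffOn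
  obtain ⟨Θ, hyΘ, hΘΩ, hΘY, hΘs, hΘd⟩ := exists_smooth_local_inverse hΩ hYs hy₀ T
    (by rw [(hYd y₀ hy₀).fderiv, hT])
  have hYi : ∀ y ∈ Θ.source, Function.Bijective ((L.comp (fderiv ℝ p y)).prod l) := by
    intro y hy
    obtain ⟨T', hT'⟩ := hΘd y hy
    rw [(hYd y (hΘΩ hy)).unique hT']
    exact T'.bijective
  obtain ⟨r, hr, hrT⟩ := isOpen_iff.1 Θ.open_target (Y y₀) (hΘY ▸ Θ.map_source hyΘ)
  set z₀ : Plane := (Y y₀).1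
  set t₀ : ℝ := (Y y₀).2
  have hST : ball z₀ r ×ˢ ball t₀ r ⊆ Θ.target := by
    rw [ball_prod_same]
    exact hrT
  set S := ball z₀ r ×ˢ ball t₀ r with hS
  have hSo : IsOpen S := isOpen_ball.prod isOpen_ball
  have ht₀ : t₀ ∈ ball t₀ r := mem_ball_self hr
  have hsy : ∀ x ∈ S, Θ.symm x ∈ Θ.source := fun x hx => Θ.map_target (hST hx)
  have hΩ' : ∀ x ∈ S, Θ.symm x ∈ Ω := fun x hx => hΘΩ (hsy x hx)
  have hsd : ∀ x ∈ S, DifferentiableAt ℝ Θ.symm x := fun x hx =>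
    (hΘs.contDiffAt (Θ.open_target.mem_nhds (hST hx))).differentiableAt (by simp)
  have hinv : ∀ x ∈ S, ∀ v, fderiv ℝ Y (Θ.symm x) (fderiv ℝ Θ.symm x v) = v := fun x hx v =>
    fderiv_fderiv_symm hΘY (hST hx) (hsd x hx) (hYd _ (hΩ' x hx)).differentiableAt v
  have hpatch : IsLagrangianPatch (p ∘ Θ.symm) (q ∘ Θ.symm) S := by
    refine h.comp hSo (hΘs.mono hST) hΩ' fun x hx v hv => ?_
    rw [← hinv x hx v, hv, map_zero]
  set P := p ∘ Θ.symm with hP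
  have hPd : ∀ x ∈ S, DifferentiableAt ℝ P x := fun x hx => hpatch.fst.differentiableAt hx
  have hYx : ∀ x ∈ S, Y (Θ.symm x) = x := by
    intro x hx
    rw [← hΘY]
    exact Θ.right_inv (hST hx)
  have hLP : ∀ x ∈ S, L (P x) = x.1 := fun x hx => congrArg Prod.fst (hYx x hx)
  -- the kernel of `dp` is the coordinate direction `t`
  have hPt : ∀ x ∈ S, fderiv ℝ P x (0, 1) = 0 := by
    intro x hx
    obtain ⟨v, hv, hv0⟩ : ∃ v, fderiv ℝ p (Θ.symm x) v = 0 ∧ v ≠ 0 := by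
      have h1 := hni _ (hΩ' x hx)
      rw [injective_iff_map_eq_zero] at h1
      push Not at h1
      exact h1
    have hin := (hYi _ (hsy x hx)).1
    have h2 : fderiv ℝ Y (Θ.symm x) v = (0, l v) := by
      rw [(hYd _ (hΩ' x hx)).fderiv]
      simp [hv]
    have h3 : fderiv ℝ Θ.symm x (0, l v) = v := by
      apply hin
      rw [← (hYd _ (hΩ' x hx)).fderiv, hinv x hx, h2]
    have hlv : l v ≠ 0 := by
      intro h4
      rw [h4, show ((0 : Plane), (0 : ℝ)) = 0 from rfl, map_zero] at h3
      exact hv0 h3.symm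
    have h5 : fderiv ℝ P x (0, l v) = 0 := by
      rw [hP, fderiv_comp x (h.fst.differentiableAt (hΩ' x hx)) (hsd x hx)]
      simp only [ContinuousLinearMap.comp_apply, h3, hv]
    have h6 : ((0 : Plane), (1 : ℝ)) = (l v)⁻¹ • (0, l v) := by
      ext1 <;> simp [hlv]
    rw [h6, map_smul, h5, smul_zero]
  have hPc : ∀ x ∈ S, P x = P (x.1, t₀) := by
    rintro ⟨z, t⟩ ⟨hz, ht⟩
    have hd' : ∀ s ∈ ball t₀ r, HasFDerivAt (fun s => P (z, s))
        ((fderiv ℝ P (z, s)).comp (ContinuousLinearMap.inr ℝ Plane ℝ)) s := fun s hs =>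
      HasFDerivAt.comp (g := P) (f := fun s => (z, s)) s
        (hPd (z, s) (Set.mk_mem_prod hz hs)).hasFDerivAt
        (hasFDerivAt_prodMk_right z s)
    refine isOpen_ball.is_const_of_fderiv_eq_zero (𝕜 := ℝ) (convex_ball t₀ r).isPreconnected
      (fun s hs => (hd' s hs).differentiableAt.differentiableWithinAt) (fun s hs => ?_) ht ht₀
    rw [(hd' s hs).fderiv]
    ext1
    simpa using hPt (z, s) ⟨hz, hs⟩
  have hmin := hpatch.isMinimalSurface isOpen_ball ht₀
    (fun x hx => by rw [mc_apply, hPt x hx, mul_zero]) (fun z hz v hv => by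
      have hx : (z, t₀) ∈ S := ⟨hz, ht₀⟩
      have h1 : (fun x => L (P x)) =ᶠ[nhds (z, t₀)] Prod.fst := by
        filter_upwards [hSo.mem_nhds hx] with x hx
        exact hLP x hx
      have h2 := congrArg (fun A : Plane × ℝ →L[ℝ] Plane => A (v, 0)) (h1.fderiv_eq (𝕜 := ℝ))
      have h3 : HasFDerivAt (fun x => L (P x)) (L.comp (fderiv ℝ P (z, t₀))) (z, t₀) :=
        L.hasFDerivAt.comp _ (hPd _ hx).hasFDerivAt
      rw [h3.fderiv, fderiv_fst] at h2
      simpa [hv] using h2.symm)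
  have hΘ1 : ∀ y, (Θ y).1 = L (p y) := fun y => by rw [hΘY]
  refine ⟨Θ.source ∩ Θ ⁻¹' S, L, ball z₀ r, _, _, Θ.isOpen_inter_preimage hSo, ⟨hyΘ, ?_⟩,
    fun y hy => hΘΩ hy.1, hmin, ?_, ?_, ?_⟩
  · rw [hΘY]
    exact ⟨mem_ball_self hr, mem_ball_self hr⟩
  · ext z
    constructor
    · rintro ⟨y, hy, rfl⟩
      have := hy.2.1
      rwa [hΘ1] at this
    · intro hz
      have hx : (z, t₀) ∈ S := ⟨hz, ht₀⟩
      refine ⟨Θ.symm (z, t₀), ⟨hsy _ hx, ?_⟩, hLP _ hx⟩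
      rw [Set.mem_preimage, Θ.right_inv (hST hx)]
      exact hx
  · intro y hy
    have h1 := hPc _ hy.2
    rw [hΘ1] at h1
    rw [← h1, hP, Function.comp_apply, Θ.left_inv hy.1]
  · intro y hy w
    obtain ⟨v, hv⟩ := (hYi y hy.1).2 (w, 0)
    exact ⟨v, congrArg Prod.fst hv⟩

end LocalSurface

/-! ### The Cayley chart of the second factor -/

section CayleyChart

open Metric

/-- `imCoord` as a continuous linear map. -/
noncomputable def imCoordCLM : ℍ[ℝ] →L[ℝ] E3 := LinearMap.toContinuousLinearMap imCoord

/-- The real part as a continuous linear map. -/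
noncomputable def reCLM : ℍ[ℝ] →L[ℝ] ℝ := innerSL ℝ (1 : ℍ[ℝ])

theorem reCLM_apply (a : ℍ[ℝ]) : reCLM a = a.re := by
  change inner ℝ (1 : ℍ[ℝ]) a = a.re
  simp [inner_eq]

/-- The inverse Cayley transform `Q ↦ Im Q / (1 + Re Q)` of the unit quaternions. -/
noncomputable def cayleyInv (Q : ℍ[ℝ]) : E3 := (1 + reCLM Q)⁻¹ • imCoordCLM Q

theorem cayleyInv_relation {Q : ℍ[ℝ]} (hQ : ‖Q‖ = 1) (h : 1 + reCLM Q ≠ 0) :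
    (1 - imLift (cayleyInv Q)) * Q = 1 + imLift (cayleyInv Q) := by
  have hn := norm_sq_eq Q
  rw [hQ] at hn
  have h' : 1 + Q.re ≠ 0 := by rwa [reCLM_apply] at h
  have e : ∀ i, cayleyInv Q i = (1 + Q.re)⁻¹ * imCoord Q i := fun i => by
    rw [cayleyInv, reCLM_apply]; rfl
  ext <;> simp [e] <;> field_simp <;> linarith

/-- If `dp = 0` at `y₀`, then `y₀` has a neighbourhood such that `dp` vanishes near `y₀` as soon as it
vanishes near one point of the neighbourhood. As the patch is immersed, `dq` is an isomorphism at
`y₀`, and Cayley coordinates of the second factor are coordinates of the patch near `y₀`. -/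
theorem IsLagrangianPatch.exists_nhds_unique_continuation {p q : E3 → ℍ[ℝ]} {Ω : Set E3}
    (h : IsLagrangianPatch p q Ω) {y₀ : E3} (hy₀ : y₀ ∈ Ω) (h0 : mc p y₀ = 0) :
    ∃ W : Set E3, IsOpen W ∧ y₀ ∈ W ∧ W ⊆ Ω ∧
      ∀ y₁ ∈ W, (∀ᶠ y in nhds y₁, mc p y = 0) → ∀ᶠ y in nhds y₀, mc p y = 0 := by
  have hΩ := h.fst.isOpen
  set q₀ := q y₀ with hq₀
  have hn0 : ‖q₀‖ = 1 := h.snd.norm_eq y₀ hy₀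
  have hns : ‖star q₀‖ = 1 := by rw [Quaternion.norm_star, hn0]
  let Q : E3 → ℍ[ℝ] := fun y => star q₀ * q y
  have hQs : ContDiffOn ℝ ∞ Q Ω := contDiffOn_const.mul h.snd.smooth
  have hQ0 : Q y₀ = 1 := star_mul_self_of_norm hn0
  let Ω₁ := Ω ∩ Q ⁻¹' {a | 1 + reCLM a ≠ 0}
  have hΩ₁ : IsOpen Ω₁ := hQs.continuousOn.isOpen_inter_preimage hΩ
    (isOpen_ne_fun (continuous_const.add reCLM.continuous) continuous_const)
  have hre1 : reCLM (1 : ℍ[ℝ]) = 1 := by simp [reCLM_apply]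
  have hy₁ : y₀ ∈ Ω₁ := ⟨hy₀, by
    change 1 + reCLM (Q y₀) ≠ 0
    rw [hQ0, hre1]
    norm_num⟩
  let Y : E3 → E3 := fun y => cayleyInv (Q y)
  have hQs₁ : ContDiffOn ℝ ∞ Q Ω₁ := hQs.mono Set.inter_subset_left
  have hYs : ContDiffOn ℝ ∞ Y Ω₁ :=
    ((contDiffOn_const.add (reCLM.contDiff.comp_contDiffOn hQs₁)).inv fun y hy => hy.2).smul
      (imCoordCLM.contDiff.comp_contDiffOn hQs₁)
  -- the derivative of the Cayley coordinates at the base point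
  have hYd : ∀ v, fderiv ℝ Y y₀ v = (2 : ℝ)⁻¹ • imCoord (mc q y₀ v) := by
    intro v
    have d1 : HasFDerivAt Q (star q₀ • fderiv ℝ q y₀) y₀ :=
      (h.snd.differentiableAt hy₀).hasFDerivAt.const_mul (star q₀)
    have d2 : DifferentiableAt ℝ (fun y => (1 + reCLM (Q y))⁻¹) y₀ :=
      ((reCLM.hasFDerivAt.comp y₀ d1).differentiableAt.const_add 1).inv hy₁.2
    have d3 : HasFDerivAt (fun y => imCoordCLM (Q y)) _ y₀ := imCoordCLM.hasFDerivAt.comp y₀ d1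
    have d4 : HasFDerivAt Y _ y₀ := d2.hasFDerivAt.smul d3
    have i1 : imCoordCLM (1 : ℍ[ℝ]) = 0 := by
      change imCoord 1 = 0
      ext i
      fin_cases i <;> simp
    rw [d4.fderiv]
    simp only [hQ0, i1, hre1]
    norm_num
    rfl
  have hYi : Function.Injective (fderiv ℝ Y y₀ : E3 →ₗ[ℝ] E3) := by
    refine (injective_iff_map_eq_zero _).2 fun v hv => ?_
    have h1 : (2 : ℝ)⁻¹ • imCoord (mc q y₀ v) = 0 := by rw [← hYd]; exact hv
    have h2 : imCoord (mc q y₀ v) = 0 := (smul_eq_zero.1 h1).resolve_left (by norm_num)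
    refine h.injective y₀ hy₀ v (by rw [h0]; rfl) ?_
    rw [← imLift_imCoord (h.snd.mc_re hy₀ v), h2, map_zero]
  let T : E3 ≃L[ℝ] E3 := ((fderiv ℝ Y y₀ : E3 →ₗ[ℝ] E3).linearEquivOfInjective hYi
    rfl).toContinuousLinearEquiv
  obtain ⟨Θ, hyΘ, hΘΩ, hΘY, hΘs, hΘd⟩ := exists_smooth_local_inverse hΩ₁ hYs hy₁ T
    (by ext1 v; rfl)
  have hYy₀ : Y y₀ = 0 := by
    change (1 + reCLM (Q y₀))⁻¹ • imCoord (Q y₀) = 0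
    rw [hQ0]
    ext i
    fin_cases i <;> simp
  obtain ⟨R, hR, hRT⟩ := isOpen_iff.1 Θ.open_target (Y y₀) (hΘY ▸ Θ.map_source hyΘ)
  rw [hYy₀] at hRT
  have hsy : ∀ x ∈ ball (0 : E3) R, Θ.symm x ∈ Ω₁ := fun x hx => hΘΩ (Θ.map_target (hRT hx))
  have hsd : ∀ x ∈ ball (0 : E3) R, DifferentiableAt ℝ Θ.symm x := fun x hx =>
    (hΘs.contDiffAt (Θ.open_target.mem_nhds (hRT hx))).differentiableAt (by simp)
  have hYD : ∀ y ∈ Ω₁, DifferentiableAt ℝ Y y := fun y hy =>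
    (hYs.contDiffAt (hΩ₁.mem_nhds hy)).differentiableAt (by simp)
  have hpatch : IsLagrangianPatch (p ∘ Θ.symm) (q ∘ Θ.symm) (ball 0 R) := by
    refine h.comp isOpen_ball (hΘs.mono hRT) (fun x hx => (hsy x hx).1) fun x hx v hv => ?_
    rw [← fderiv_fderiv_symm hΘY (hRT hx) (hsd x hx) (hYD _ (hsy x hx)) v, hv, map_zero]
  have hrel : ∀ x ∈ ball (0 : E3) R,
      (1 - imLift x) * (star q₀ * (q ∘ Θ.symm) x) = 1 + imLift x := by
    intro x hx
    have h1 : cayleyInv (Q (Θ.symm x)) = x := by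
      change Y (Θ.symm x) = x
      rw [← hΘY]
      exact Θ.right_inv (hRT hx)
    have h2 := cayleyInv_relation (Q := Q (Θ.symm x))
      (by rw [norm_mul, hns, h.snd.norm_eq _ (hsy x hx).1, one_mul]) (hsy x hx).2
    rw [h1] at h2
    exact h2
  have hmcΘ : ∀ x ∈ ball (0 : E3) R, ∀ v,
      mc (p ∘ Θ.symm) x v = mc p (Θ.symm x) (fderiv ℝ Θ.symm x v) := fun x hx v =>
    mc_comp (h.fst.differentiableAt (hsy x hx).1) (hsd x hx) v
  have hball : ball (0 : E3) (R / 4) ⊆ ball 0 R := ball_subset_ball (by linarith)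
  refine ⟨Θ.source ∩ Θ ⁻¹' ball 0 (R / 4), Θ.isOpen_inter_preimage isOpen_ball, ⟨hyΘ, ?_⟩,
    fun y hy => (hΘΩ hy.1).1, fun y₁ hy₁ hz => ?_⟩
  · rw [Set.mem_preimage, hΘY, hYy₀]
    exact mem_ball_self (by linarith)
  · -- transfer to the Cayley coordinates
    have hz' : ∀ᶠ x in nhds (Θ y₁), mc (p ∘ Θ.symm) x = 0 := by
      have hc : Filter.Tendsto Θ.symm (nhds (Θ y₁)) (nhds y₁) := by
        have := (Θ.symm.continuousAt (Θ.map_source hy₁.1))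
        rw [ContinuousAt, Θ.left_inv hy₁.1] at this
        exact this
      filter_upwards [hc.eventually hz, isOpen_ball.mem_nhds (hball hy₁.2)] with x hx hx'
      ext1 v
      rw [hmcΘ x hx', hx]
      rfl
    have key := mc_eq_zero_of_eventually hpatch hn0 hrel hy₁.2 hz'
    -- the derivative of `Θ.symm` is surjective
    have hback : ∀ y ∈ Θ.source, Θ y ∈ ball (0 : E3) R → mc (p ∘ Θ.symm) (Θ y) = 0 →
        mc p y = 0 := by
      intro y hy hyR h1
      ext1 v
      have hinj : Function.Injective (fderiv ℝ Y y) := by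
        obtain ⟨T', hT'⟩ := hΘd y hy
        rw [hT'.fderiv]
        exact T'.injective
      have h2 := fderiv_fderiv_symm hΘY (hRT hyR) (hsd _ hyR) (hYD _ (hsy _ hyR))
        (fderiv ℝ Y y v)
      rw [Θ.left_inv hy] at h2
      have h3 := hmcΘ (Θ y) hyR (fderiv ℝ Y y v)
      rw [Θ.left_inv hy, hinj h2, h1] at h3
      exact h3.symm
    have h0mem : Θ y₀ ∈ ball (Θ y₁) (R / 2) := by
      rw [hΘY, hYy₀, mem_ball_comm, ← hΘY]
      exact ball_subset_ball (by linarith) hy₁.2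
    have h0R : Θ y₀ ∈ ball (0 : E3) R := by
      rw [hΘY, hYy₀]
      exact mem_ball_self hR
    have hΘc := Θ.continuousAt hyΘ
    filter_upwards [Θ.open_source.mem_nhds hyΘ, hΘc.eventually (isOpen_ball.mem_nhds h0mem),
      hΘc.eventually (isOpen_ball.mem_nhds h0R)] with y a1 a2 a3
    exact hback y a1 a3 (key _ a2)

end CayleyChart

/-! ### Lagrangian immersions in charts -/

section Charts

variable {M : Type*} [TopologicalSpace M] [ChartedSpace (EuclideanSpace ℝ (Fin 3)) M]

theorem mdifferentiableAt_of_isLagrangianImmersion {f : M → HH} (hf : IsLagrangianImmersion f)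
    (x : M) : MDifferentiableAt (𝓡 3) 𝓘(ℝ, HH) f x :=
  (hf.smooth x).mdifferentiableAt (by simp)

theorem mdifferentiableAt_clm_comp {E F : Type*} [NormedAddCommGroup E] [NormedSpace ℝ E]
    [NormedAddCommGroup F] [NormedSpace ℝ F] {G : M → E} {x : M}
    (hG : MDifferentiableAt (𝓡 3) 𝓘(ℝ, E) G x) (L : E →L[ℝ] F) :
    MDifferentiableAt (𝓡 3) 𝓘(ℝ, F) (fun y => L (G y)) x ∧
      diff (fun y => L (G y)) x = L.comp (diff G x) := by
  have h := L.hasMFDerivAt.comp x hG.hasMFDerivAt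
  exact ⟨h.mdifferentiableAt, h.mfderiv⟩

theorem diff_fstMap {f : M → HH} (hf : IsLagrangianImmersion f) (x : M)
    (X : TangentSpace (𝓡 3) x) : diff (fstMap f) x X = (diff f x X).1 := by
  have h := (mdifferentiableAt_clm_comp (mdifferentiableAt_of_isLagrangianImmersion hf x)
    (ContinuousLinearMap.fst ℝ ℍ[ℝ] ℍ[ℝ])).2
  exact congrArg (fun A : TangentSpace (𝓡 3) x →L[ℝ] ℍ[ℝ] => A X) h

theorem mdifferentiableAt_fstMap {f : M → HH} (hf : IsLagrangianImmersion f) (x : M) :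
    MDifferentiableAt (𝓡 3) 𝓘(ℝ, ℍ[ℝ]) (fstMap f) x :=
  (mdifferentiableAt_clm_comp (mdifferentiableAt_of_isLagrangianImmersion hf x)
    (ContinuousLinearMap.fst ℝ ℍ[ℝ] ℍ[ℝ])).1

theorem contMDiff_fstMap {f : M → HH} (hf : IsLagrangianImmersion f) :
    ContMDiff (𝓡 3) 𝓘(ℝ, ℍ[ℝ]) ∞ (fstMap f) :=
  (ContinuousLinearMap.fst ℝ ℍ[ℝ] ℍ[ℝ]).contMDiff.comp hf.smooth

variable [IsManifold (𝓡 3) ∞ M]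

/-- In a chart, the differential of a map is its derivative, up to an isomorphism which does not
depend on the map. -/
theorem exists_chart_equiv (x₀ : M) {y : E3} (hy : y ∈ (extChartAt (𝓡 3) x₀).target) :
    ∃ A : E3 ≃L[ℝ] TangentSpace (𝓡 3) ((extChartAt (𝓡 3) x₀).symm y),
      ∀ (E : Type) [NormedAddCommGroup E] [NormedSpace ℝ E] (G : M → E),
        MDifferentiableAt (𝓡 3) 𝓘(ℝ, E) G ((extChartAt (𝓡 3) x₀).symm y) →
        ∀ v, fderiv ℝ (G ∘ (extChartAt (𝓡 3) x₀).symm) y v =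
          diff G ((extChartAt (𝓡 3) x₀).symm y) (A v) := by
  have : IsManifold (𝓡 3) 1 M := IsManifold.of_le (n := ∞) (by simp)
  obtain ⟨A, hA⟩ := isInvertible_mfderivWithin_extChartAt_symm (I := 𝓡 3) hy
  have hs := mdifferentiableWithinAt_extChartAt_symm (I := 𝓡 3) hy
  have hr : Set.range (𝓡 3) = Set.univ := ModelWithCorners.range_eq_univ _
  rw [hr] at hA hs
  rw [mfderivWithin_univ] at hA
  rw [mdifferentiableWithinAt_univ] at hs
  refine ⟨A, fun E _ _ G hG v => ?_⟩
  have h := hG.hasMFDerivAt.comp y hs.hasMFDerivAt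
  have h2 := h.mfderiv
  rw [mfderiv_eq_fderiv] at h2
  rw [h2]
  have h3 := congrArg
    (fun B : E3 →L[ℝ] TangentSpace (𝓡 3) ((extChartAt (𝓡 3) x₀).symm y) => B v) hA
  exact congrArg (fun w => mfderiv (𝓡 3) 𝓘(ℝ, E) G ((extChartAt (𝓡 3) x₀).symm y) w) h3.symm

variable {f : M → HH}

/-- A Lagrangian immersion is a Lagrangian patch in each chart; `mc` is there the left-trivialised
differential, up to an isomorphism. -/
theorem isLagrangianPatch_chart (hf : IsLagrangianImmersion f) (x₀ : M) :
    IsLagrangianPatch (fun y => (f ((extChartAt (𝓡 3) x₀).symm y)).1)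
      (fun y => (f ((extChartAt (𝓡 3) x₀).symm y)).2) (extChartAt (𝓡 3) x₀).target ∧
    ∀ y ∈ (extChartAt (𝓡 3) x₀).target,
      ∃ A : E3 ≃ₗ[ℝ] TangentSpace (𝓡 3) ((extChartAt (𝓡 3) x₀).symm y),
      ∀ v, mc (fun y => (f ((extChartAt (𝓡 3) x₀).symm y)).1) y v =
          fstForm f ((extChartAt (𝓡 3) x₀).symm y) (A v) ∧
        mc (fun y => (f ((extChartAt (𝓡 3) x₀).symm y)).2) y v =
          sndForm f ((extChartAt (𝓡 3) x₀).symm y) (A v) := by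
  set e := extChartAt (𝓡 3) x₀ with he
  have hsm : ContDiffOn ℝ ∞ (f ∘ e.symm) e.target := by
    rw [← contMDiffOn_iff_contDiffOn]
    exact hf.smooth.comp_contMDiffOn (contMDiffOn_extChartAt_symm x₀)
  have ho : IsOpen e.target := isOpen_extChartAt_target x₀
  have hd : ∀ y ∈ e.target, DifferentiableAt ℝ (f ∘ e.symm) y := fun y hy =>
    (hsm.contDiffAt (ho.mem_nhds hy)).differentiableAt (by simp)
  have key : ∀ y ∈ e.target, ∃ A : E3 ≃ₗ[ℝ] TangentSpace (𝓡 3) (e.symm y),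
      ∀ v, mc (fun y => (f (e.symm y)).1) y v = fstForm f (e.symm y) (A v) ∧
        mc (fun y => (f (e.symm y)).2) y v = sndForm f (e.symm y) (A v) := by
    intro y hy
    obtain ⟨A, hA⟩ := exists_chart_equiv x₀ hy
    have hA' := hA HH f (mdifferentiableAt_of_isLagrangianImmersion hf _)
    refine ⟨A.toLinearEquiv, fun v => ⟨?_, ?_⟩⟩
    · have h1 : HasFDerivAt (fun y => (f (e.symm y)).1) _ y :=
        (ContinuousLinearMap.fst ℝ ℍ[ℝ] ℍ[ℝ]).hasFDerivAt.comp y (hd y hy).hasFDerivAt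
      rw [mc_apply, h1.fderiv, fstForm_apply]
      exact congrArg (fun Z : HH => star (f (e.symm y)).1 * Z.1) (hA' v)
    · have h1 : HasFDerivAt (fun y => (f (e.symm y)).2) _ y :=
        (ContinuousLinearMap.snd ℝ ℍ[ℝ] ℍ[ℝ]).hasFDerivAt.comp y (hd y hy).hasFDerivAt
      rw [mc_apply, h1.fderiv, sndForm_apply]
      exact congrArg (fun Z : HH => star (f (e.symm y)).2 * Z.2) (hA' v)
  refine ⟨⟨⟨ho, contDiff_fst.comp_contDiffOn hsm, fun y _ => hf.norm_fst _⟩,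
    ⟨ho, contDiff_snd.comp_contDiffOn hsm, fun y _ => hf.norm_snd _⟩, ?_, ?_⟩, key⟩
  · intro y hy v h1 h2
    obtain ⟨A, hA⟩ := key y hy
    rw [(hA v).1] at h1
    rw [(hA v).2] at h2
    have h3 : diff f (e.symm y) (A v) = 0 := by
      rw [diff_eq_leftVec (hf.norm_fst _) (hf.norm_snd _), h1, h2]
      simp [leftVec]
    have h4 := (injective_iff_map_eq_zero _).1 (hf.immersion (e.symm y)) _ h3
    exact A.map_eq_zero_iff.1 h4
  · intro y hy v w
    obtain ⟨A, hA⟩ := key y hy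
    have h1 := hf.lagrangian (e.symm y) (A v) (A w)
    rw [diff_eq_leftVec (hf.norm_fst _) (hf.norm_snd _),
      diff_eq_leftVec (hf.norm_fst _) (hf.norm_snd _),
      g_J_leftVec _ _ _ (hf.norm_fst _) (hf.norm_snd _), mul_eq_zero] at h1
    have h2 := h1.resolve_left (by positivity)
    rw [(hA v).1, (hA v).2, (hA w).1, (hA w).2, sub_eq_zero.1 h2, real_inner_comm]

theorem isLagrangianPair_forms (hf : IsLagrangianImmersion f) (x : M) :
    IsLagrangianPair (fstForm f x) (sndForm f x) := by
  suffices H : ∀ y ∈ (extChartAt (𝓡 3) x).target,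
      IsLagrangianPair (fstForm f ((extChartAt (𝓡 3) x).symm y))
        (sndForm f ((extChartAt (𝓡 3) x).symm y)) by
    have h1 := H _ (mem_extChartAt_target x)
    rwa [extChartAt_to_inv x] at h1
  intro y hy
  obtain ⟨h, hA⟩ := isLagrangianPatch_chart hf x
  obtain ⟨A, hA⟩ := hA y hy
  have hp := h.isLagrangianPair hy
  have ha : ∀ X, fstForm f _ X =
      mc (fun y => (f ((extChartAt (𝓡 3) x).symm y)).1) y (A.symm X) := fun X => by
    rw [(hA _).1, A.apply_symm_apply]
  have hb : ∀ X, sndForm f _ X =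
      mc (fun y => (f ((extChartAt (𝓡 3) x).symm y)).2) y (A.symm X) := fun X => by
    rw [(hA _).2, A.apply_symm_apply]
  refine ⟨fun X => ?_, fun X => ?_, fun X h1 h2 => ?_, fun X Y => ?_, fun X Y Z => ?_⟩
  · rw [ha]; exact hp.re_fst _
  · rw [hb]; exact hp.re_snd _
  · rw [ha] at h1
    rw [hb] at h2
    exact A.symm.map_eq_zero_iff.1 (hp.injective _ h1 h2)
  · simp only [ha, hb]; exact hp.symm _ _
  · simp only [ha, hb]; exact hp.cubic _ _ _

end Charts

/-! ### The rank of the first component -/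

section Rank

variable {M : Type*} [TopologicalSpace M] [ChartedSpace (EuclideanSpace ℝ (Fin 3)) M]
  {f : M → HH}

theorem finrank_tangentSpace (x : M) : Module.finrank ℝ (TangentSpace (𝓡 3) x) = 3 := by
  change Module.finrank ℝ (EuclideanSpace ℝ (Fin 3)) = 3
  simp

instance finiteDimensional_tangentSpace (x : M) : FiniteDimensional ℝ (TangentSpace (𝓡 3) x) :=
  inferInstanceAs (FiniteDimensional ℝ (EuclideanSpace ℝ (Fin 3)))

theorem fstForm_eq_zero_iff (hf : IsLagrangianImmersion f) {x : M} {X : TangentSpace (𝓡 3) x} :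
    fstForm f x X = 0 ↔ diff (fstMap f) x X = 0 := by
  rw [diff_fstMap hf, fstForm_apply, mul_eq_zero, or_iff_right]
  exact star_ne_zero.2 (ne_zero_of_norm (hf.norm_fst x))

theorem ker_fstForm (hf : IsLagrangianImmersion f) (x : M) :
    LinearMap.ker (fstForm f x) =
      LinearMap.ker (diff (fstMap f) x : TangentSpace (𝓡 3) x →ₗ[ℝ] ℍ[ℝ]) := by
  ext X
  exact fstForm_eq_zero_iff hf

theorem rankAt_add_finrank_ker (hf : IsLagrangianImmersion f) (x : M) :
    rankAt (fstMap f) x + Module.finrank ℝ (LinearMap.ker (fstForm f x)) = 3 := by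
  rw [ker_fstForm hf]
  exact (LinearMap.finrank_range_add_finrank_ker _).trans (finrank_tangentSpace x)

theorem fstForm_not_injective (hf : IsLagrangianImmersion f)
    (hr : NowhereMaximalRank (fstMap f)) (x : M) : ¬ Function.Injective (fstForm f x) := by
  intro h
  have h1 := rankAt_add_finrank_ker hf x
  rw [LinearMap.ker_eq_bot.2 h, finrank_bot] at h1
  have := hr x
  omega

theorem fstForm_eq_zero_iff' (hf : IsLagrangianImmersion f) {x : M} :
    fstForm f x = 0 ↔ diff (fstMap f) x = 0 := by
  constructor
  · intro h
    ext1 X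
    exact (fstForm_eq_zero_iff hf).1 (by rw [h]; rfl)
  · intro h
    ext1 X
    exact (fstForm_eq_zero_iff hf).2 (by rw [h]; rfl)

variable [IsManifold (𝓡 3) ∞ M]

/-- The rank of `dp` is two or zero. -/
theorem mem_regularSet_iff (hf : IsLagrangianImmersion f)
    (hr : NowhereMaximalRank (fstMap f)) {x : M} :
    x ∈ regularSet (fstMap f) ↔ fstForm f x ≠ 0 := by
  have h1 := rankAt_add_finrank_ker hf x
  constructor
  · intro h h0
    have h : rankAt (fstMap f) x = 2 := h
    rw [h0, LinearMap.ker_zero, finrank_top, finrank_tangentSpace] at h1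
    omega
  · intro h0
    rw [(isLagrangianPair_forms hf x).finrank_ker (fstForm_not_injective hf hr x) h0] at h1
    change rankAt (fstMap f) x = 2
    omega

end Rank

section Branched

variable {M : Type*} [TopologicalSpace M] [ChartedSpace (EuclideanSpace ℝ (Fin 3)) M]
  [IsManifold (𝓡 3) ∞ M] {f : M → HH}

/-! ### The case `dp = 0` -/

/-- If `p` is constant, the immersion parametrises an open part of a fibre `{p} × S³`, which is
totally geodesic. -/
theorem isTotallyGeodesic_of_fstForm_eq_zero (hf : IsLagrangianImmersion f)
    (h0 : ∀ x, fstForm f x = 0) : IsTotallyGeodesic f := by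
  intro Y _ x X
  have hpr := isLagrangianPair_forms hf x
  have hcoord : ∀ (y : M) (Z : TangentSpace (𝓡 3) y),
      leftCoord (f y) (diff f y Z) = (0, sndForm f y Z) := by
    intro y Z
    rw [diff_eq_leftVec (hf.norm_fst y) (hf.norm_snd y),
      leftCoord_leftVec _ _ (ne_zero_of_norm (hf.norm_fst y)) (ne_zero_of_norm (hf.norm_snd y)),
      h0 y]
    rfl
  -- the field takes its values in the tangent spaces of the second factor
  let F : M → HH := fun y => leftCoord (f y) (diff f y (Y y))
  have hF : ∀ y, F y = (0, sndForm f y (Y y)) := fun y => hcoord y (Y y)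
  -- `diff F x` is zero by convention where `F` is not differentiable, so that the smoothness of the
  -- field is not needed
  obtain ⟨hF1, hF2⟩ : (diff F x X).1 = 0 ∧ (diff F x X).2.re = 0 := by
    by_cases hd : MDifferentiableAt (𝓡 3) 𝓘(ℝ, HH) F x
    · have key : ∀ L : HH →L[ℝ] ℝ, (∀ y, L (F y) = 0) → L (diff F x X) = 0 := by
        intro L hL
        have h1 := (mdifferentiableAt_clm_comp hd L).2
        have h2 : (fun y => L (F y)) = fun _ => (0 : ℝ) := funext hL
        rw [h2] at h1
        have h3 : diff (fun _ : M => (0 : ℝ)) x = 0 := mfderiv_const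
        rw [h3] at h1
        exact (congrArg (fun A : TangentSpace (𝓡 3) x →L[ℝ] ℝ => A X) h1).symm
      constructor
      · have h1 := key ((innerSL ℝ (diff F x X).1).comp (ContinuousLinearMap.fst ℝ ℍ[ℝ] ℍ[ℝ]))
          fun y => by
            rw [hF]
            exact inner_zero_right (𝕜 := ℝ) (diff F x X).1
        exact inner_self_eq_zero.1 h1
      · have h1 := key (reCLM.comp (ContinuousLinearMap.snd ℝ ℍ[ℝ] ℍ[ℝ])) fun y => by
          rw [hF]
          exact (reCLM_apply _).trans ((isLagrangianPair_forms hf y).re_snd _)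
        exact (reCLM_apply _).symm.trans h1
    · have h1 : diff F x = 0 := mfderiv_zero_of_not_mdifferentiableAt hd
      rw [h1]
      exact ⟨rfl, rfl⟩
  have hinj : Function.Injective (sndForm f x) :=
    (injective_iff_map_eq_zero _).2 fun Z hZ => hpr.injective Z (by rw [h0]; rfl) hZ
  obtain ⟨Z, hZ⟩ := exists_eq_of_injective (finrank_tangentSpace x) hinj hpr.re_snd
    (z := (diff F x X).2 + cross (sndForm f x X) (sndForm f x (Y x))) (by
      rw [Quaternion.re_add, hF2, cross_re, add_zero])
  refine ⟨Z, ?_⟩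
  have hW : covDeriv f (fun y => diff f y (Y y)) x X =
      leftVec (f x) (diff F x X + Gam (leftCoord (f x) (diff f x X)) (F x)) := rfl
  rw [hW, diff_eq_leftVec (hf.norm_fst x) (hf.norm_snd x), hZ, h0 x, hcoord, hF]
  congr 1
  ext1
  · simp [Gam, hF1]
  · simp [Gam]

/-! ### The first component as a branched minimal surface -/

theorem mc_chart_eq_zero_iff (hf : IsLagrangianImmersion f) (x₀ : M) {y : E3}
    (hy : y ∈ (extChartAt (𝓡 3) x₀).target) :
    mc (fun y => (f ((extChartAt (𝓡 3) x₀).symm y)).1) y = 0 ↔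
      fstForm f ((extChartAt (𝓡 3) x₀).symm y) = 0 := by
  obtain ⟨A, hA⟩ := (isLagrangianPatch_chart hf x₀).2 y hy
  constructor
  · intro h
    ext1 X
    have h1 := (hA (A.symm X)).1
    rw [h, A.apply_symm_apply] at h1
    exact h1.symm
  · intro h
    ext1 v
    rw [(hA v).1, h]
    rfl

theorem isOpen_setOf_fstForm_ne_zero (hf : IsLagrangianImmersion f) :
    IsOpen {x | fstForm f x ≠ 0} := by
  rw [isOpen_iff_mem_nhds]
  intro x hx
  have hy := mem_extChartAt_target (I := 𝓡 3) x
  have hp := (isLagrangianPatch_chart hf x).1.fst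
  have hx' : fstForm f ((extChartAt (𝓡 3) x).symm (extChartAt (𝓡 3) x x)) ≠ 0 := by
    rwa [extChartAt_to_inv x]
  rw [Ne, ← mc_chart_eq_zero_iff hf x hy] at hx'
  obtain ⟨v, hv⟩ : ∃ v, mc (fun y => (f ((extChartAt (𝓡 3) x).symm y)).1)
      (extChartAt (𝓡 3) x x) v ≠ 0 := by
    by_contra! hcon
    exact hx' (LinearMap.ext hcon)
  have h1 := (hp.contDiffAt_mc hy v).continuousAt.eventually_ne hv
  filter_upwards [(continuousAt_extChartAt (I := 𝓡 3) x).eventually h1,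
    (isOpen_extChartAt_source (I := 𝓡 3) x).mem_nhds (mem_extChartAt_source x)] with x' h2 h3
  have h4 := (extChartAt (𝓡 3) x).map_source h3
  intro h5
  refine h2 ?_
  rw [(mc_chart_eq_zero_iff hf x h4).2 (by rwa [(extChartAt (𝓡 3) x).left_inv h3])]
  rfl

/-- By unique continuation, the set of the points near which `p` is constant is closed. -/
theorem isClosed_interior_fstForm_eq_zero (hf : IsLagrangianImmersion f) :
    IsClosed (interior {x | fstForm f x = 0}) := by
  refine isClosed_of_closure_subset fun x hx => ?_
  have hx0 : fstForm f x = 0 := by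
    have h1 : IsClosed {x | fstForm f x = 0} := by
      have := (isOpen_setOf_fstForm_ne_zero hf).isClosed_compl
      convert! this using 1
      ext x
      simp
    exact h1.closure_subset_iff.2 interior_subset hx
  have hy := mem_extChartAt_target (I := 𝓡 3) x
  have hzero : ∀ y ∈ (extChartAt (𝓡 3) x).target, _ := fun y hy => mc_chart_eq_zero_iff hf x hy
  set e := extChartAt (𝓡 3) x with he
  obtain ⟨W, hWo, hxW, hWt, hW⟩ :=
    (isLagrangianPatch_chart hf x).1.exists_nhds_unique_continuation hy
      ((hzero _ hy).2 (by rwa [he, extChartAt_to_inv x]))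
  have hVo : IsOpen (e.source ∩ e ⁻¹' W) :=
    (continuousOn_extChartAt x).isOpen_inter_preimage (isOpen_extChartAt_source x) hWo
  obtain ⟨x₁, hx₁, hx₁U⟩ := mem_closure_iff.1 hx _ hVo ⟨mem_extChartAt_source x, hxW⟩
  have h1 : ∀ᶠ y in nhds (e x₁), mc (fun y => (f (e.symm y)).1) y = 0 := by
    have hc : ContinuousAt e.symm (e x₁) := continuousAt_extChartAt_symm'' (e.map_source hx₁.1)
    have hU : ∀ᶠ x' in nhds (e.symm (e x₁)), fstForm f x' = 0 := by
      rw [e.left_inv hx₁.1]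
      exact mem_interior_iff_mem_nhds.1 hx₁U
    filter_upwards [hc.eventually hU,
      (isOpen_extChartAt_target x).mem_nhds (e.map_source hx₁.1)] with y a1 a2
    exact (hzero y a2).2 a1
  have h2 := hW _ hx₁.2 h1
  rw [mem_interior_iff_mem_nhds]
  filter_upwards [(continuousAt_extChartAt (I := 𝓡 3) x).eventually h2,
    (isOpen_extChartAt_source (I := 𝓡 3) x).mem_nhds (mem_extChartAt_source x)] with x' a1 a2
  have h3 := (hzero _ (e.map_source a2)).1 a1
  rwa [e.left_inv a2] at h3

theorem exists_isLocalSurface (hf : IsLagrangianImmersion f)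
    (hr : NowhereMaximalRank (fstMap f)) {x : M} (hx : fstForm f x ≠ 0) :
    ∃ (V : Set M) (D : Set Plane) (φ N : Plane → ℍ[ℝ]) (π : M → Plane),
      x ∈ V ∧ IsLocalSurface (fstMap f) V D φ N π := by
  obtain ⟨hp, hA⟩ := isLagrangianPatch_chart hf x
  have hy := mem_extChartAt_target (I := 𝓡 3) x
  have hx' : mc (fun y => (f ((extChartAt (𝓡 3) x).symm y)).1) (extChartAt (𝓡 3) x x) ≠ 0 := by
    rw [Ne, mc_chart_eq_zero_iff hf x hy]
    rwa [extChartAt_to_inv x]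
  set e := extChartAt (𝓡 3) x with he
  set pc : E3 → ℍ[ℝ] := fun y => (f (e.symm y)).1 with hpc
  have hfd : ∀ y ∈ e.target, ∀ v, pc y * mc pc y v = fderiv ℝ pc y v := fun y hy v =>
    mul_mc (hp.fst.norm_eq y hy) v
  have hni : ∀ y ∈ e.target, ¬ Function.Injective (fderiv ℝ pc y) := by
    intro y hy hi
    obtain ⟨A, hA⟩ := hA y hy
    refine fstForm_not_injective hf hr (e.symm y) ((injective_iff_map_eq_zero _).2 fun X hX => ?_)
    have h1 := (hA (A.symm X)).1
    rw [A.apply_symm_apply, hX] at h1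
    have h2 : fderiv ℝ pc y (A.symm X) = 0 := by
      rw [← hfd y hy, h1, mul_zero]
    exact A.symm.map_eq_zero_iff.1 ((injective_iff_map_eq_zero _).1 hi _ h2)
  obtain ⟨W, L, D, φ, N, hWo, hxW, hWt, hmin, himg, hfac, hsurj⟩ :=
    hp.exists_local_surface (by simp) hni hy (fun h0 => hx' (by
      ext1 v
      rw [mc_apply, h0]
      simp))
  refine ⟨e.source ∩ e ⁻¹' W, D, φ, N, fun x => L (fstMap f x),
    ⟨mem_extChartAt_source x, hxW⟩, ?_, hmin, ?_, ?_, ?_, ?_⟩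
  · exact (continuousOn_extChartAt x).isOpen_inter_preimage (isOpen_extChartAt_source x) hWo
  · exact (L.contMDiff.comp (contMDiff_fstMap hf)).contMDiffOn
  · -- transfer of the surjectivity from the chart
    have key : ∀ y ∈ W, Function.Surjective (diff (fun x => L (fstMap f x)) (e.symm y)) := by
      intro y hy w
      obtain ⟨v, hv⟩ := hsurj y hy w
      obtain ⟨A, hA⟩ := hA y (hWt hy)
      refine ⟨A v, ?_⟩
      rw [(mdifferentiableAt_clm_comp (mdifferentiableAt_fstMap hf _) L).2]
      change L (diff (fstMap f) (e.symm y) (A v)) = w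
      change L (fderiv ℝ pc y v) = w at hv
      rw [← hv, ← hfd y (hWt hy), (hA v).1, diff_fstMap hf,
        diff_eq_leftVec (hf.norm_fst _) (hf.norm_snd _)]
      rfl
    intro x' hx'
    have h1 := key _ hx'.2
    rwa [e.left_inv hx'.1] at h1
  · rw [← himg]
    ext w
    constructor
    · rintro ⟨x', hx', rfl⟩
      refine ⟨e x', hx'.2, ?_⟩
      simp only [hpc, e.left_inv hx'.1, fstMap]
    · rintro ⟨y, hy, rfl⟩
      refine ⟨e.symm y, ⟨e.map_target (hWt hy), ?_⟩, rfl⟩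
      rw [Set.mem_preimage, e.right_inv (hWt hy)]
      exact hy
  · intro x' hx'
    have h1 := hfac _ hx'.2
    simp only [hpc, e.left_inv hx'.1] at h1
    exact h1

/-- Density of the regular set: the open set of the points near which `dp = 0` is closed, and it is not
all of the connected manifold `M`, for the immersion would then be totally geodesic. -/
theorem isBranchedMinimalSurface_fstMap [ConnectedSpace M] (hf : IsLagrangianImmersion f)
    (hr : NowhereMaximalRank (fstMap f)) (hg : ¬ IsTotallyGeodesic f) :
    IsBranchedMinimalSurface (fstMap f) := by
  have hR : regularSet (fstMap f) = {x | fstForm f x ≠ 0} := by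
    ext x
    exact mem_regularSet_iff hf hr
  refine ⟨?_, ?_, ?_, ?_⟩
  · rw [hR]
    exact isOpen_setOf_fstForm_ne_zero hf
  · have h1 : IsClopen (interior {x | fstForm f x = 0}) :=
      ⟨isClosed_interior_fstForm_eq_zero hf, isOpen_interior⟩
    rw [hR]
    refine (interior_eq_empty_iff_dense_compl (s := {x | fstForm f x = 0})).1 ?_
    rcases isClopen_iff.1 h1 with h2 | h2
    · exact h2
    · have h3 : ∀ x, x ∈ interior {x | fstForm f x = 0} := fun x => by
        rw [h2]
        trivial
      have h4 : ∀ x, x ∈ {x | fstForm f x = 0} := fun x => interior_subset (h3 x)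
      exact absurd (isTotallyGeodesic_of_fstForm_eq_zero hf h4) hg
  · intro x hx
    rw [hR] at hx
    exact (fstForm_eq_zero_iff' hf).1 (not_not.1 hx)
  · intro x hx
    exact exists_isLocalSurface hf hr ((mem_regularSet_iff hf hr).1 hx)

end Branched

/-! ### The frame bundle of the minimal surface -/

section SO4

/-- The matrix of an orthonormal quadruple of quaternions is orthogonal. -/
theorem frameMatrix_mem_orthogonalGroup {c : Fin 4 → ℍ[ℝ]}
    (h : ∀ i j, inner ℝ (c i) (c j) = if i = j then (1 : ℝ) else 0) :
    frameMatrix (c 0) (c 1) (c 2) (c 3) ∈ Matrix.orthogonalGroup (Fin 4) ℝ := by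
  rw [Matrix.mem_orthogonalGroup_iff']
  have hc : ![c 0, c 1, c 2, c 3] = c := by
    ext1 i
    fin_cases i <;> rfl
  ext i j
  rw [Matrix.mul_apply, Matrix.one_apply, ← h i j, inner_eq]
  simp only [frameMatrix, hc, Matrix.transpose_apply, Matrix.of_apply, Fin.sum_univ_four]
  rfl

/-- Left multiplication by `p` on the quaternions has determinant `‖p‖ ^ 4`. -/
theorem det_frameMatrix_left_mul (p a b c d : ℍ[ℝ]) :
    (frameMatrix (p * a) (p * b) (p * c) (p * d)).det =
      (‖p‖ ^ 2) ^ 2 * (frameMatrix a b c d).det := by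
  have h1 : frameMatrix (p * a) (p * b) (p * c) (p * d) =
      !![p.re, -p.imI, -p.imJ, -p.imK; p.imI, p.re, -p.imK, p.imJ;
        p.imJ, p.imK, p.re, -p.imI; p.imK, -p.imJ, p.imI, p.re] * frameMatrix a b c d := by
    ext i j
    fin_cases i <;> fin_cases j <;>
      simp [frameMatrix, quatCoord, Matrix.mul_apply, Fin.sum_univ_four] <;> ring
  rw [h1, Matrix.det_mul, norm_sq_eq]
  congr 1
  simp [Matrix.det_succ_row_zero, Fin.sum_univ_succ, Fin.succAbove]
  ring

theorem IsPosFrame.det_frameMatrix {w u v : ℍ[ℝ]} (h : IsPosFrame w u v) :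
    (frameMatrix 1 u v w).det = 1 := by
  have h1 : (frameMatrix 1 u v w).det = inner ℝ w (cross u v) := by
    simp [frameMatrix, quatCoord, Matrix.det_succ_row_zero, Fin.sum_univ_succ, Fin.succAbove,
      h.re_w, inner_eq]
    ring
  rw [h1, ← h.cross_uv, h.norm_w]

theorem IsPosFrame.frameMatrix_mem {p w u v : ℍ[ℝ]} (h : IsPosFrame w u v) (hp : ‖p‖ = 1) :
    frameMatrix p (p * u) (p * v) (p * w) ∈ Matrix.specialOrthogonalGroup (Fin 4) ℝ := by
  have h1 : frameMatrix p (p * u) (p * v) (p * w) =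
      frameMatrix (p * 1) (p * u) (p * v) (p * w) := by rw [mul_one]
  rw [Matrix.mem_specialOrthogonalGroup_iff]
  constructor
  · refine frameMatrix_mem_orthogonalGroup (c := ![p, p * u, p * v, p * w]) ?_
    have hc : ![p, p * u, p * v, p * w] = fun i => p * (![1, u, v, w] i) := by
      ext1 i
      fin_cases i <;> simp
    have hr : ∀ a : ℍ[ℝ], a.re = 0 → inner ℝ (1 : ℍ[ℝ]) a = 0 ∧ inner ℝ a (1 : ℍ[ℝ]) = 0 := by
      intro a ha
      simp [inner_eq, ha]
    have hn : ∀ a : ℍ[ℝ], inner ℝ a a = (1 : ℝ) → ‖a‖ = 1 := by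
      intro a ha
      rw [real_inner_self_eq_norm_sq] at ha
      exact (sq_eq_sq₀ (norm_nonneg _) zero_le_one).1 (by rw [ha]; norm_num)
    intro i j
    rw [hc, inner_mul_left_of_norm hp]
    fin_cases i <;> fin_cases j <;>
      simp [hr _ h.re_u, hr _ h.re_v, hr _ h.re_w, hn _ h.norm_u, hn _ h.norm_v, hn _ h.norm_w,
        h.orth, h.inner_wu, h.inner_wv, real_inner_comm u v, real_inner_comm w u, real_inner_comm w v]
  · rw [h1, det_frameMatrix_left_mul, hp, h.det_frameMatrix]
    norm_num

end SO4

section Frames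

variable {M : Type*} [TopologicalSpace M] [ChartedSpace (EuclideanSpace ℝ (Fin 3)) M]
  {f : M → HH}

theorem exists_adaptedFrame [IsManifold (𝓡 3) ∞ M] (hf : IsLagrangianImmersion f)
    (hr : NowhereMaximalRank (fstMap f)) (x : M) :
    ∃ (e : Fin 3 → TangentSpace (𝓡 3) x) (Λ : ℝ),
      0 ≤ Λ ∧ Λ ≤ Real.pi / 2 ∧ IsAdaptedFrame f x e Λ := by
  obtain ⟨e, Λ, w, u, v, h0, h1, h⟩ := (isLagrangianPair_forms hf x).exists_normalFrame
    (finrank_tangentSpace x) (fstForm_not_injective hf hr x)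
  exact ⟨e, Λ, h0, h1, adaptedFrame_of_normalFrame (hf.norm_fst x) (hf.norm_snd x) h⟩

theorem fstForm_ne_zero_iff_sin_ne_zero [IsManifold (𝓡 3) ∞ M] (hf : IsLagrangianImmersion f)
    {x : M} {e : Fin 3 → TangentSpace (𝓡 3) x} {Λ : ℝ} {w u v : ℍ[ℝ]}
    (h : IsNormalFrame (fstForm f x) (sndForm f x) e Λ w u v) :
    fstForm f x ≠ 0 ↔ Real.sin Λ ≠ 0 := by
  have hp := h.posFrame
  have hu0 : u ≠ 0 := by
    rintro rfl
    simpa using hp.norm_u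
  have hs3 : Real.sqrt 3 ≠ 0 := by positivity
  constructor
  · intro h0 hs
    obtain ⟨Z, hZ⟩ : ∃ Z, fstForm f x Z ≠ 0 := by
      by_contra! hcon
      exact h0 (LinearMap.ext hcon)
    -- if `sin Λ = 0`, then both `e 0` and `e 1` are in the kernel, which is a line
    have h1 : fstForm f x (e 1) = 0 := by rw [h.fst_one, hs, zero_smul]
    have hw0 : w ≠ 0 := by
      rintro rfl
      simpa using hp.norm_w
    have he0 : e 0 ≠ 0 := by
      intro h2
      have h3 := h.snd_zero
      rw [h2, map_zero, eq_comm, smul_eq_zero] at h3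
      rcases h3 with h3 | h3
      · exact hs3 (by linarith)
      · exact hw0 h3
    obtain ⟨c, hc⟩ := (isLagrangianPair_forms hf x).exists_smul_of_mem_ker h.fst_zero h1 he0 hZ
    have h4 := congrArg (fun X => (inner ℝ (sndForm f x X) u : ℝ)) hc
    simp only [map_smul, h.snd_zero, h.snd_one, inner_smul_left, hp.inner_wu, hp.norm_u,
      conj_trivial, mul_zero, mul_one, hs, zero_div, zero_sub] at h4
    have h5 : Real.cos Λ = 0 := by
      have : Real.sqrt 3 / 2 * Real.cos Λ = 0 := by linarith
      exact (mul_eq_zero.1 this).resolve_left (by positivity)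
    have := Real.sin_sq_add_cos_sq Λ
    rw [hs, h5] at this
    norm_num at this
  · intro hs h0
    have h1 := h.fst_one
    rw [h0, LinearMap.zero_apply, eq_comm, smul_eq_zero] at h1
    exact h1.elim hs hu0

/-- In an adapted frame, `ξ = (p w, 0)`. -/
theorem xi_eq {x : M} (h1 : ‖(f x).1‖ = 1) (h2 : ‖(f x).2‖ = 1)
    {e : Fin 3 → TangentSpace (𝓡 3) x} {Λ : ℝ} {w u v : ℍ[ℝ]}
    (h : IsNormalFrame (fstForm f x) (sndForm f x) e Λ w u v) :
    xi f x e = ((f x).1 * w, 0) := by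
  have hs3 : Real.sqrt 3 * Real.sqrt 3 = 3 := Real.mul_self_sqrt (by norm_num)
  have hs0 : Real.sqrt 3 ≠ 0 := by positivity
  rw [xi, diff_eq_leftVec h1 h2, J_leftVec _ _ (ne_zero_of_norm h1) (ne_zero_of_norm h2), J_one,
    ← leftVec_smul, ← leftVec_sub, h.fst_zero, h.snd_zero]
  have h3 : (1 / Real.sqrt 3) • ((0, -(Real.sqrt 3 / 2) • w) : HH) - (1 / Real.sqrt 3) •
      ((2 : ℝ) • -(Real.sqrt 3 / 2) • w - 0, -(Real.sqrt 3 / 2) • w - (2 : ℝ) • 0) = (w, 0) := by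
    ext1
    · simp only [Prod.fst_sub, Prod.smul_fst]
      match_scalars
      field_simp
    · simp
  change leftVec (f x) ((1 / Real.sqrt 3) • ((0, -(Real.sqrt 3 / 2) • w) : HH)
    - (1 / Real.sqrt 3) • ((2 : ℝ) • -(Real.sqrt 3 / 2) • w - 0,
      -(Real.sqrt 3 / 2) • w - (2 : ℝ) • 0)) = _
  rw [h3]
  simp [leftVec]

theorem diff_fstMap_eq (hf : IsLagrangianImmersion f) (x : M) (X : TangentSpace (𝓡 3) x) :
    diff (fstMap f) x X = (f x).1 * fstForm f x X := by
  rw [diff_fstMap hf, diff_eq_leftVec (hf.norm_fst x) (hf.norm_snd x)]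
  rfl

theorem inv_sin_smul_diff (hf : IsLagrangianImmersion f) {x : M} {X : TangentSpace (𝓡 3) x}
    {Λ : ℝ} {u : ℍ[ℝ]} (h : fstForm f x X = Real.sin Λ • u) (hs : Real.sin Λ ≠ 0) :
    (Real.sin Λ)⁻¹ • diff (fstMap f) x X = (f x).1 * u := by
  rw [diff_fstMap_eq hf, h, mul_smul_comm, smul_smul, inv_mul_cancel₀ hs, one_smul]

theorem liftMatrix_eq (hf : IsLagrangianImmersion f) {x : M}
    {e : Fin 3 → TangentSpace (𝓡 3) x} {Λ : ℝ} {w u v : ℍ[ℝ]}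
    (h : IsNormalFrame (fstForm f x) (sndForm f x) e Λ w u v) (hs : Real.sin Λ ≠ 0) :
    liftMatrix f x e Λ =
      frameMatrix (f x).1 ((f x).1 * u) ((f x).1 * v) ((f x).1 * w) := by
  rw [liftMatrix, inv_sin_smul_diff hf h.fst_one hs, inv_sin_smul_diff hf h.fst_two hs,
    xi_eq (hf.norm_fst x) (hf.norm_snd x) h]
  rfl

section Surface

variable {V : Set M} {D : Set Plane} {φ N : Plane → ℍ[ℝ]} {π : M → Plane}

theorem IsLocalSurface.mem (h : IsLocalSurface (fstMap f) V D φ N π) {x : M} (hx : x ∈ V) :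
    π x ∈ D := h.image_eq ▸ Set.mem_image_of_mem π hx

theorem IsLocalSurface.diff_eq (h : IsLocalSurface (fstMap f) V D φ N π) {x : M} (hx : x ∈ V)
    (X : TangentSpace (𝓡 3) x) :
    diff (fstMap f) x X = fderiv ℝ φ (π x) (diff π x X) := by
  have h1 : MDifferentiableAt (𝓡 3) 𝓘(ℝ, Plane) π x :=
    (h.smooth.contMDiffAt (h.isOpen.mem_nhds hx)).mdifferentiableAt (by simp)
  have h2 : DifferentiableAt ℝ φ (π x) :=
    (h.surface.smooth.contDiffAt (h.surface.isOpen.mem_nhds (h.mem hx))).differentiableAt (by simp)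
  have h3 := (h2.hasFDerivAt.hasMFDerivAt.comp x h1.hasMFDerivAt).mfderiv
  have h4 : fstMap f =ᶠ[nhds x] φ ∘ π := by
    filter_upwards [h.isOpen.mem_nhds hx] with y hy
    exact h.factor y hy
  have h5 : diff (fstMap f) x = mfderiv (𝓡 3) 𝓘(ℝ, ℍ[ℝ]) (φ ∘ π) x := h4.mfderiv_eq
  rw [h5, h3]
  rfl

/-- At a point of a local surface, `ξ` is one of the two unit normals of the surface. -/
theorem xi_eq_normal (hf : IsLagrangianImmersion f) (h : IsLocalSurface (fstMap f) V D φ N π)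
    {x : M} (hx : x ∈ V) {e : Fin 3 → TangentSpace (𝓡 3) x} {Λ : ℝ} {w u v : ℍ[ℝ]}
    (he : IsNormalFrame (fstForm f x) (sndForm f x) e Λ w u v) (hs : Real.sin Λ ≠ 0) :
    (xi f x e).1 = N (π x) ∨ (xi f x e).1 = -N (π x) := by
  have hn := hf.norm_fst x
  have hp := he.posFrame
  rw [xi_eq (hf.norm_fst x) (hf.norm_snd x) he]
  have hmem := h.mem hx
  set z := star (f x).1 * N (π x) with hz
  have hNz : N (π x) = (f x).1 * z := by
    rw [hz, ← mul_assoc, self_mul_star_of_norm hn, one_mul]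
  have hre : z.re = 0 := by
    have h1 := h.surface.normal_sphere _ hmem
    rw [← h.factor x hx, hNz] at h1
    change inner ℝ ((f x).1 * z) (f x).1 = 0 at h1
    have h2 := inner_mul_left_of_norm hn z 1
    rw [mul_one, h1] at h2
    simpa [inner_eq] using h2.symm
  have htan : ∀ {X : TangentSpace (𝓡 3) x} {u : ℍ[ℝ]}, fstForm f x X = Real.sin Λ • u →
      inner ℝ z u = 0 := by
    intro X u hX
    have h1 := h.surface.normal_surface _ hmem (diff π x X)
    rw [← h.diff_eq hx, diff_fstMap_eq hf, hX, hNz, inner_mul_left_of_norm hn, inner_smul_right,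
      mul_eq_zero] at h1
    exact h1.resolve_left hs
  have h1 := hp.expand hre
  rw [htan he.fst_one, htan he.fst_two, zero_smul, zero_smul, zero_add, zero_add] at h1
  have h2 : ‖z‖ = 1 := by
    have := h.surface.normal_norm _ hmem
    rwa [hNz, norm_mul, hn, one_mul] at this
  have h3 : (inner ℝ z w : ℝ) * inner ℝ z w = 1 := by
    have h4 : inner ℝ z z = (1 : ℝ) := by rw [real_inner_self_eq_norm_sq, h2]; norm_num
    rw [h1, inner_smul_left, inner_smul_right, hp.norm_w] at h4
    simpa using h4
  rcases mul_self_eq_one_iff.1 h3 with h4 | h4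
  · left
    rw [hNz, h1, h4, one_smul]
  · right
    rw [hNz, h1, h4, neg_smul, one_smul, mul_neg, neg_neg]

theorem liftMatrix_mem_frameFiber (hf : IsLagrangianImmersion f)
    (h : IsLocalSurface (fstMap f) V D φ N π)
    {x : M} (hx : x ∈ V) {e : Fin 3 → TangentSpace (𝓡 3) x} {Λ : ℝ} {w u v : ℍ[ℝ]}
    (he : IsNormalFrame (fstForm f x) (sndForm f x) e Λ w u v) (hs : Real.sin Λ ≠ 0)
    {N' : Plane → ℍ[ℝ]} (hN : (xi f x e).1 = N' (π x)) :
    liftMatrix f x e Λ ∈ frameFiber φ N' (π x) := by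
  refine ⟨?_, (Real.sin Λ)⁻¹ • diff π x (e 1), (Real.sin Λ)⁻¹ • diff π x (e 2), ?_⟩
  · rw [liftMatrix_eq hf he hs]
    exact he.posFrame.frameMatrix_mem (hf.norm_fst x)
  · rw [liftMatrix, hN, h.factor x hx, map_smul, map_smul, ← h.diff_eq hx, ← h.diff_eq hx]

/-- A local surface lies in the regular set. -/
theorem IsLocalSurface.fstForm_ne_zero (hf : IsLagrangianImmersion f)
    (h : IsLocalSurface (fstMap f) V D φ N π) {x : M} (hx : x ∈ V) : fstForm f x ≠ 0 := by
  intro h0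
  obtain ⟨X, hX⟩ := h.submersion x hx (EuclideanSpace.single 0 1)
  have h1 := h.diff_eq hx X
  rw [hX, diff_fstMap_eq hf, h0, LinearMap.zero_apply, mul_zero] at h1
  have h2 := (injective_iff_map_eq_zero _).1 (h.surface.immersion _ (h.mem hx)) _ h1.symm
  simpa using congrArg (fun z : Plane => z 0) h2

end Surface

/-- The image of a continuous vector field under the differential of a smooth map is continuous, as a
vector valued function. -/
theorem continuousOn_diff_apply [IsManifold (𝓡 3) ∞ M] (hf : IsLagrangianImmersion f) {V : Set M}
    {Y : (x : M) → TangentSpace (𝓡 3) x}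
    (hY : ContinuousOn (fun x => (⟨x, Y x⟩ : TangentBundle (𝓡 3) M)) V) :
    ContinuousOn (fun x => diff f x (Y x)) V := by
  have : IsManifold (𝓡 3) 1 M := IsManifold.of_le (n := ∞) (by simp)
  have h1 : Continuous (tangentMap (𝓡 3) 𝓘(ℝ, HH) f) := hf.smooth.continuous_tangentMap (by simp)
  have h2 := (tangentBundleModelSpaceHomeomorph 𝓘(ℝ, HH)).continuous
  exact (continuous_snd.comp (h2.comp h1)).comp_continuousOn hY

end Frames

end NKS3

/-! ### The lift to the frame bundle -/

theorem mainTheorem2 {M : Type*} [TopologicalSpace M] [T2Space M] [ConnectedSpace M]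
    [ChartedSpace (EuclideanSpace ℝ (Fin 3)) M] [IsManifold (𝓡 3) ∞ M]
    (f : M → NKS3.HH) (hf : NKS3.IsLagrangianImmersion f)
    (hrank : NKS3.NowhereMaximalRank (NKS3.fstMap f))
    (hgeod : ¬ NKS3.IsTotallyGeodesic f) :
    -- `p(M)` is a (branched) minimal surface
    NKS3.IsBranchedMinimalSurface (NKS3.fstMap f) ∧
    -- adapted frames exist at every point
    (∀ x : M, ∃ (e : Fin 3 → TangentSpace (𝓡 3) x) (Λ : ℝ),
      0 ≤ Λ ∧ Λ ≤ Real.pi / 2 ∧ NKS3.IsAdaptedFrame f x e Λ) ∧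
    -- for each adapted frame, `Λ` detects the regular points, and there the matrix belongs to the
    -- frame bundle of the minimal surface, `ξ` being one of the two unit normals
    (∀ (x : M) (e : Fin 3 → TangentSpace (𝓡 3) x) (Λ : ℝ), NKS3.IsAdaptedFrame f x e Λ →
      (x ∈ NKS3.regularSet (NKS3.fstMap f) ↔ Real.sin Λ ≠ 0) ∧
      (NKS3.xi f x e).2 = 0 ∧
      (Real.sin Λ ≠ 0 →
        NKS3.liftMatrix f x e Λ ∈ Matrix.specialOrthogonalGroup (Fin 4) ℝ ∧
        ∀ (V : Set M) (D : Set NKS3.Plane) (φ N : NKS3.Plane → ℍ[ℝ]) (π : M → NKS3.Plane),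
          NKS3.IsLocalSurface (NKS3.fstMap f) V D φ N π → x ∈ V →
          NKS3.liftMatrix f x e Λ ∈ NKS3.frameFiber φ N (π x) ∨
          NKS3.liftMatrix f x e Λ ∈ NKS3.frameFiber φ (-N) (π x))) ∧
    -- along a smooth adapted frame field on a connected set, the unit normal does not change side
    (∀ (V : Set M) (D : Set NKS3.Plane) (φ N : NKS3.Plane → ℍ[ℝ]) (π : M → NKS3.Plane)
        (E : Fin 3 → (x : M) → TangentSpace (𝓡 3) x) (Λ : M → ℝ),
      NKS3.IsLocalSurface (NKS3.fstMap f) V D φ N π → IsPreconnected V →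
      (∀ i, ContMDiffOn (𝓡 3) (𝓡 3).tangent ∞
        (fun x => (⟨x, E i x⟩ : TangentBundle (𝓡 3) M)) V) →
      (∀ x ∈ V, NKS3.IsAdaptedFrame f x (fun i => E i x) (Λ x)) →
      (∀ x ∈ V, NKS3.liftMatrix f x (fun i => E i x) (Λ x) ∈ NKS3.frameFiber φ N (π x)) ∨
      (∀ x ∈ V, NKS3.liftMatrix f x (fun i => E i x) (Λ x) ∈ NKS3.frameFiber φ (-N) (π x))) := by
  have hnf : ∀ {x : M} {e : Fin 3 → TangentSpace (𝓡 3) x} {Λ : ℝ},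
      NKS3.IsAdaptedFrame f x e Λ → ∃ w u v : ℍ[ℝ],
        NKS3.IsNormalFrame (NKS3.fstForm f x) (NKS3.sndForm f x) e Λ w u v := fun he =>
    NKS3.normalFrame_of_adaptedFrame (hf.norm_fst _) (hf.norm_snd _)
      (NKS3.isLagrangianPair_forms hf _) he
  refine ⟨NKS3.isBranchedMinimalSurface_fstMap hf hrank hgeod, NKS3.exists_adaptedFrame hf hrank,
    ?_, ?_⟩
  · intro x e Λ he
    obtain ⟨w, u, v, h⟩ := hnf he
    refine ⟨(NKS3.mem_regularSet_iff hf hrank).trans (NKS3.fstForm_ne_zero_iff_sin_ne_zero hf h),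
      by rw [NKS3.xi_eq (hf.norm_fst x) (hf.norm_snd x) h], fun hs => ⟨?_, ?_⟩⟩
    · rw [NKS3.liftMatrix_eq hf h hs]
      exact h.posFrame.frameMatrix_mem (hf.norm_fst x)
    · intro V D φ N π hV hx
      exact (NKS3.xi_eq_normal hf hV hx h hs).imp
        (fun h1 => NKS3.liftMatrix_mem_frameFiber hf hV hx h hs h1)
        (fun h1 => NKS3.liftMatrix_mem_frameFiber hf hV hx h hs h1)
  · intro V D φ N π E Λ hV hc hE he
    have hs : ∀ x ∈ V, Real.sin (Λ x) ≠ 0 := by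
      intro x hx
      obtain ⟨w, u, v, h⟩ := hnf (he x hx)
      exact (NKS3.fstForm_ne_zero_iff_sin_ne_zero hf h).1 (hV.fstForm_ne_zero hf hx)
    have hxi : ∀ x ∈ V, (NKS3.xi f x fun i => E i x).1 = N (π x) ∨
        (NKS3.xi f x fun i => E i x).1 = -N (π x) := by
      intro x hx
      obtain ⟨w, u, v, h⟩ := hnf (he x hx)
      exact NKS3.xi_eq_normal hf hV hx h (hs x hx)
    have hlift : ∀ {N' : NKS3.Plane → ℍ[ℝ]}, ∀ x ∈ V,
        (NKS3.xi f x fun i => E i x).1 = N' (π x) →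
        NKS3.liftMatrix f x (fun i => E i x) (Λ x) ∈ NKS3.frameFiber φ N' (π x) := by
      intro N' x hx h1
      obtain ⟨w, u, v, h⟩ := hnf (he x hx)
      exact NKS3.liftMatrix_mem_frameFiber hf hV hx h (hs x hx) h1
    have hcN : ContinuousOn (fun x => N (π x)) V :=
      hV.surface.normal_smooth.continuousOn.comp hV.smooth.continuousOn fun x hx => hV.mem hx
    -- `ξ` is a continuous function of the frame
    have hcx : ContinuousOn (fun x => (NKS3.xi f x fun i => E i x).1) V := by
      have h1 := NKS3.continuousOn_diff_apply hf (hE 0).continuousOn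
      have hp : ContinuousOn (fun x => (f x).1) V :=
        (continuous_fst.comp hf.smooth.continuous).continuousOn
      have hq : ContinuousOn (fun x => star (f x).2) V :=
        ((NKS3.contDiff_star_quat (n := 0)).continuous.comp
          (continuous_snd.comp hf.smooth.continuous)).continuousOn
      have hd : ContinuousOn (fun x => (NKS3.diff f x (E 0 x)).2) V :=
        continuous_snd.comp_continuousOn h1
      have h2 : ContinuousOn (fun x => (f x).1 * (-(2 / Real.sqrt 3) •
          (star (f x).2 * (NKS3.diff f x (E 0 x)).2))) V :=
        hp.mul ((hq.mul hd).const_smul (-(2 / Real.sqrt 3)))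
      refine h2.congr fun x hx => ?_
      obtain ⟨w, u, v, h⟩ := hnf (he x hx)
      have h3 := h.snd_zero
      rw [NKS3.sndForm_apply] at h3
      have hs0 : Real.sqrt 3 ≠ 0 := by positivity
      simp only [NKS3.xi_eq (hf.norm_fst x) (hf.norm_snd x) h, h3, smul_smul]
      congr 1
      match_scalars
      field_simp
    have hinner : ∀ x ∈ V, inner ℝ (N (π x)) (N (π x)) = (1 : ℝ) := by
      intro x hx
      rw [real_inner_self_eq_norm_sq, hV.surface.normal_norm _ (hV.mem hx)]
      norm_num
    -- a change of sign would make the continuous function `⟨ξ, N ∘ π⟩` vanish somewhere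
    by_contra! hcon
    obtain ⟨⟨a, ha, ha'⟩, ⟨b, hb, hb'⟩⟩ := hcon
    have sa := (hxi a ha).resolve_left fun h1 => ha' (hlift a ha h1)
    have sb := (hxi b hb).resolve_right fun h1 => hb' (hlift b hb h1)
    obtain ⟨c, hcV, h0⟩ := hc.intermediate_value ha hb (hcx.inner (𝕜 := ℝ) hcN)
      (show (0 : ℝ) ∈ _ by
        simp only [sa, sb, inner_neg_left, hinner a ha, hinner b hb]
        constructor <;> norm_num)
    rcases hxi c hcV with h1 | h1
    · simp only [h1, hinner c hcV] at h0
      norm_num at h0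
    · simp only [h1, inner_neg_left, hinner c hcV] at h0
      norm_num at h0
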